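/- Let $n\ge 2$, let $\mathbb C\{x,x_1,\dots,x_n\}$ be the ring of convergent power series, and let $f\ne 0$ in it. Write $f=f_Nf_F$ with $f_F=\prod_k F_k^{m_k}$ and $f_N=u\prod_j f_j^{l_j}$, where $u$ is a unit, the $f_j,F_k$ are irreducible and pairwise non-associated, $F_k\in\mathbb C\{x_1,\dots,x_n\}$, and $f_j=0$ is non-fibered (not a union of orbits of $\partial/\partial x$). A homological equation $[\partial\alpha/\partial x=A/f]$, $A\in\mathbb C\{x,x_1,\dots,x_n\}$, is *free of residues* if, for all $P=(x^0,x_1^0,\dots,x_n^0)$ near $0$ with $f_N(P)=0$ and $f_N(x,x_1^0,\dots,x_n^0)\not\equiv 0$, the form $(A/f_N)(x,x_1^0,\dots,x_n^0)\,dx$ has residue $0$ at $x^0$. It is *special* if it has a solution $\alpha=\beta/(f_F\prod_j f_j^{l_j-1})$ with $\beta\in\mathbb C\{x,x_1,\dots,x_n\}$. Let $Fr(f)$ be the complex vector space of the equations that are free of residues, and let $Sp(f)\subset Fr(f)$ be the subspace of the special ones. Let $f_0=(x_2-xx_1)^2$ and $E_0=[\partial\alpha/\partial x=1/f_0]$.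 Then: 1. An equation $[\partial\alpha/\partial x=A/f_0]\in Fr(f_0)$ belongs to $Sp(f_0)$ if and only if $A\in(x_1,x_2)$. 2. $Fr(f_0)/Sp(f_0)=\mathbb C\{x_3,\dots,x_n\}E_0$. More precisely, $c\,E_0:=[\partial\alpha/\partial x=c/f_0]\in Fr(f_0)$ for all $c\in\mathbb C\{x_3,\dots,x_n\}$, and $c\mapsto c\,E_0+Sp(f_0)$ is a linear isomorphism from $\mathbb C\{x_3,\dots,x_n\}$ onto $Fr(f_0)/Sp(f_0)$. Hence $\dim_{\mathbb C}Fr(f_0)/Sp(f_0)=1$ if $n=2$, and $Fr(f_0)/Sp(f_0)$ is infinite dimensional if $n\ge 3$. 3. Let $n=2$. Let $\mathcal D_{f_0}$ be the set of germs of analytic diffeomorphisms $\varphi$ of $(\mathbb C^3,0)$ with $x_j\circ\varphi=x_j$ for $j=1,2$, $\frac{\partial(x\circ\varphi)}{\partial x}(0)=1$, and $(x\circ\varphi-x)/f_0$ a unit. Let $\varphi_1,\varphi_2\in\mathcal D_{f_0}$. Then there is a formal diffeomorphism $\hat\sigma$ of $(\mathbb C^3,0)$ with $x_j\circ\hat\sigma=x_j$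 for $j=1,2$, with $x\circ\hat\sigma-x\in\sqrt{(f_N)}$ for $f=x\circ\varphi_1-x$ (that is, $\hat\sigma$ is special), and with $\varphi_2\circ\hat\sigma=\hat\sigma\circ\varphi_1$, if and only if $$Res_{x_2-xx_1=0}(\varphi_1)\equiv Res_{x_2-xx_1=0}(\varphi_2)\quad\text{and}\quad \frac{\partial^2(x\circ\varphi_1)}{\partial x_2^2}(0)=\frac{\partial^2(x\circ\varphi_2)}{\partial x_2^2}(0).$$ Here $Res_{x_2-xx_1=0}(\varphi)$ is the function $P\mapsto Res(\varphi_P)$, where $\varphi_P$ is the restriction of $\varphi$ to the line $\{x_1=x_1(P),\,x_2=x_2(P)\}$, a one-variable germ at $P$. It is defined at those points $P$ near $0$ of the hypersurface $x_2-xx_1=0$ at which the order of contact of $\varphi_P$ with the identity is minimal. For a one-variable germ $\tau$ tangent to the identity, with $\tau=\exp(h(t)\,\partial/\partial t)$, $h\in(t^2)\subset\mathbb C[[t]]$, $h\neq 0$, the number $Res(\tau)$ is the residue at $t=0$ of $dt/h(t)$. -/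

import Mathlib

open Filter Topology

noncomputable section

/-- The ring `ℂ[[x, x₁, …, xₙ]]`; the variable `x` has index `0`. -/
abbrev Formal (n : ℕ) : Type := MvPowerSeries (Fin (n + 1)) ℂ

/-- Absolute convergence on some polydisc centred at the origin. -/
def IsConvergent {n : ℕ} (A : Formal n) : Prop :=
  ∃ r : ℝ, 0 < r ∧ Summable fun d : Fin (n + 1) →₀ ℕ => ‖MvPowerSeries.coeff d A‖ * r ^ d.degree

theorem IsConvergent.of_finite {n : ℕ} {A : Formal n}
    (h : {d | MvPowerSeries.coeff d A ≠ 0}.Finite) : IsConvergent A := by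
  refine ⟨1, one_pos, summable_of_hasFiniteSupport (h.subset fun d hd => ?_)⟩
  simp only [Function.mem_support, one_pow, mul_one, ne_eq, norm_eq_zero] at hd
  exact hd

theorem IsConvergent.mono {n : ℕ} {A : Formal n} {r s : ℝ} (hs : 0 < s) (hsr : s ≤ r)
    (h : Summable fun d : Fin (n + 1) →₀ ℕ => ‖MvPowerSeries.coeff d A‖ * r ^ d.degree) :
    Summable fun d : Fin (n + 1) →₀ ℕ => ‖MvPowerSeries.coeff d A‖ * s ^ d.degree := by
  refine h.of_nonneg_of_le (fun d => by positivity) fun d => ?_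
  gcongr

theorem IsConvergent.add {n : ℕ} {A B : Formal n} (hA : IsConvergent A) (hB : IsConvergent B) :
    IsConvergent (A + B) := by
  obtain ⟨r, hr, hA⟩ := hA
  obtain ⟨s, hs, hB⟩ := hB
  have hm : 0 < min r s := lt_min hr hs
  refine ⟨min r s, hm, ((IsConvergent.mono hm (min_le_left _ _) hA).add
    (IsConvergent.mono hm (min_le_right _ _) hB)).of_nonneg_of_le (fun d => by positivity) fun d => ?_⟩
  rw [map_add, ← add_mul]
  gcongr
  exact norm_add_le _ _

theorem summable_antidiagonal {ι : Type*} [AddCommMonoid ι] [Finset.HasAntidiagonal ι]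
    (deg : ι →+ ℕ) {a b : ι → ℂ} {ρ : ℝ} (hm : 0 < ρ)
    (h1 : Summable fun d => ‖a d‖ * ρ ^ deg d)
    (h2 : Summable fun d => ‖b d‖ * ρ ^ deg d) :
    Summable fun d : ι =>
      ‖∑ p ∈ Finset.HasAntidiagonal.antidiagonal d, a p.1 * b p.2‖ * ρ ^ deg d := by
  have h0 : ∀ c : ι → ℂ, ∀ d, 0 ≤ ‖c d‖ * ρ ^ deg d := fun c d =>
    mul_nonneg (norm_nonneg _) (pow_nonneg hm.le _)
  have h3 : Summable fun x : ι × ι => ‖a x.1‖ * ρ ^ deg x.1 * (‖b x.2‖ * ρ ^ deg x.2) :=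
    (h1.mul_of_nonneg h2 (h0 a) (h0 b))
  have h4 : Summable fun d : ι => ∑ p ∈ Finset.HasAntidiagonal.antidiagonal d,
      ‖a p.1‖ * ρ ^ deg p.1 * (‖b p.2‖ * ρ ^ deg p.2) :=
    summable_sum_mul_antidiagonal_of_summable_mul (f := fun d => ‖a d‖ * ρ ^ deg d)
      (g := fun d => ‖b d‖ * ρ ^ deg d) h3
  refine Summable.of_nonneg_of_le (fun d => ?_) (fun d => ?_) h4
  · exact mul_nonneg (norm_nonneg _) (pow_nonneg hm.le _)
  have h5 : ∀ p ∈ Finset.HasAntidiagonal.antidiagonal d,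
      ‖a p.1 * b p.2‖ * ρ ^ deg d =
        ‖a p.1‖ * ρ ^ deg p.1 * (‖b p.2‖ * ρ ^ deg p.2) := by
    intro p hp
    rw [← Finset.HasAntidiagonal.mem_antidiagonal.mp hp, map_add, pow_add, norm_mul]
    exact mul_mul_mul_comm _ _ _ _
  rw [← Finset.sum_congr rfl h5, ← Finset.sum_mul]
  exact mul_le_mul_of_nonneg_right (norm_sum_le _ _) (pow_nonneg hm.le _)

theorem IsConvergent.mul {n : ℕ} {A B : Formal n} (hA : IsConvergent A) (hB : IsConvergent B) :
    IsConvergent (A * B) := by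
  classical
  obtain ⟨r, hr, hA⟩ := hA
  obtain ⟨s, hs, hB⟩ := hB
  have hm : 0 < min r s := lt_min hr hs
  refine ⟨min r s, hm, ?_⟩
  simp only [MvPowerSeries.coeff_mul]
  exact summable_antidiagonal Finsupp.degree hm (IsConvergent.mono hm (min_le_left _ _) hA)
    (IsConvergent.mono hm (min_le_right _ _) hB)

/-- The ring `ℂ{x, x₁, …, xₙ}` of convergent power series. -/
def Conv (n : ℕ) : Subalgebra ℂ (Formal n) where
  carrier := {A | IsConvergent A}
  mul_mem' := IsConvergent.mul
  add_mem' := IsConvergent.add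
  algebraMap_mem' c := by
    classical
    refine IsConvergent.of_finite ((Set.finite_singleton 0).subset fun d hd => ?_)
    by_contra h
    refine hd ?_
    rw [MvPowerSeries.algebraMap_apply, MvPowerSeries.coeff_C]
    exact if_neg h

/-- The coordinates `x = x₀, x₁, …, xₙ` as convergent power series. -/
def coord (n : ℕ) (i : Fin (n + 1)) : Conv n :=
  ⟨MvPowerSeries.X i, by
    classical
    refine IsConvergent.of_finite ((Set.finite_singleton (Finsupp.single i 1)).subset fun d hd => ?_)
    by_contra h
    refine hd ?_
    rw [MvPowerSeries.coeff_X]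
    exact if_neg h⟩

/-- `∂A/∂xᵢ`. -/
abbrev partialD {n : ℕ} (i : Fin (n + 1)) (A : Formal n) : Formal n := MvPowerSeries.pderiv ℂ i A

/-- The value of a power series at a point of its domain of convergence. -/
def evalAt {n : ℕ} (A : Formal n) (P : Fin (n + 1) → ℂ) : ℂ :=
  ∑' d : Fin (n + 1) →₀ ℕ, MvPowerSeries.coeff d A * ∏ i, P i ^ d i

/-- The Taylor expansion in `t`, at `t = 0`, of `A(x⁰ + t, x₁⁰, …, xₙ⁰)`, where
`P = (x⁰, x₁⁰, …, xₙ⁰)`. -/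
def lineTaylor {n : ℕ} (A : Formal n) (P : Fin (n + 1) → ℂ) : PowerSeries ℂ :=
  PowerSeries.mk fun k =>
    iteratedDeriv k (fun z => evalAt A (Function.update P 0 z)) (P 0) / (Nat.factorial k : ℂ)

/-- The residue at `t = 0` of the (formal) meromorphic 1-form `(a / b) dt`. -/
def residue (a b : PowerSeries ℂ) : ℂ :=
  HahnSeries.coeff (HahnSeries.ofPowerSeries ℤ ℂ a / HahnSeries.ofPowerSeries ℤ ℂ b) (-1)

theorem residue_add (a a' b : PowerSeries ℂ) :
    residue (a + a') b = residue a b + residue a' b := by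
  simp only [residue, map_add, add_div, HahnSeries.coeff_add]

theorem residue_smul (c : ℂ) (a b : PowerSeries ℂ) :
    residue (c • a) b = c * residue a b := by
  rw [residue, PowerSeries.smul_eq_C_mul, map_mul, HahnSeries.ofPowerSeries_C, mul_div_assoc,
    HahnSeries.C_mul_eq_smul, HahnSeries.coeff_smul, smul_eq_mul, residue]

theorem residue_zero (b : PowerSeries ℂ) : residue 0 b = 0 := by
  simp [residue]

/-- Near the origin, the evaluation of a convergent power series is well behaved. -/
theorem IsConvergent.eventually {n : ℕ} {A : Formal n} (hA : IsConvergent A) :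
    ∀ᶠ P in 𝓝 (0 : Fin (n + 1) → ℂ), ∀ᶠ z in 𝓝 (P 0),
      (Summable fun d : Fin (n + 1) →₀ ℕ =>
        MvPowerSeries.coeff d A * ∏ i, Function.update P 0 z i ^ d i) ∧
      AnalyticAt ℂ (fun z => evalAt A (Function.update P 0 z)) z := by
  obtain ⟨r, hr, h⟩ := hA
  filter_upwards [Metric.ball_mem_nhds (0 : Fin (n + 1) → ℂ) hr] with P hP
  have hP' : ∀ i, ‖P i‖ < r := fun i =>
    (norm_le_pi_norm P i).trans_lt (by simpa using hP)
  have hbd : ∀ (d : Fin (n + 1) →₀ ℕ), ∀ z ∈ Metric.ball (0 : ℂ) r,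
      ‖MvPowerSeries.coeff d A * ∏ i, Function.update P 0 z i ^ d i‖ ≤
        ‖MvPowerSeries.coeff d A‖ * r ^ d.degree := by
    intro d z hz
    rw [norm_mul, norm_prod, Finsupp.degree_eq_sum, ← Finset.prod_pow_eq_pow_sum]
    gcongr with i
    rw [norm_pow]
    gcongr
    by_cases hi : i = 0
    · subst hi
      simpa using (mem_ball_zero_iff.mp hz).le
    · simpa [Function.update_of_ne hi] using (hP' i).le
  have hdiff : DifferentiableOn ℂ (fun z => evalAt A (Function.update P 0 z))
      (Metric.ball (0 : ℂ) r) := by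
    refine DifferentiableOn.congr (Complex.differentiableOn_tsum_of_summable_norm h
      (fun d => ?_) Metric.isOpen_ball hbd) (fun z _ => rfl)
    refine Differentiable.differentiableOn ?_
    refine (differentiable_const _).mul ?_
    refine Differentiable.fun_finsetProd fun i _ => ?_
    refine Differentiable.pow ?_ _
    by_cases hi : i = 0
    · subst hi
      simp
    · simp [Function.update_of_ne hi]
  filter_upwards [Metric.isOpen_ball.mem_nhds (show P 0 ∈ Metric.ball (0 : ℂ) r by
    simpa using hP' 0)] with z hz
  exact ⟨Summable.of_norm_bounded h fun d => hbd d z hz,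
    hdiff.analyticAt (Metric.isOpen_ball.mem_nhds hz)⟩

theorem lineTaylor_add {n : ℕ} (A B : Conv n) :
    ∀ᶠ P in 𝓝 (0 : Fin (n + 1) → ℂ),
      lineTaylor ((A + B : Conv n) : Formal n) P =
        lineTaylor (A : Formal n) P + lineTaylor (B : Formal n) P := by
  have hA : IsConvergent (A : Formal n) := A.2
  have hB : IsConvergent (B : Formal n) := B.2
  filter_upwards [hA.eventually, hB.eventually] with P h1 h2
  ext k
  have he : (fun z => evalAt ((A + B : Conv n) : Formal n) (Function.update P 0 z)) =ᶠ[𝓝 (P 0)]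
      (fun z => evalAt (A : Formal n) (Function.update P 0 z)) +
        fun z => evalAt (B : Formal n) (Function.update P 0 z) := by
    filter_upwards [h1, h2] with z k1 k2
    simp only [evalAt, Subalgebra.coe_add, map_add, add_mul, Pi.add_apply]
    exact k1.1.tsum_add k2.1
  simp only [lineTaylor, map_add, PowerSeries.coeff_mk]
  rw [he.iteratedDeriv_eq, iteratedDeriv_add h1.self_of_nhds.2.contDiffAt
    h2.self_of_nhds.2.contDiffAt, add_div]

theorem lineTaylor_smul {n : ℕ} (c : ℂ) (A : Formal n) (P : Fin (n + 1) → ℂ) :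
    lineTaylor (c • A) P = c • lineTaylor A P := by
  ext k
  have he : (fun z => evalAt (c • A) (Function.update P 0 z)) =
      fun z => c * evalAt A (Function.update P 0 z) := by
    funext z
    simp only [evalAt, map_smul, smul_eq_mul, mul_assoc, tsum_mul_left]
  simp only [lineTaylor, map_smul, PowerSeries.coeff_mk, smul_eq_mul]
  rw [he, iteratedDeriv_const_mul_field, mul_div_assoc]

/-- The hypersurface germ `h = 0` is a union of orbits of `∂/∂x`, that is, it has an equation which
does not depend on `x`. -/
def IsFibered {n : ℕ} (h : Conv n) : Prop :=
  ∃ k : Conv n, Associated h k ∧ partialD 0 (k : Formal n) = 0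

/-- A decomposition `f = u · f₁^{l₁} ⋯ f_p^{l_p} · F₁^{m₁} ⋯ F_q^{m_q}` into irreducible factors in
`ℂ{x, x₁, …, xₙ}`, with `u` a unit, `f_j = 0` non-fibered and `F_k` in `ℂ{x₁, …, xₙ}`.
Since `ℂ{x, x₁, …, xₙ}` is factorial, every `f ≠ 0` has such a decomposition, unique up to order and
units, so that the quantifiers over decompositions below only express independence of the choice. -/
structure IrredDecomp {n : ℕ} (f : Conv n) where
  p : ℕ
  q : ℕ
  u : (Conv n)ˣ
  fac : Fin p → Conv n
  l : Fin p → ℕ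
  Fac : Fin q → Conv n
  m : Fin q → ℕ
  fac_irreducible : ∀ j, Irreducible (fac j)
  fac_not_fibered : ∀ j, ¬ IsFibered (fac j)
  fac_distinct : ∀ i j, i ≠ j → ¬ Associated (fac i) (fac j)
  l_pos : ∀ j, 0 < l j
  Fac_irreducible : ∀ k, Irreducible (Fac k)
  Fac_indep : ∀ k, partialD 0 (Fac k : Formal n) = 0
  Fac_distinct : ∀ i j, i ≠ j → ¬ Associated (Fac i) (Fac j)
  m_pos : ∀ k, 0 < m k
  eq : f = u * (∏ j, fac j ^ l j) * ∏ k, Fac k ^ m k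

namespace IrredDecomp

variable {n : ℕ} {f : Conv n}

/-- The non-fibered part of `f`. -/
def fN (d : IrredDecomp f) : Conv n := d.u * ∏ j, d.fac j ^ d.l j

/-- The denominator `f₁^{l₁ - 1} ⋯ f_p^{l_p - 1} · f_F` of the special functions. -/
def specialDenom (d : IrredDecomp f) : Conv n :=
  (∏ j, d.fac j ^ (d.l j - 1)) * ∏ k, d.Fac k ^ d.m k

end IrredDecomp

/-- `α = β / D` solves the homological equation `∂α/∂x = A / f`, denominators being cleared. -/
def IsSolution {n : ℕ} (f A β D : Conv n) : Prop :=
  (f : Formal n) * (partialD 0 (β : Formal n) * D - β * partialD 0 (D : Formal n)) =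
    A * (D : Formal n) ^ 2

/-- The homological equation `∂α/∂x = A / f` is free of residues: the 1-form
`(A / f_N)(x, x₁⁰, …, xₙ⁰) dx` has residue zero at every point `P = (x⁰, x₁⁰, …, xₙ⁰)` near the origin
with `f_N(P) = 0` and `f_N(x, x₁⁰, …, xₙ⁰)` not identically zero. -/
def IsResidueFree {n : ℕ} (f A : Conv n) : Prop :=
  ∀ d : IrredDecomp f, ∀ᶠ P in 𝓝 (0 : Fin (n + 1) → ℂ),
    evalAt (d.fN : Formal n) P = 0 → lineTaylor (d.fN : Formal n) P ≠ 0 →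
      residue (lineTaylor (A : Formal n) P) (lineTaylor (d.fN : Formal n) P) = 0

/-- The homological equation `∂α/∂x = A / f` has a special solution. -/
def IsSpecialEq {n : ℕ} (f A : Conv n) : Prop :=
  ∀ d : IrredDecomp f, ∃ β : Conv n, IsSolution f A β d.specialDenom

/-- `Fr(f)`, for `f ≠ 0`: the equation `∂α/∂x = A / f` is represented by its numerator `A`. -/
def Fr {n : ℕ} (f : Conv n) : Submodule ℂ (Conv n) where
  carrier := {A | IsResidueFree f A}
  zero_mem' := by
    intro d
    refine Eventually.of_forall fun P _ _ => ?_
    have h : lineTaylor ((0 : Conv n) : Formal n) P = 0 := by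
      have := lineTaylor_smul (0 : ℂ) (0 : Formal n) P
      simpa using this
    rw [h, residue_zero]
  add_mem' := by
    intro A B hA hB d
    filter_upwards [hA d, hB d, lineTaylor_add A B] with P h1 h2 h3 h4 h5
    rw [h3, residue_add, h1 h4 h5, h2 h4 h5, add_zero]
  smul_mem' := by
    intro c A hA d
    filter_upwards [hA d] with P h1 h4 h5
    rw [Subalgebra.coe_smul, lineTaylor_smul, residue_smul, h1 h4 h5, mul_zero]

/-- `Sp(f)`, for `f ≠ 0`: the special equations in `Fr(f)`. -/
def Sp {n : ℕ} (f : Conv n) : Submodule ℂ (Conv n) where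
  carrier := {A | A ∈ Fr f ∧ IsSpecialEq f A}
  zero_mem' := by
    refine ⟨zero_mem _, fun d => ⟨0, ?_⟩⟩
    simp [IsSolution]
  add_mem' := by
    rintro A B ⟨hA, hA'⟩ ⟨hB, hB'⟩
    refine ⟨add_mem hA hB, fun d => ?_⟩
    obtain ⟨β, h1⟩ := hA' d
    obtain ⟨γ, h2⟩ := hB' d
    refine ⟨β + γ, ?_⟩
    simp only [IsSolution, Subalgebra.coe_add, map_add] at *
    linear_combination h1 + h2
  smul_mem' := by
    rintro c A ⟨hA, hA'⟩
    refine ⟨Submodule.smul_mem _ c hA, fun d => ?_⟩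
    obtain ⟨β, h1⟩ := hA' d
    refine ⟨c • β, ?_⟩
    have h2 : partialD 0 ((c • β : Conv n) : Formal n) =
        MvPowerSeries.C c * partialD 0 (β : Formal n) := by
      rw [Subalgebra.coe_smul, partialD, Derivation.map_smul, MvPowerSeries.smul_eq_C_mul]
    simp only [IsSolution] at h1 ⊢
    rw [h2, Subalgebra.coe_smul, Subalgebra.coe_smul, MvPowerSeries.smul_eq_C_mul,
      MvPowerSeries.smul_eq_C_mul]
    linear_combination MvPowerSeries.C c * h1

/-- The complex vector space `Fr(f) / Sp(f)` of the classes `A + Sp(f)` with `A` in `Fr(f)`, as a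
subspace of `ℂ{x, x₁, …, xₙ} / Sp(f)`; note that `Sp(f) ⊆ Fr(f)`. -/
def FrModSp {n : ℕ} (f : Conv n) : Submodule ℂ (Conv n ⧸ Sp f) := (Fr f).map (Sp f).mkQ

/-- The convergent power series that do not depend on the variables with index in `s`. -/
def convIndep (n : ℕ) (s : Set (Fin (n + 1))) : Submodule ℂ (Conv n) where
  carrier := {c | ∀ i ∈ s, partialD i (c : Formal n) = 0}
  zero_mem' := by
    intro i _
    simp
  add_mem' := by
    intro A B hA hB i hi
    have h1 := hA i hi
    have h2 := hB i hi
    simp only [partialD] at h1 h2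
    simp [h1, h2]
  smul_mem' := by
    intro c A hA i hi
    have h1 := hA i hi
    simp only [partialD] at h1
    simp [h1]

/-- `x₂ - x x₁`. -/
def g₀ (n : ℕ) : Conv n := coord n 2 - coord n 0 * coord n 1

/-- `f₀ = (x₂ - x x₁)²`. -/
def f₀ (n : ℕ) : Conv n := g₀ n ^ 2

/-- The numerator of the equation `E₀ : ∂α/∂x = 1 / f₀`. -/
def E₀ (n : ℕ) : Conv n := 1

/-- Formal diffeomorphisms of `(ℂⁿ⁺¹, 0)`, given by their components. -/
structure FormalDiff (n : ℕ) where
  comp : Fin (n + 1) → Formal n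
  map_zero : ∀ i, MvPowerSeries.constantCoeff (comp i) = 0
  jacobian : (Matrix.of fun i j => MvPowerSeries.constantCoeff (partialD j (comp i))).det ≠ 0

/-- Germs of complex analytic diffeomorphisms of `(ℂⁿ⁺¹, 0)`, given by their components. -/
structure AnalyticDiff (n : ℕ) where
  comp : Fin (n + 1) → Conv n
  map_zero : ∀ i, MvPowerSeries.constantCoeff (comp i : Formal n) = 0
  jacobian :
    (Matrix.of fun i j => MvPowerSeries.constantCoeff (partialD j (comp i : Formal n))).det ≠ 0

/-- `φ₂ ∘ σ = σ ∘ φ₁`. -/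
def Conjugates {n : ℕ} (σ : FormalDiff n) (φ₁ φ₂ : AnalyticDiff n) : Prop :=
  ∀ i, MvPowerSeries.subst σ.comp (φ₂.comp i : Formal n) =
    MvPowerSeries.subst (fun j => (φ₁.comp j : Formal n)) (σ.comp i)

/-- Unipotent parameterized diffeomorphisms (up-diffeomorphisms). -/
def IsUp {n : ℕ} (φ : AnalyticDiff n) : Prop :=
  (∀ j, j ≠ 0 → φ.comp j = coord n j) ∧
    MvPowerSeries.constantCoeff (partialD 0 (φ.comp 0 : Formal n)) = 1

/-- The set `𝒟_f` of up-diffeomorphisms such that `(x ∘ φ - x) / f` is a unit. -/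
def DSet {n : ℕ} (f : Conv n) : Set (AnalyticDiff n) :=
  {φ | IsUp φ ∧ ∃ v : Conv n, IsUnit v ∧ φ.comp 0 - coord n 0 = v * f}

/-- The formal diffeomorphism `σ` is parameterized and special with respect to `f = 0`, that is,
`x ∘ σ - x` belongs to the radical of `(f_N)`. -/
def IsSpecialDiff {n : ℕ} (f : Conv n) (σ : FormalDiff n) : Prop :=
  (∀ j, j ≠ 0 → σ.comp j = MvPowerSeries.X j) ∧
    ∀ d : IrredDecomp f,
      σ.comp 0 - MvPowerSeries.X 0 ∈ (Ideal.span {(d.fN : Formal n)}).radical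

/-- `φ₁` and `φ₂` are formally conjugated by a special transformation (with respect to the fixed
points set `x ∘ φ₁ - x = 0`). -/
def FormallySpeciallyConjugated {n : ℕ} (φ₁ φ₂ : AnalyticDiff n) : Prop :=
  ∃ σ : FormalDiff n, IsSpecialDiff (φ₁.comp 0 - coord n 0) σ ∧ Conjugates σ φ₁ φ₂

/-- The exponential `∑ⱼ Xʲ(t) / j!` of the formal nilpotent vector field `X = h(t) d/dt` in one
variable, `h ∈ (t²)`. Since `Xʲ(t) ∈ (tʲ⁺¹)` for `j ≥ 1`, the coefficient of `tᵏ` only involves the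
terms with `j ≤ k`. -/
def expField (h : PowerSeries ℂ) : PowerSeries ℂ :=
  PowerSeries.mk fun k => ∑ j ∈ Finset.range (k + 1),
    PowerSeries.coeff k
      ((fun a : PowerSeries ℂ => h * PowerSeries.derivative ℂ a)^[j] PowerSeries.X) /
        (Nat.factorial j : ℂ)

open Classical in
/-- The logarithm of a formal diffeomorphism `τ` of `(ℂ, 0)` tangent to the identity: the unique `h`
in `(t²)` such that `τ = exp(h(t) d/dt)`. -/
def logField (τ : PowerSeries ℂ) : PowerSeries ℂ :=
  if H : ∃ h : PowerSeries ℂ, PowerSeries.X ^ 2 ∣ h ∧ expField h = τ then H.choose else 0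

/-- The residue of `τ` tangent to the identity: the residue at `0` of the dual form `dt / h` of
`log τ = h(t) d/dt`. -/
def residueOf (τ : PowerSeries ℂ) : ℂ := residue 1 (logField τ)

/-- The one-dimensional germ `φ_P` of a parameterized diffeomorphism `φ` at a fixed point `P`, obtained
by restriction to the orbit of `∂/∂x` through `P`, in the coordinate `t = x - x(P)`. -/
def germAt {n : ℕ} (φ : AnalyticDiff n) (P : Fin (n + 1) → ℂ) : PowerSeries ℂ :=
  lineTaylor (φ.comp 0 : Formal n) P - PowerSeries.C (P 0)

/-- The order of contact `ν(φ_P)` between `φ_P` and the identity. -/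
def contactOrder {n : ℕ} (φ : AnalyticDiff n) (P : Fin (n + 1) → ℂ) : ℕ∞ :=
  (germAt φ P - PowerSeries.X).order

/-- The zero set of `g`, to be considered near the origin only. -/
def zeroSet {n : ℕ} (g : Conv n) : Set (Fin (n + 1) → ℂ) := {P | evalAt (g : Formal n) P = 0}

/-- The minimal order of contact of `φ` along the germ at `0` of `g = 0`. -/
def minContactOrder {n : ℕ} (g : Conv n) (φ : AnalyticDiff n) : ℕ∞ :=
  liminf (fun Q => contactOrder φ Q) (𝓝[zeroSet g] 0)

/-- The residue functions `P ↦ Res(φ_P)` of `φ₁` and `φ₂` along a common non-fibered unipotent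
component `g = 0` of their fixed points sets coincide; they are defined at the points near the origin
where the order of contact is minimal. -/
def SameResidues {n : ℕ} (g : Conv n) (φ₁ φ₂ : AnalyticDiff n) : Prop :=
  ∀ᶠ P in 𝓝[zeroSet g] 0,
    contactOrder φ₁ P = minContactOrder g φ₁ → contactOrder φ₂ P = minContactOrder g φ₂ →
      residueOf (germAt φ₁ P) = residueOf (germAt φ₂ P)

end

/-! Put g = x₂ - x x₁, so that f₀ = g² and ∂g/∂x = -x₁; a prime denotes ∂/∂x.

The space Fr(f₀)/Sp(f₀). On the orbit through a point of g = 0 with x₁ ≠ 0 the function g is -x₁ t,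
so the residue of A/f₀ there is A'/x₁². Hence A is free of residues if and only if g divides A'
(`mem_Fr_f₀_iff`); passing from vanishing on g = 0 to divisibility rests on division by g with a
remainder free of x₂ (`exists_division`), which also shows that g is prime. A special solution is
β/g, so A is special if and only if A = g β' + x₁ β (`isSpecialEq_f₀_iff`). Since (g β' + x₁ β)' = g
β'', a double primitive of A'/g reduces A to a function of x₁, …, xₙ; its part in (x₁, x₂) is again
special, because x₂ c₁ and x₁ c₀ arise from β = x c₁ and β = c₀. What is left is some c in ℂ{x₃, …,
xₙ} (`exists_special_normal_form`). As g β' + x₁ β lies in (x₁, x₂), which contains no nonzero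
function of x₃, …, xₙ alone, c is exactly the class of A, and it vanishes if and only if A is in
(x₁, x₂).

Formal conjugation for n = 2. Write x ∘ φᵢ = x + vᵢ g². The residue function is 1 - v'/(v² x₁²), so
equality of residues means that g divides v₁' v₂² - v₂' v₁² (`sameResidues_iff`), while the second
derivative in x₂ at 0 is 2 vᵢ(0). A special σ has x ∘ σ = x + g τ; expanding the conjugacy equation
to second order gives both conditions (`invariants_of_conjugated`).

Conversely, φᵢ is the exponential of a formal field g² aᵢ ∂/∂x (`exists_log`), and the divisibility
condition passes from vᵢ to aᵢ, where it says that 1/a₁ - 1/a₂ is formally free of residues. For n =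
2 the obstruction c is a constant, equal to 1/a₁(0) - 1/a₂(0) = 0, so 1/a₁ - 1/a₂ = g β' + x₁ β. It
remains to find τ such that the integral of ds/(g² a₂) from x to x + g τ along the orbit is β/g.
After rescaling s this becomes an equation for τ with invertible linear term (`exists_transport`).
Its solution σ conjugates the vector fields, hence their exponentials (`subst_fsum_dividedPow`).

All infinite processes are controlled by the filtration by order: sums are identified modulo each
order, and equations are solved as fixed points of maps that gain one degree. -/

open scoped NNReal ENNReal

noncomputable section

/-! ### Graded fixed points and the order filtration -/

/-- An operator which improves the agreement of graded families by one degree has a fixed point. -/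
theorem exists_fixed_point_of_contracting {ι α : Type*} [Zero α] (deg : ι → ℕ)
    (T : (ι → α) → ι → α)
    (hT : ∀ k F G, (∀ d, deg d < k → F d = G d) → ∀ d, deg d < k + 1 → T F d = T G d) :
    ∃ F, T F = F := by
  have h1 : ∀ k m, k ≤ m → ∀ d, deg d < k → (T^[m] 0) d = (T^[k] 0) d := by
    intro k
    induction k with
    | zero => intro m _ d hd; omega
    | succ k ih =>
      intro m hm d hd
      obtain ⟨m, rfl⟩ : ∃ m', m = m' + 1 := ⟨m - 1, by omega⟩
      rw [Function.iterate_succ_apply', Function.iterate_succ_apply']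
      exact hT k _ _ (ih m (by omega)) d hd
  -- In degree k the iterates of `T` are stationary from the (k + 1)-st one on; the candidate
  -- collects these stable values.
  refine ⟨fun d => (T^[deg d + 1] 0) d, funext fun d => ?_⟩
  rw [Function.iterate_succ_apply']
  refine hT (deg d) _ _ (fun e he => ?_) d (Nat.lt_succ_self _)
  exact (h1 (deg e + 1) (deg d) he e (Nat.lt_succ_self _)).symm

variable {n : ℕ}

/-- The power series of order at least `N`. -/
def ordIdeal (n N : ℕ) : Ideal (Formal n) where
  carrier := {F | ∀ d : Fin (n + 1) →₀ ℕ, d.degree < N → MvPowerSeries.coeff d F = 0}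
  zero_mem' := by
    intro d _
    simp
  add_mem' := by
    intro F G hF hG d hd
    rw [map_add, hF d hd, hG d hd, add_zero]
  smul_mem' := by
    classical
    intro F G hG d hd
    rw [smul_eq_mul, MvPowerSeries.coeff_mul]
    refine Finset.sum_eq_zero fun p hp => ?_
    have h := congrArg Finsupp.degree (Finset.HasAntidiagonal.mem_antidiagonal.mp hp)
    rw [map_add] at h
    rw [hG p.2 (by omega), mul_zero]

theorem mul_mem_ordIdeal {M N : ℕ} {F G : Formal n} (hF : F ∈ ordIdeal n M)
    (hG : G ∈ ordIdeal n N) : F * G ∈ ordIdeal n (M + N) := by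
  classical
  intro d hd
  rw [MvPowerSeries.coeff_mul]
  refine Finset.sum_eq_zero fun p hp => ?_
  have h := congrArg Finsupp.degree (Finset.HasAntidiagonal.mem_antidiagonal.mp hp)
  rw [map_add] at h
  rcases lt_or_ge p.1.degree M with h1 | h1
  · rw [hF p.1 h1, zero_mul]
  · rw [hG p.2 (by omega), mul_zero]

theorem ordIdeal_anti {M N : ℕ} (h : M ≤ N) : ordIdeal n N ≤ ordIdeal n M :=
  fun _ hF d hd => hF d (hd.trans_le h)

theorem mem_ordIdeal_zero (F : Formal n) : F ∈ ordIdeal n 0 := fun _ hd => absurd hd (by omega)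

theorem mem_ordIdeal_one {F : Formal n} :
    F ∈ ordIdeal n 1 ↔ MvPowerSeries.constantCoeff F = 0 := by
  rw [← MvPowerSeries.coeff_zero_eq_constantCoeff_apply]
  constructor
  · intro h
    exact h 0 (by simp)
  · intro h d hd
    rw [(Finsupp.degree_eq_zero_iff d).mp (by omega), h]

theorem pow_mem_ordIdeal {M : ℕ} {F : Formal n} (hF : F ∈ ordIdeal n M) (k : ℕ) :
    F ^ k ∈ ordIdeal n (M * k) := by
  induction k with
  | zero => exact mem_ordIdeal_zero _
  | succ k ih => rw [pow_succ, Nat.mul_succ]; exact mul_mem_ordIdeal ih hF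

theorem eq_of_sub_mem_ordIdeal {F G : Formal n} (h : ∀ N, F - G ∈ ordIdeal n N) : F = G := by
  ext d
  have := h (d.degree + 1) d (Nat.lt_succ_self _)
  rwa [map_sub, sub_eq_zero] at this

theorem smul_mem_ordIdeal {N : ℕ} (c : ℂ) {F : Formal n} (hF : F ∈ ordIdeal n N) :
    c • F ∈ ordIdeal n N := by
  rw [MvPowerSeries.smul_eq_C_mul]
  exact Ideal.mul_mem_left _ _ hF

theorem partialD_mem_ordIdeal {N : ℕ} {F : Formal n} (i : Fin (n + 1))
    (hF : F ∈ ordIdeal n (N + 1)) : partialD i F ∈ ordIdeal n N := by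
  intro d hd
  rw [MvPowerSeries.coeff_pderiv, hF _ (by simpa [map_add] using hd), zero_mul]

/-- The factor makes up for the degree lost by differentiation. Thus g ∂/∂x preserves the order and
g² u ∂/∂x raises it by one, which makes the latter exponentiable. -/
theorem mul_partialD_mem_ordIdeal {N M : ℕ} {a F : Formal n} (i : Fin (n + 1))
    (ha : a ∈ ordIdeal n (M + 1)) (hF : F ∈ ordIdeal n N) :
    a * partialD i F ∈ ordIdeal n (N + M) := by
  rcases N with _ | N
  · rw [Nat.zero_add]
    exact Ideal.mul_mem_right _ _ (ordIdeal_anti (Nat.le_succ _) ha)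
  · have := mul_mem_ordIdeal ha (partialD_mem_ordIdeal i hF)
    exact ordIdeal_anti (by omega) this

/-! ### Sums of families of increasing order -/

/-- The sum of a family of power series `c k` of order at least `k`. -/
def fsum (c : ℕ → Formal n) : Formal n :=
  fun d => ∑ k ∈ Finset.range (d.degree + 1), MvPowerSeries.coeff d (c k)

/-- The tool that reduces identities between infinite sums to identities between partial sums modulo
order `N`. -/
theorem fsum_sub_sum_mem {c : ℕ → Formal n} (hc : ∀ k, c k ∈ ordIdeal n k) (N : ℕ) :
    fsum c - ∑ k ∈ Finset.range N, c k ∈ ordIdeal n N := by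
  intro d hd
  have h : MvPowerSeries.coeff d (fsum c) =
    ∑ k ∈ Finset.range (d.degree + 1), MvPowerSeries.coeff d (c k) := rfl
  rw [map_sub, map_sum, h, sub_eq_zero]
  refine Finset.sum_subset (Finset.range_mono hd) fun k _ hk => ?_
  exact hc k d (by simpa using hk)

/-- To identify a sum of a family of power series it is enough to approximate it. -/
theorem fsum_eq_of_approx {c : ℕ → Formal n} (hc : ∀ k, c k ∈ ordIdeal n k) {F : Formal n}
    (h : ∀ N, F - ∑ k ∈ Finset.range N, c k ∈ ordIdeal n N) : fsum c = F := by
  refine eq_of_sub_mem_ordIdeal fun N => ?_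
  have := Ideal.sub_mem _ (fsum_sub_sum_mem hc N) (h N)
  rwa [sub_sub_sub_cancel_right] at this

theorem fsum_mem {c : ℕ → Formal n} (hc : ∀ k, c k ∈ ordIdeal n k) {N : ℕ}
    (h : ∀ k, c k ∈ ordIdeal n N) : fsum c ∈ ordIdeal n N := by
  have := Ideal.add_mem _ (fsum_sub_sum_mem hc N) (Ideal.sum_mem _ fun k (_ : k ∈ Finset.range N) => h k)
  rwa [sub_add_cancel] at this

theorem fsum_sub_fsum_mem {c c' : ℕ → Formal n} (hc : ∀ k, c k ∈ ordIdeal n k)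
    (hc' : ∀ k, c' k ∈ ordIdeal n k) {N : ℕ} (h : ∀ k, c k - c' k ∈ ordIdeal n N) :
    fsum c - fsum c' ∈ ordIdeal n N := by
  have h1 := fsum_sub_sum_mem hc N
  have h2 := fsum_sub_sum_mem hc' N
  have h3 := Ideal.sum_mem _ fun k (_ : k ∈ Finset.range N) => h k
  rw [Finset.sum_sub_distrib] at h3
  have := Ideal.add_mem _ (Ideal.sub_mem _ h1 h2) h3
  convert this using 1
  ring

/-- Turns a recurrence between terms into a functional equation between sums. -/
theorem fsum_succ {c c' : ℕ → Formal n} (a : Formal n) (hc : ∀ k, c k ∈ ordIdeal n k)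
    (hc' : ∀ k, c' k ∈ ordIdeal n k) (h : ∀ k, c (k + 1) = a * c' k) :
    fsum c = c 0 + a * fsum c' := by
  refine fsum_eq_of_approx hc fun N => ?_
  rcases N with _ | N
  · exact mem_ordIdeal_zero _
  have h1 : a * (fsum c' - ∑ k ∈ Finset.range (N + 1), c' k) ∈ ordIdeal n (N + 1) :=
    Ideal.mul_mem_left _ _ (fsum_sub_sum_mem hc' (N + 1))
  have h2 : c (N + 1) ∈ ordIdeal n (N + 1) := hc _
  rw [Finset.sum_range_succ']
  simp only [h] at h2 ⊢
  rw [← Finset.mul_sum]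
  rw [Finset.sum_range_succ] at h1
  convert Ideal.add_mem _ h1 h2 using 1
  ring

theorem fsum_add {c c' : ℕ → Formal n} (hc : ∀ k, c k ∈ ordIdeal n k)
    (hc' : ∀ k, c' k ∈ ordIdeal n k) : fsum (fun k => c k + c' k) = fsum c + fsum c' := by
  refine fsum_eq_of_approx (fun k => Ideal.add_mem _ (hc k) (hc' k)) fun N => ?_
  rw [Finset.sum_add_distrib, add_sub_add_comm]
  exact Ideal.add_mem _ (fsum_sub_sum_mem hc N) (fsum_sub_sum_mem hc' N)

theorem fsum_mul_left {c : ℕ → Formal n} (a : Formal n) (hc : ∀ k, c k ∈ ordIdeal n k) :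
    fsum (fun k => a * c k) = a * fsum c := by
  refine fsum_eq_of_approx (fun k => Ideal.mul_mem_left _ _ (hc k)) fun N => ?_
  rw [← Finset.mul_sum, ← mul_sub]
  exact Ideal.mul_mem_left _ _ (fsum_sub_sum_mem hc N)

/-- One more term than the order claimed is needed, because differentiation lowers the order by one.
-/
theorem partialD_fsum_sub_mem {c : ℕ → Formal n} (i : Fin (n + 1)) (hc : ∀ k, c k ∈ ordIdeal n k)
    (N : ℕ) :
    partialD i (fsum c) - ∑ k ∈ Finset.range (N + 1), partialD i (c k) ∈ ordIdeal n N := by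
  have := partialD_mem_ordIdeal i (fsum_sub_sum_mem hc (N + 1))
  rwa [partialD, map_sub, map_sum] at this

/-! ### Continuity of substitutions -/

/-- Agreement up to degree `N` with a polynomial. -/
theorem exists_polynomial_sub_mem (F : Formal n) (N : ℕ) :
    ∃ p : MvPolynomial (Fin (n + 1)) ℂ, F - (p : Formal n) ∈ ordIdeal n N := by
  refine ⟨MvPowerSeries.truncTotal N F, fun d hd => ?_⟩
  rw [map_sub, MvPolynomial.coeff_coe, MvPowerSeries.coeff_truncTotal _ hd, sub_self]

/-- Continuity of substitution for the order filtration: with polynomial approximation, identities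
between substitutions need to be checked on polynomials only. -/
theorem subst_mem_ordIdeal {a : Fin (n + 1) → Formal n} (ha : ∀ i, a i ∈ ordIdeal n 1) {N : ℕ}
    {F : Formal n} (hF : F ∈ ordIdeal n N) : MvPowerSeries.subst a F ∈ ordIdeal n N := by
  have hs : MvPowerSeries.HasSubst a :=
    MvPowerSeries.hasSubst_of_constantCoeff_zero fun i => mem_ordIdeal_one.mp (ha i)
  intro e he
  rw [MvPowerSeries.coeff_subst hs]
  refine finsum_eq_zero_of_forall_eq_zero fun d => ?_
  rcases lt_or_ge d.degree N with h | h
  · rw [hF d h, zero_smul]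
  · have h1 : ∀ s : Finset (Fin (n + 1)), ∏ i ∈ s, a i ^ d i ∈ ordIdeal n (∑ i ∈ s, d i) := by
      classical
      intro s
      induction s using Finset.induction_on with
      | empty => exact mem_ordIdeal_zero _
      | insert i s hi ih =>
        rw [Finset.prod_insert hi, Finset.sum_insert hi]
        refine mul_mem_ordIdeal ?_ ih
        have := pow_mem_ordIdeal (ha i) (d i)
        rwa [one_mul] at this
    have h2 := h1 d.support e (he.trans_le h)
    have h3 : (d.prod fun s e => a s ^ e) = ∏ i ∈ d.support, a i ^ d i := rfl
    rw [h3, h2, smul_zero]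

/-- A continuous algebra endomorphism is a substitution. -/
theorem algHom_eq_subst (S : Formal n →ₐ[ℂ] Formal n)
    (hS : ∀ N, ∀ F ∈ ordIdeal n N, S F ∈ ordIdeal n N) {a : Fin (n + 1) → Formal n}
    (ha : ∀ i, S (MvPowerSeries.X i) = a i) (F : Formal n) :
    S F = MvPowerSeries.subst a F := by
  have ha' : ∀ i, a i ∈ ordIdeal n 1 := fun i => by
    rw [← ha]
    exact hS 1 _ (mem_ordIdeal_one.mpr (MvPowerSeries.constantCoeff_X i))
  have hs : MvPowerSeries.HasSubst a :=
    MvPowerSeries.hasSubst_of_constantCoeff_zero fun i => mem_ordIdeal_one.mp (ha' i)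
  refine eq_of_sub_mem_ordIdeal fun N => ?_
  obtain ⟨p, hp⟩ := exists_polynomial_sub_mem F N
  have h1 : S.comp (MvPolynomial.coeToMvPowerSeries.algHom ℂ) =
      (MvPowerSeries.substAlgHom hs).comp (MvPolynomial.coeToMvPowerSeries.algHom ℂ) := by
    refine MvPolynomial.algHom_ext fun i => ?_
    simp [ha, MvPowerSeries.subst_X hs]
  have h2 : S (p : Formal n) = MvPowerSeries.subst a (p : Formal n) := by
    have := DFunLike.congr_fun h1 p
    simpa using this
  have h3 := hS N _ hp
  have h4 := subst_mem_ordIdeal ha' hp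
  rw [MvPowerSeries.subst_sub hs] at h4
  rw [map_sub, h2] at h3
  have := Ideal.sub_mem _ h3 h4
  rwa [sub_sub_sub_cancel_right] at this

/-! ### Exponentials of derivations and Taylor shifts as substitutions -/

/-- A family `D k` of operators with the properties of the terms `X^k / k!` of the exponential of
a nilpotent derivation `X`. -/
structure HigherDerivation (D : ℕ → Formal n →ₗ[ℂ] Formal n) : Prop where
  zero : ∀ F, D 0 F = F
  one : ∀ k, D (k + 1) 1 = 0
  leibniz : ∀ k F G, D k (F * G) = ∑ p ∈ Finset.HasAntidiagonal.antidiagonal k, D p.1 F * D p.2 G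
  mem : ∀ k F, D k F ∈ ordIdeal n k
  mem_of_mem : ∀ N k, ∀ F ∈ ordIdeal n N, D k F ∈ ordIdeal n N

namespace HigherDerivation

variable {D : ℕ → Formal n →ₗ[ℂ] Formal n}

theorem fsum_mul (h : HigherDerivation D) (F G : Formal n) :
    fsum (fun k => D k (F * G)) = fsum (fun k => D k F) * fsum (fun k => D k G) := by
  refine fsum_eq_of_approx (fun k => h.mem k _) fun N => ?_
  have hF := fsum_sub_sum_mem (fun k => h.mem k F) N
  have hG := fsum_sub_sum_mem (fun k => h.mem k G) N
  -- The product of the partial sums is a sum over a square; the Leibniz rule accounts for the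
  -- triangle p.1 + p.2 < N, and every other term has order at least N.
  have h1 : (∑ k ∈ Finset.range N, D k F) * (∑ k ∈ Finset.range N, D k G) -
      ∑ k ∈ Finset.range N, D k (F * G) ∈ ordIdeal n N := by
    simp only [h.leibniz]
    rw [Finset.sum_mul_sum, ← Finset.sum_product', Finset.sum_sigma']
    have h2 : ∑ x ∈ (Finset.range N).sigma Finset.HasAntidiagonal.antidiagonal, D x.2.1 F * D x.2.2 G =
        ∑ p ∈ (Finset.range N ×ˢ Finset.range N).filter (fun p => p.1 + p.2 < N),
          D p.1 F * D p.2 G := by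
      refine Finset.sum_bij' (fun x _ => x.2) (fun p _ => ⟨p.1 + p.2, p⟩) ?_ ?_ ?_ ?_ ?_
      · rintro ⟨k, a, b⟩ hx
        simp only [Finset.mem_sigma, Finset.mem_range, Finset.HasAntidiagonal.mem_antidiagonal] at hx
        simp only [Finset.mem_filter, Finset.mem_product, Finset.mem_range]
        omega
      · rintro ⟨a, b⟩ hx
        simp only [Finset.mem_filter, Finset.mem_product, Finset.mem_range] at hx
        exact Finset.mem_sigma.mpr ⟨Finset.mem_range.mpr hx.2,
          Finset.HasAntidiagonal.mem_antidiagonal.mpr rfl⟩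
      · rintro ⟨k, a, b⟩ hx
        simp only [Finset.mem_sigma, Finset.mem_range, Finset.HasAntidiagonal.mem_antidiagonal] at hx
        obtain ⟨_, rfl⟩ := hx
        rfl
      · intro p _
        rfl
      · intro x _
        rfl
    rw [h2, ← Finset.sum_filter_add_sum_filter_not (Finset.range N ×ˢ Finset.range N)
      (fun p => p.1 + p.2 < N), add_sub_cancel_left]
    refine Ideal.sum_mem _ fun p hp => ?_
    simp only [Finset.mem_filter, not_lt] at hp
    exact ordIdeal_anti hp.2 (mul_mem_ordIdeal (h.mem _ _) (h.mem _ _))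
  have h3 := Ideal.add_mem _ (Ideal.add_mem _ (Ideal.mul_mem_right (fsum fun k => D k G) _ hF)
    (Ideal.mul_mem_left _ (∑ k ∈ Finset.range N, D k F) hG)) h1
  convert h3 using 1
  ring

/-- The algebra endomorphism `F ↦ ∑ₖ Dₖ(F)`. -/
def toAlgHom (h : HigherDerivation D) : Formal n →ₐ[ℂ] Formal n :=
  AlgHom.ofLinearMap
    { toFun := fun F => fsum fun k => D k F
      map_add' := fun F G => by
        simp only [map_add]
        exact fsum_add (fun k => h.mem k F) fun k => h.mem k G
      map_smul' := fun c F => by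
        have h1 : ∀ k, D k (c • F) = MvPowerSeries.C c * D k F := fun k => by
          rw [map_smul, MvPowerSeries.smul_eq_C_mul]
        simp only [h1, RingHom.id_apply]
        rw [MvPowerSeries.smul_eq_C_mul]
        exact fsum_mul_left _ fun k => h.mem k F }
    (by
      have h1 := fsum_succ (c := fun k => D k 1) (c' := fun _ => 0) 0 (fun k => h.mem k 1)
        (fun k => zero_mem _) (fun k => by rw [h.one, zero_mul])
      change fsum (fun k => D k 1) = 1
      rw [h1, h.zero, zero_mul, add_zero])
    (fun F G => h.fsum_mul F G)

/-- `∑ₖ Dₖ` is the substitution of the values at the coordinates. -/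
theorem fsum_eq_subst (h : HigherDerivation D) {a : Fin (n + 1) → Formal n}
    (ha : ∀ i, fsum (fun k => D k (MvPowerSeries.X i)) = a i) (F : Formal n) :
    fsum (fun k => D k F) = MvPowerSeries.subst a F :=
  algHom_eq_subst h.toAlgHom
    (fun N F hF => fsum_mem (fun k => h.mem k F) fun k => h.mem_of_mem N k F hF) ha F

end HigherDerivation

/-- The divided powers `X^k / k!` of a derivation. -/
def dividedPow (X : Derivation ℂ (Formal n) (Formal n)) (k : ℕ) : Formal n →ₗ[ℂ] Formal n :=
  ((k.factorial : ℂ)⁻¹) • (X : Formal n →ₗ[ℂ] Formal n) ^ k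

theorem dividedPow_zero (X : Derivation ℂ (Formal n) (Formal n)) (F : Formal n) :
    dividedPow X 0 F = F := by
  simp [dividedPow]

theorem dividedPow_succ (X : Derivation ℂ (Formal n) (Formal n)) (k : ℕ) (F : Formal n) :
    X (dividedPow X k F) = ((k + 1 : ℕ) : ℂ) • dividedPow X (k + 1) F := by
  have hk : ((k + 1 : ℕ) : ℂ) ≠ 0 := by exact_mod_cast Nat.succ_ne_zero k
  simp only [dividedPow, LinearMap.smul_apply, smul_smul, pow_succ', Module.End.mul_apply]
  rw [Derivation.map_smul, Nat.factorial_succ, Nat.cast_mul, mul_inv, mul_inv_cancel_left₀ hk]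
  rfl

theorem dividedPow_one_eq_zero (X : Derivation ℂ (Formal n) (Formal n)) (k : ℕ) :
    dividedPow X (k + 1) 1 = 0 := by
  rw [dividedPow, LinearMap.smul_apply, pow_succ, Module.End.mul_apply]
  have : (X : Formal n →ₗ[ℂ] Formal n) 1 = 0 := X.map_one_eq_zero
  rw [this, map_zero, smul_zero]

/-- Induction through X Dₖ = (k + 1) Dₖ₊₁: writing the weight k + 1 as p.1 + p.2 and giving each
factor its share produces the two halves of X applied to a product. -/
theorem dividedPow_leibniz (X : Derivation ℂ (Formal n) (Formal n)) (k : ℕ) (F G : Formal n) :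
    dividedPow X k (F * G) =
      ∑ p ∈ Finset.HasAntidiagonal.antidiagonal k, dividedPow X p.1 F * dividedPow X p.2 G := by
  induction k with
  | zero => simp [dividedPow_zero]
  | succ k ih =>
    have hk : ((k + 1 : ℕ) : ℂ) ≠ 0 := by exact_mod_cast Nat.succ_ne_zero k
    have h1 := dividedPow_succ X k (F * G)
    have h2 : ((k + 1 : ℕ) : ℂ) • ∑ p ∈ Finset.HasAntidiagonal.antidiagonal (k + 1),
        dividedPow X p.1 F * dividedPow X p.2 G =
        ∑ p ∈ Finset.HasAntidiagonal.antidiagonal (k + 1), ((p.1 : ℂ) • dividedPow X p.1 F) * dividedPow X p.2 G +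
        ∑ p ∈ Finset.HasAntidiagonal.antidiagonal (k + 1),
          dividedPow X p.1 F * ((p.2 : ℂ) • dividedPow X p.2 G) := by
      rw [← Finset.sum_add_distrib, Finset.smul_sum]
      refine Finset.sum_congr rfl fun p hp => ?_
      rw [← Finset.HasAntidiagonal.mem_antidiagonal.mp hp, smul_mul_assoc, mul_smul_comm, ← add_smul, Nat.cast_add]
    rw [Finset.Nat.sum_antidiagonal_succ
      (f := fun p => ((p.1 : ℂ) • dividedPow X p.1 F) * dividedPow X p.2 G), Finset.Nat.sum_antidiagonal_succ'
      (f := fun p => dividedPow X p.1 F * ((p.2 : ℂ) • dividedPow X p.2 G))] at h2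
    simp only [← dividedPow_succ, Nat.cast_zero, zero_smul, mul_zero, zero_mul, zero_add] at h2
    rw [ih, map_sum] at h1
    simp only [Derivation.leibniz, smul_eq_mul] at h1
    rw [Finset.sum_add_distrib] at h1
    have h3 : ((k + 1 : ℕ) : ℂ) • dividedPow X (k + 1) (F * G) = ((k + 1 : ℕ) : ℂ) •
        ∑ p ∈ Finset.HasAntidiagonal.antidiagonal (k + 1), dividedPow X p.1 F * dividedPow X p.2 G := by
      rw [h2, ← h1, add_comm]
      congr 1
      exact Finset.sum_congr rfl fun p _ => mul_comm _ _
    exact smul_right_injective _ hk h3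

/-- The divided powers of a derivation which raises the order. -/
theorem higherDerivation_dividedPow {X : Derivation ℂ (Formal n) (Formal n)}
    (hX : ∀ N, ∀ F ∈ ordIdeal n N, X F ∈ ordIdeal n (N + 1)) :
    HigherDerivation (dividedPow X) := by
  have h1 : ∀ N k, ∀ F ∈ ordIdeal n N, dividedPow X k F ∈ ordIdeal n (N + k) := by
    intro N k F hF
    refine smul_mem_ordIdeal _ ?_
    induction k with
    | zero => exact hF
    | succ k ih =>
      rw [pow_succ', Module.End.mul_apply]
      exact hX _ _ ih
  refine ⟨dividedPow_zero X, dividedPow_one_eq_zero X, dividedPow_leibniz X, fun k F => ?_,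
    fun N k F hF => ordIdeal_anti (by omega) (h1 N k F hF)⟩
  have := h1 0 k F (mem_ordIdeal_zero F)
  rwa [zero_add] at this

/-- The terms of the Taylor expansion of `F(x + w)`. -/
def taylorTerm (w : Formal n) (k : ℕ) : Formal n →ₗ[ℂ] Formal n :=
  (LinearMap.mulLeft ℂ (w ^ k)).comp (dividedPow (MvPowerSeries.pderiv ℂ 0) k)

theorem taylorTerm_apply (w : Formal n) (k : ℕ) (F : Formal n) :
    taylorTerm w k F = w ^ k * dividedPow (MvPowerSeries.pderiv ℂ 0) k F := rfl

/-- The factor wᵏ stays outside the differentiations, so the product formula is inherited from ∂/∂x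
even when w depends on x. Each ∂/∂x loses a degree that a factor w restores. -/
theorem higherDerivation_taylorTerm {w : Formal n} (hw : w ∈ ordIdeal n 1) :
    HigherDerivation (taylorTerm w) := by
  have h0 : ∀ k, w ^ k ∈ ordIdeal n k := fun k => by
    have := pow_mem_ordIdeal hw k
    rwa [one_mul] at this
  refine ⟨fun F => ?_, fun k => ?_, fun k F G => ?_, fun k F => Ideal.mul_mem_right _ _ (h0 k),
    fun N k F hF => ?_⟩
  · rw [taylorTerm_apply, pow_zero, one_mul, dividedPow_zero]
  · rw [taylorTerm_apply, dividedPow_one_eq_zero, mul_zero]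
  · simp only [taylorTerm_apply]
    rw [dividedPow_leibniz, Finset.mul_sum]
    refine Finset.sum_congr rfl fun p hp => ?_
    rw [← Finset.HasAntidiagonal.mem_antidiagonal.mp hp]
    ring
  · have h1 : ∀ k N, ∀ F ∈ ordIdeal n (N + k),
        dividedPow (MvPowerSeries.pderiv ℂ 0) k F ∈ ordIdeal n N := by
      intro k N F hF
      refine smul_mem_ordIdeal _ ?_
      induction k generalizing N with
      | zero => exact hF
      | succ k ih =>
        rw [pow_succ', Module.End.mul_apply]
        exact partialD_mem_ordIdeal 0 (ih (N + 1) (by rwa [add_right_comm]))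
    rw [taylorTerm_apply]
    rcases le_total N k with h | h
    · exact ordIdeal_anti h (Ideal.mul_mem_right _ _ (h0 k))
    · have := mul_mem_ordIdeal (h0 k) (h1 k (N - k) F (by rwa [Nat.sub_add_cancel h]))
      rwa [Nat.add_sub_cancel' h] at this

/-! ### Weighted norms and preservation of convergence -/

/-- The weighted `ℓ¹` norm on the polydisc of radius `r`. -/
def wnorm (r : ℝ≥0) (F : Formal n) : ℝ≥0∞ :=
  ∑' d : Fin (n + 1) →₀ ℕ, (‖MvPowerSeries.coeff d F‖₊ * r ^ d.degree : ℝ≥0)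

theorem wnorm_ne_top_iff {r : ℝ≥0} {F : Formal n} : wnorm r F ≠ ⊤ ↔
    Summable fun d : Fin (n + 1) →₀ ℕ => ‖MvPowerSeries.coeff d F‖ * (r : ℝ) ^ d.degree := by
  rw [wnorm, ENNReal.tsum_coe_ne_top_iff_summable, ← NNReal.summable_coe]
  simp

/-- The bound 1/2 costs nothing, since radii may be decreased, and it makes the geometric series of
ratio r in `exists_division` finite. -/
theorem isConvergent_iff_wnorm {F : Formal n} :
    IsConvergent F ↔ ∃ r : ℝ≥0, 0 < r ∧ r ≤ 1 / 2 ∧ wnorm r F ≠ ⊤ := by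
  constructor
  · rintro ⟨r, hr, h⟩
    have hm : 0 < min r (1 / 2) := lt_min hr (by norm_num)
    refine ⟨⟨min r (1 / 2), hm.le⟩, hm, ?_, ?_⟩
    · exact min_le_right r (1 / 2)
    · exact wnorm_ne_top_iff.mpr (IsConvergent.mono hm (min_le_left _ _) h)
  · rintro ⟨r, hr, _, h⟩
    exact ⟨r, hr, wnorm_ne_top_iff.mp h⟩

theorem wnorm_le_of_coeff_le {r : ℝ≥0} {F G : Formal n}
    (h : ∀ d, ‖MvPowerSeries.coeff d F‖₊ ≤ ‖MvPowerSeries.coeff d G‖₊) :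
    wnorm r F ≤ wnorm r G := by
  refine ENNReal.tsum_le_tsum fun d => ?_
  exact ENNReal.coe_le_coe.mpr (mul_le_mul_left (h d) _)

theorem single_add_injective (i : Fin (n + 1)) :
    Function.Injective fun d : Fin (n + 1) →₀ ℕ => d + Finsupp.single i 1 :=
  fun _ _ h => add_right_cancel h

theorem mem_range_add_single {i : Fin (n + 1)} {d : Fin (n + 1) →₀ ℕ} (h : d i ≠ 0) :
    ∃ e, e + Finsupp.single i 1 = d :=
  ⟨d - Finsupp.single i 1, tsub_add_cancel_of_le
    (Finsupp.single_le_iff.mpr (Nat.one_le_iff_ne_zero.mpr h))⟩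

theorem wnorm_le_mul_of_coeff_le {r : ℝ≥0} {F G : Formal n} (i : Fin (n + 1))
    (h0 : ∀ d : Fin (n + 1) →₀ ℕ, d i = 0 → MvPowerSeries.coeff d F = 0)
    (h : ∀ d, ‖MvPowerSeries.coeff (d + Finsupp.single i 1) F‖₊ ≤ ‖MvPowerSeries.coeff d G‖₊) :
    wnorm r F ≤ r * wnorm r G := by
  rw [wnorm, ← Function.Injective.tsum_eq (single_add_injective i), wnorm, ← ENNReal.tsum_mul_left]
  · refine ENNReal.tsum_le_tsum fun d => ?_
    rw [← ENNReal.coe_mul, ENNReal.coe_le_coe, map_add, Finsupp.degree_single, pow_succ]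
    calc _ = r * (‖MvPowerSeries.coeff (d + Finsupp.single i 1) F‖₊ * r ^ d.degree) := by ring
      _ ≤ _ := mul_le_mul_right (mul_le_mul_left (h d) _) _
  · intro d hd
    refine mem_range_add_single fun h' => hd ?_
    simp [h0 d h']

theorem coeff_X_mul_of_eq_zero (i : Fin (n + 1)) (F : Formal n) {d : Fin (n + 1) →₀ ℕ}
    (h : d i = 0) : MvPowerSeries.coeff d (MvPowerSeries.X i * F) = 0 :=
  MvPowerSeries.X_dvd_iff.mp (dvd_mul_right _ _) d h

theorem coeff_add_single_X_mul (i : Fin (n + 1)) (F : Formal n) (d : Fin (n + 1) →₀ ℕ) :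
    MvPowerSeries.coeff (d + Finsupp.single i 1) (MvPowerSeries.X i * F) =
      MvPowerSeries.coeff d F := by
  rw [add_comm d, MvPowerSeries.X, MvPowerSeries.coeff_add_monomial_mul, one_mul]

theorem wnorm_X_mul_le (r : ℝ≥0) (i : Fin (n + 1)) (F : Formal n) :
    wnorm r (MvPowerSeries.X i * F) ≤ r * wnorm r F :=
  wnorm_le_mul_of_coeff_le i (fun _ h => coeff_X_mul_of_eq_zero i F h)
    fun d => by rw [coeff_add_single_X_mul]

/-- The quotient `(F - F|_{X_i = 0}) / X_i`. -/
def shift (i : Fin (n + 1)) (F : Formal n) : Formal n :=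
  fun d => MvPowerSeries.coeff (d + Finsupp.single i 1) F

theorem coeff_shift (i : Fin (n + 1)) (F : Formal n) (d : Fin (n + 1) →₀ ℕ) :
    MvPowerSeries.coeff d (shift i F) = MvPowerSeries.coeff (d + Finsupp.single i 1) F := rfl

theorem wnorm_shift_le (r : ℝ≥0) (i : Fin (n + 1)) (F : Formal n) :
    r * wnorm r (shift i F) ≤ wnorm r F := by
  rw [wnorm, ← ENNReal.tsum_mul_left]
  refine le_trans (le_of_eq ?_) (ENNReal.tsum_comp_le_tsum_of_injective (single_add_injective i) _)
  refine tsum_congr fun d => ?_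
  rw [← ENNReal.coe_mul, coeff_shift, map_add, Finsupp.degree_single, pow_succ]
  congr 1
  ring

/-- The restriction `F|_{X_i = 0}`. -/
def restrictZero (i : Fin (n + 1)) (F : Formal n) : Formal n :=
  fun d => if d i = 0 then MvPowerSeries.coeff d F else 0

theorem coeff_restrictZero (i : Fin (n + 1)) (F : Formal n) (d : Fin (n + 1) →₀ ℕ) :
    MvPowerSeries.coeff d (restrictZero i F) = if d i = 0 then MvPowerSeries.coeff d F else 0 := rfl

theorem wnorm_restrictZero_le (r : ℝ≥0) (i : Fin (n + 1)) (F : Formal n) :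
    wnorm r (restrictZero i F) ≤ wnorm r F :=
  wnorm_le_of_coeff_le fun d => by
    rw [coeff_restrictZero]
    split_ifs <;> simp

theorem X_mul_shift_add_restrictZero (i : Fin (n + 1)) (F : Formal n) :
    MvPowerSeries.X i * shift i F + restrictZero i F = F := by
  ext d
  rw [map_add, coeff_restrictZero]
  by_cases h : d i = 0
  · rw [coeff_X_mul_of_eq_zero i _ h, if_pos h, zero_add]
  · obtain ⟨e, rfl⟩ := mem_range_add_single h
    rw [coeff_add_single_X_mul, coeff_shift, if_neg h, add_zero]

theorem partialD_eq_zero_iff {i : Fin (n + 1)} {F : Formal n} :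
    partialD i F = 0 ↔ ∀ d : Fin (n + 1) →₀ ℕ, d i ≠ 0 → MvPowerSeries.coeff d F = 0 := by
  constructor
  · intro h d hd
    obtain ⟨e, rfl⟩ := mem_range_add_single hd
    have h1 : MvPowerSeries.coeff e (partialD i F) = 0 := by rw [h, map_zero]
    rw [MvPowerSeries.coeff_pderiv] at h1
    exact (mul_eq_zero.mp h1).resolve_right (Nat.cast_add_one_ne_zero _)
  · intro h
    ext d
    rw [MvPowerSeries.coeff_pderiv, h _ (by simp), zero_mul, map_zero]

theorem partialD_restrictZero_self (i : Fin (n + 1)) (F : Formal n) :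
    partialD i (restrictZero i F) = 0 :=
  partialD_eq_zero_iff.mpr fun _ hd => if_neg hd

theorem partialD_restrictZero {i j : Fin (n + 1)} {F : Formal n} (h : partialD i F = 0) :
    partialD i (restrictZero j F) = 0 := by
  refine partialD_eq_zero_iff.mpr fun d hd => ?_
  rw [coeff_restrictZero, partialD_eq_zero_iff.mp h d hd, ite_self]

theorem partialD_shift {i j : Fin (n + 1)} {F : Formal n} (h : partialD i F = 0) :
    partialD i (shift j F) = 0 := by
  refine partialD_eq_zero_iff.mpr fun d hd => partialD_eq_zero_iff.mp h _ ?_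
  simp [hd]

/-- A power series without `X_i` which is divisible by `X_i` vanishes. -/
theorem eq_zero_of_partialD_of_X_dvd {i : Fin (n + 1)} {F : Formal n} (h : partialD i F = 0)
    (h' : MvPowerSeries.X i ∣ F) : F = 0 := by
  ext d
  by_cases hd : d i = 0
  · exact MvPowerSeries.X_dvd_iff.mp h' d hd
  · exact partialD_eq_zero_iff.mp h d hd

/-- The quotient by `X_i` of the primitive of `F` with respect to `X_i`. -/
def primitiveQuot (i : Fin (n + 1)) (F : Formal n) : Formal n :=
  fun d => MvPowerSeries.coeff d F / ((d i : ℂ) + 1)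

theorem coeff_primitiveQuot (i : Fin (n + 1)) (F : Formal n) (d : Fin (n + 1) →₀ ℕ) :
    MvPowerSeries.coeff d (primitiveQuot i F) = MvPowerSeries.coeff d F / ((d i : ℂ) + 1) := rfl

/-- The primitive with respect to `X_i` which vanishes on `X_i = 0`. -/
def primitive (i : Fin (n + 1)) (F : Formal n) : Formal n :=
  MvPowerSeries.X i * primitiveQuot i F

theorem partialD_primitive (i : Fin (n + 1)) (F : Formal n) : partialD i (primitive i F) = F := by
  ext d
  rw [MvPowerSeries.coeff_pderiv, primitive, coeff_add_single_X_mul,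
    coeff_primitiveQuot]
  exact div_mul_cancel₀ _ (Nat.cast_add_one_ne_zero _)

theorem X_dvd_primitive (i : Fin (n + 1)) (F : Formal n) : MvPowerSeries.X i ∣ primitive i F :=
  dvd_mul_right _ _

theorem wnorm_primitive_le (r : ℝ≥0) (i : Fin (n + 1)) (F : Formal n) :
    wnorm r (primitive i F) ≤ r * wnorm r F := by
  refine (wnorm_X_mul_le r i _).trans ?_
  gcongr
  refine wnorm_le_of_coeff_le fun d => ?_
  rw [coeff_primitiveQuot, nnnorm_div]
  refine div_le_self zero_le ?_
  rw [← NNReal.coe_le_coe, coe_nnnorm, NNReal.coe_one, ← Nat.cast_succ, Complex.norm_natCast]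
  exact_mod_cast Nat.succ_le_succ (Nat.zero_le _)

theorem wnorm_fsum_le (r : ℝ≥0) (c : ℕ → Formal n) : wnorm r (fsum c) ≤ ∑' k, wnorm r (c k) := by
  simp only [wnorm]
  rw [ENNReal.tsum_comm]
  refine ENNReal.tsum_le_tsum fun d => ?_
  have h : MvPowerSeries.coeff d (fsum c) =
    ∑ k ∈ Finset.range (d.degree + 1), MvPowerSeries.coeff d (c k) := rfl
  refine le_trans ?_ (ENNReal.sum_le_tsum (Finset.range (d.degree + 1)))
  rw [h, ← ENNReal.ofNNReal_finsetSum, ENNReal.coe_le_coe, ← Finset.sum_mul]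
  exact mul_le_mul_left (nnnorm_sum_le _ _) _

theorem IsConvergent.shift {F : Formal n} (hF : IsConvergent F) (i : Fin (n + 1)) :
    IsConvergent (shift i F) := by
  obtain ⟨r, hr, hr', h⟩ := isConvergent_iff_wnorm.mp hF
  refine isConvergent_iff_wnorm.mpr ⟨r, hr, hr', fun h' => h ?_⟩
  have := wnorm_shift_le r i F
  rwa [h', ENNReal.mul_top (by exact_mod_cast hr.ne'), top_le_iff] at this

theorem IsConvergent.restrictZero {F : Formal n} (hF : IsConvergent F) (i : Fin (n + 1)) :
    IsConvergent (restrictZero i F) := by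
  obtain ⟨r, hr, hr', h⟩ := isConvergent_iff_wnorm.mp hF
  exact isConvergent_iff_wnorm.mpr ⟨r, hr, hr', ne_top_of_le_ne_top h (wnorm_restrictZero_le r i F)⟩

theorem IsConvergent.primitive {F : Formal n} (hF : IsConvergent F) (i : Fin (n + 1)) :
    IsConvergent (primitive i F) := by
  obtain ⟨r, hr, hr', h⟩ := isConvergent_iff_wnorm.mp hF
  exact isConvergent_iff_wnorm.mpr ⟨r, hr, hr',
    ne_top_of_le_ne_top (ENNReal.mul_ne_top ENNReal.coe_ne_top h) (wnorm_primitive_le r i F)⟩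

/-- Halving the radius absorbs the factors d i + 1 ≤ 2 ^ |d| created by differentiation. -/
theorem IsConvergent.partialD {F : Formal n} (hF : IsConvergent F) (i : Fin (n + 1)) :
    IsConvergent (partialD i F) := by
  obtain ⟨r, hr, h⟩ := hF
  refine ⟨r / 2, by positivity, ?_⟩
  have h1 := (h.comp_injective (single_add_injective i)).mul_left r⁻¹
  refine h1.of_nonneg_of_le (fun d => by positivity) fun d => ?_
  have h2 : (d i : ℝ) + 1 ≤ 2 ^ d.degree := by
    have h3 : d i ≤ d.degree := Finsupp.le_degree i d
    have h4 : d.degree < 2 ^ d.degree := Nat.lt_two_pow_self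
    exact_mod_cast (by omega : d i + 1 ≤ 2 ^ d.degree)
  have h5 : ‖((d i : ℂ) + 1)‖ = (d i : ℝ) + 1 := by
    rw [← Nat.cast_succ, Complex.norm_natCast, Nat.cast_succ]
  simp only [Function.comp_apply, MvPowerSeries.coeff_pderiv, norm_mul, h5, map_add,
    Finsupp.degree_single, pow_succ, div_pow]
  calc _ ≤ ‖MvPowerSeries.coeff (d + Finsupp.single i 1) F‖ * 2 ^ d.degree *
        (r ^ d.degree / 2 ^ d.degree) := by gcongr
    _ = _ := by field_simp

theorem IsConvergent.sub {A B : Formal n} (hA : IsConvergent A) (hB : IsConvergent B) :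
    IsConvergent (A - B) :=
  (Conv n).sub_mem (x := A) (y := B) hA hB

theorem isConvergent_X (i : Fin (n + 1)) : IsConvergent (MvPowerSeries.X i : Formal n) :=
  (coord n i).2

/-! ### Division by x₂ - x x₁ and primality -/

theorem coe_g₀ : (g₀ n : Formal n) = MvPowerSeries.X 2 - MvPowerSeries.X 0 * MvPowerSeries.X 1 := rfl

/-- Numerals in `Fin (n + 1)` are read modulo n + 1; the bound n ≥ 2 is what keeps the indices 0, 1,
2 distinct. -/
theorem fin_zero_ne_one (hn : 2 ≤ n) : (0 : Fin (n + 1)) ≠ 1 := by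
  rw [Ne, Fin.ext_iff]
  change ¬ 0 % (n + 1) = 1 % (n + 1)
  rw [Nat.mod_eq_of_lt (by omega), Nat.mod_eq_of_lt (by omega)]
  omega

theorem fin_zero_ne_two (hn : 2 ≤ n) : (0 : Fin (n + 1)) ≠ 2 := by
  rw [Ne, Fin.ext_iff]
  change ¬ 0 % (n + 1) = 2 % (n + 1)
  rw [Nat.mod_eq_of_lt (by omega), Nat.mod_eq_of_lt (by omega)]
  omega

theorem fin_one_ne_two (hn : 2 ≤ n) : (1 : Fin (n + 1)) ≠ 2 := by
  rw [Ne, Fin.ext_iff]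
  change ¬ 1 % (n + 1) = 2 % (n + 1)
  rw [Nat.mod_eq_of_lt (by omega), Nat.mod_eq_of_lt (by omega)]
  omega

theorem X_mem_ordIdeal (i : Fin (n + 1)) : (MvPowerSeries.X i : Formal n) ∈ ordIdeal n 1 :=
  mem_ordIdeal_one.mpr (MvPowerSeries.constantCoeff_X i)

theorem partialD_mul (i : Fin (n + 1)) (F G : Formal n) :
    partialD i (F * G) = F * partialD i G + partialD i F * G := by
  rw [partialD, Derivation.leibniz, smul_eq_mul, smul_eq_mul, mul_comm G]

theorem partialD_X_ne {i j : Fin (n + 1)} (h : j ≠ i) :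
    partialD i (MvPowerSeries.X j : Formal n) = 0 := MvPowerSeries.pderiv_X_of_ne h

theorem partialD_mul_eq_zero {i : Fin (n + 1)} {F G : Formal n} (hF : partialD i F = 0)
    (hG : partialD i G = 0) : partialD i (F * G) = 0 := by
  rw [partialD_mul, hF, hG, mul_zero, zero_mul, add_zero]

theorem partialD_pow_eq_zero {i : Fin (n + 1)} {F : Formal n} (hF : partialD i F = 0) (k : ℕ) :
    partialD i (F ^ k) = 0 := by
  rw [partialD, Derivation.leibniz_pow]
  simp only [partialD] at hF
  rw [hF, smul_zero, smul_zero]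

theorem partialD_fsum_eq_zero {i : Fin (n + 1)} {c : ℕ → Formal n} (hc : ∀ k, c k ∈ ordIdeal n k)
    (h : ∀ k, partialD i (c k) = 0) : partialD i (fsum c) = 0 := by
  refine eq_of_sub_mem_ordIdeal fun N => ?_
  have := partialD_fsum_sub_mem i hc N
  rwa [Finset.sum_eq_zero fun k _ => h k] at this

/-- Division by `x₂ - x x₁` with a remainder which does not depend on `x₂`. -/
theorem exists_division (hn : 2 ≤ n) (A : Formal n) : ∃ Q ρ : Formal n,
    A = (g₀ n : Formal n) * Q + ρ ∧ partialD 2 ρ = 0 ∧ (IsConvergent A → IsConvergent Q) := by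
  set w : Formal n := MvPowerSeries.X 0 * MvPowerSeries.X 1 with hw
  have hw1 : w ∈ ordIdeal n 1 := Ideal.mul_mem_right _ _ (X_mem_ordIdeal 0)
  have hwk : ∀ k, w ^ k ∈ ordIdeal n k := fun k => by
    simpa using pow_mem_ordIdeal hw1 k
  have hc : ∀ c : ℕ → Formal n, ∀ k, w ^ k * c k ∈ ordIdeal n k :=
    fun c k => Ideal.mul_mem_right _ _ (hwk k)
  have hs := hc fun k => (shift 2)^[k] A
  have hs' := hc fun k => (shift 2)^[k + 1] A
  have hr := hc fun k => restrictZero 2 ((shift 2)^[k] A)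
  -- With S = `shift 2`: the remainder is A with x₂ replaced by w = x x₁, and Q = ∑ wᵏ Sᵏ⁺¹ A is the
  -- difference quotient (A - ρ)/(x₂ - w).
  refine ⟨fsum fun k => w ^ k * (shift 2)^[k + 1] A,
    fsum fun k => w ^ k * restrictZero 2 ((shift 2)^[k] A), ?_, ?_, ?_⟩
  -- The sum ∑ wᵏ Sᵏ A is computed twice: splitting each Sᵏ A by powers of x₂ gives x₂ Q + ρ, and
  -- detaching the term k = 0 gives A + w Q.
  · have h1 : fsum (fun k => w ^ k * (shift 2)^[k] A) =
        MvPowerSeries.X 2 * fsum (fun k => w ^ k * (shift 2)^[k + 1] A) +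
          fsum fun k => w ^ k * restrictZero 2 ((shift 2)^[k] A) := by
      rw [← fsum_mul_left (c := fun k => w ^ k * (shift 2)^[k + 1] A) _ hs',
        ← fsum_add (c := fun k => MvPowerSeries.X 2 * (w ^ k * (shift 2)^[k + 1] A))
          (fun k => Ideal.mul_mem_left _ _ (hs' k)) hr]
      congr 1
      funext k
      rw [Function.iterate_succ_apply']
      conv_lhs => rw [← X_mul_shift_add_restrictZero 2 ((shift 2)^[k] A)]
      ring
    have h2 := fsum_succ (c := fun k => w ^ k * (shift 2)^[k] A)
      (c' := fun k => w ^ k * (shift 2)^[k + 1] A) w hs hs' (fun k => by ring)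
    simp only [pow_zero, Function.iterate_zero, id_eq, one_mul] at h2
    rw [coe_g₀]
    linear_combination h1 - h2
  · refine partialD_fsum_eq_zero hr fun k => partialD_mul_eq_zero
      (partialD_pow_eq_zero (partialD_mul_eq_zero ?_ ?_) k) (partialD_restrictZero_self 2 _)
    · exact partialD_X_ne (fin_zero_ne_two hn)
    · exact partialD_X_ne (fin_one_ne_two hn)
  · intro hA
    obtain ⟨r, hr, hr', h⟩ := isConvergent_iff_wnorm.mp hA
    refine isConvergent_iff_wnorm.mpr ⟨r, hr, hr', fun h' => ?_⟩
    have h1 : ∀ k, (r : ℝ≥0∞) ^ k * wnorm r ((shift 2)^[k] A) ≤ wnorm r A := by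
      intro k
      induction k with
      | zero => simp
      | succ k ih =>
        rw [Function.iterate_succ_apply', pow_succ, mul_assoc]
        refine le_trans ?_ ih
        gcongr
        exact wnorm_shift_le r 2 _
    have h2 : ∀ k (F : Formal n), wnorm r (w ^ k * F) ≤ (r : ℝ≥0∞) ^ k * (r ^ k * wnorm r F) := by
      intro k F
      induction k with
      | zero => simp
      | succ k ih =>
        rw [pow_succ', mul_assoc, hw, mul_assoc]
        refine (wnorm_X_mul_le r 0 _).trans ?_
        calc _ ≤ (r : ℝ≥0∞) * (r * ((r : ℝ≥0∞) ^ k * (r ^ k * wnorm r F))) := by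
              gcongr
              refine (wnorm_X_mul_le r 1 _).trans ?_
              gcongr
          _ = _ := by ring
    -- Each shift costs a factor 1/r and each w gains r², so r times the k-th term of Q has norm at
    -- most rᵏ times that of A.
    have h3 : r * wnorm r (fsum fun k => w ^ k * (shift 2)^[k + 1] A) ≤
        (1 - (r : ℝ≥0∞))⁻¹ * wnorm r A := by
      rw [← ENNReal.tsum_geometric, ← ENNReal.tsum_mul_right]
      calc _ ≤ r * ∑' k, wnorm r (w ^ k * (shift 2)^[k + 1] A) := by
            gcongr
            exact wnorm_fsum_le r _
        _ = ∑' k, r * wnorm r (w ^ k * (shift 2)^[k + 1] A) := by rw [ENNReal.tsum_mul_left]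
        _ ≤ _ := by
          refine ENNReal.tsum_le_tsum fun k => ?_
          calc _ ≤ r * ((r : ℝ≥0∞) ^ k * (r ^ k * wnorm r ((shift 2)^[k + 1] A))) := by
                gcongr
                exact h2 k _
            _ = r ^ k * (r ^ (k + 1) * wnorm r ((shift 2)^[k + 1] A)) := by ring
            _ ≤ _ := by
              gcongr
              exact h1 (k + 1)
    rw [h', ENNReal.mul_top (by exact_mod_cast hr.ne'), top_le_iff, ENNReal.mul_eq_top] at h3
    rcases h3 with ⟨_, h3⟩ | ⟨h3, _⟩
    · exact h h3
    · rw [ENNReal.inv_eq_top, tsub_eq_zero_iff_le] at h3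
      have h4 : (1 : ℝ≥0) ≤ r := by exact_mod_cast h3
      exact absurd (h4.trans hr') (not_le.mpr one_half_lt_one)

/-- This is uniqueness in the division. The coefficients of x₂ Q must be those of x x₁ Q; the first
product shifts degrees by one and the second by two, so the order of Q exceeds every bound. -/
theorem eq_zero_of_g₀_mul_indep {Q : Formal n} (h : partialD 2 ((g₀ n : Formal n) * Q) = 0) :
    Q = 0 := by
  refine eq_of_sub_mem_ordIdeal fun N => ?_
  rw [sub_zero]
  induction N with
  | zero => exact mem_ordIdeal_zero _
  | succ N ih =>
    intro d hd
    have h1 := partialD_eq_zero_iff.mp h (d + Finsupp.single 2 1) (by simp)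
    rw [coe_g₀, sub_mul, map_sub, coeff_add_single_X_mul, mul_assoc] at h1
    have h2 := mul_mem_ordIdeal (X_mem_ordIdeal 0) (mul_mem_ordIdeal (X_mem_ordIdeal 1) ih)
    rw [h2 _ (by rw [map_add, Finsupp.degree_single]; omega), sub_zero] at h1
    exact h1

/-- The product of the two remainders is free of x₂ and divisible by g, hence zero by uniqueness;
formal power series form a domain. -/
theorem g₀_dvd_mul (hn : 2 ≤ n) {A B : Formal n} (h : (g₀ n : Formal n) ∣ A * B) :
    (g₀ n : Formal n) ∣ A ∨ (g₀ n : Formal n) ∣ B := by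
  obtain ⟨Q, ρ, hA, hρ, _⟩ := exists_division hn A
  obtain ⟨Q', ρ', hB, hρ', _⟩ := exists_division hn B
  obtain ⟨K, hK⟩ := h
  have h1 : (g₀ n : Formal n) * (K - g₀ n * Q * Q' - Q * ρ' - Q' * ρ) = ρ * ρ' := by
    rw [hA, hB] at hK
    linear_combination -hK
  have h2 : ρ * ρ' = 0 := by
    have h3 := partialD_mul_eq_zero hρ hρ'
    rw [← h1] at h3
    rw [← h1, eq_zero_of_g₀_mul_indep h3, mul_zero]
  rcases mul_eq_zero.mp h2 with h3 | h3
  · exact Or.inl ⟨Q, by rw [hA, h3, add_zero]⟩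
  · exact Or.inr ⟨Q', by rw [hB, h3, add_zero]⟩

theorem partialD_two_g₀ (hn : 2 ≤ n) : partialD 2 (g₀ n : Formal n) = 1 := by
  rw [coe_g₀, partialD, map_sub, MvPowerSeries.pderiv_X_self]
  have := partialD_mul_eq_zero (partialD_X_ne (fin_zero_ne_two hn)) (partialD_X_ne (fin_one_ne_two hn))
  simp only [partialD] at this
  rw [this, sub_zero]

theorem partialD_zero_g₀ (hn : 2 ≤ n) :
    partialD 0 (g₀ n : Formal n) = -MvPowerSeries.X 1 := by
  rw [coe_g₀, partialD, map_sub, MvPowerSeries.pderiv_X_of_ne (fin_zero_ne_two hn).symm]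
  have := partialD_mul 0 (MvPowerSeries.X 0 : Formal n) (MvPowerSeries.X 1)
  simp only [partialD] at this
  rw [this, MvPowerSeries.pderiv_X_self, MvPowerSeries.pderiv_X_of_ne (fin_zero_ne_one hn).symm]
  ring

theorem coe_g₀_ne_zero (hn : 2 ≤ n) : (g₀ n : Formal n) ≠ 0 := by
  intro h
  have := partialD_two_g₀ hn
  rw [h, partialD, map_zero] at this
  exact zero_ne_one this

theorem g₀_mem_ordIdeal : (g₀ n : Formal n) ∈ ordIdeal n 1 :=
  Ideal.sub_mem _ (X_mem_ordIdeal 2) (Ideal.mul_mem_right _ _ (X_mem_ordIdeal 0))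

theorem not_isUnit_of_mem_ordIdeal_one {F : Formal n} (h : F ∈ ordIdeal n 1) : ¬ IsUnit F := by
  intro h'
  have := h'.map (MvPowerSeries.constantCoeff (σ := Fin (n + 1)) (R := ℂ))
  rw [mem_ordIdeal_one.mp h] at this
  exact not_isUnit_zero this

theorem prime_coe_g₀ (hn : 2 ≤ n) : Prime (g₀ n : Formal n) :=
  ⟨coe_g₀_ne_zero hn, not_isUnit_of_mem_ordIdeal_one g₀_mem_ordIdeal, fun _ _ => g₀_dvd_mul hn⟩

/-- By uniqueness a formal quotient is the convergent one of `exists_division`, so divisibility by g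
may be tested formally. -/
theorem g₀_dvd_iff (hn : 2 ≤ n) {A : Conv n} : g₀ n ∣ A ↔ (g₀ n : Formal n) ∣ (A : Formal n) := by
  constructor
  · rintro ⟨B, rfl⟩
    exact ⟨B, rfl⟩
  · rintro ⟨B, hB⟩
    obtain ⟨Q, ρ, hA, hρ, hQ⟩ := exists_division hn (A : Formal n)
    have h1 : (g₀ n : Formal n) * (B - Q) = ρ := by
      linear_combination hA - hB
    rw [← h1] at hρ
    have h2 := eq_zero_of_g₀_mul_indep hρ
    refine ⟨⟨Q, hQ A.2⟩, Subtype.ext ?_⟩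
    rw [hA, ← h1, h2, mul_zero, add_zero]
    rfl

theorem prime_g₀ (hn : 2 ≤ n) : Prime (g₀ n) := by
  refine ⟨fun h => coe_g₀_ne_zero hn (congrArg Subtype.val h), fun h => ?_, fun A B h => ?_⟩
  · exact not_isUnit_of_mem_ordIdeal_one g₀_mem_ordIdeal (h.map (Conv n).val)
  · rw [g₀_dvd_iff hn, g₀_dvd_iff hn]
    exact g₀_dvd_mul hn ((g₀_dvd_iff hn).mp h)

/-! ### Normal form of the equations free of residues -/

/-- Normal form of the numerators `A` of the equations `∂α/∂x = A / (x₂ - x x₁)²` which are free of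
residues. -/
theorem exists_special_normal_form (hn : 2 ≤ n) {A : Formal n}
    (h : (g₀ n : Formal n) ∣ partialD 0 A) : ∃ β c : Formal n,
      A = (g₀ n : Formal n) * partialD 0 β + MvPowerSeries.X 1 * β + c ∧
      (∀ i ∈ ({0, 1, 2} : Set (Fin (n + 1))), partialD i c = 0) ∧
      (IsConvergent A → IsConvergent β ∧ IsConvergent c) := by
  obtain ⟨B, hB⟩ := h
  set β := primitive 0 (primitive 0 B) with hβ
  have hβ1 : partialD 0 β = primitive 0 B := partialD_primitive 0 _
  have hβ2 : partialD 0 (primitive 0 B) = B := partialD_primitive 0 _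
  have hX1 : partialD 0 (MvPowerSeries.X 1 : Formal n) = 0 := partialD_X_ne (fin_zero_ne_one hn).symm
  set C := restrictZero 0 A with hC
  have hA : A = (g₀ n : Formal n) * partialD 0 β + MvPowerSeries.X 1 * β + C := by
    -- In the derivative of g β' + x₁ β the terms -x₁ β' and x₁ β' cancel, leaving g β'' = g B =
    -- ∂A/∂x.
    have h1 : partialD 0 (A - ((g₀ n : Formal n) * partialD 0 β + MvPowerSeries.X 1 * β + C)) = 0 := by
      have h2 := partialD_mul 0 (g₀ n : Formal n) (primitive 0 B)
      have h3 := partialD_mul 0 (MvPowerSeries.X 1 : Formal n) β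
      have h4 := partialD_restrictZero_self 0 A
      have h5 := partialD_zero_g₀ hn
      rw [hX1, hβ1] at h3
      rw [h5, hβ2] at h2
      rw [hβ1]
      simp only [partialD] at *
      rw [map_sub, map_add, map_add, h2, h3, h4, hB]
      ring
    -- The primitives vanish at x = 0, where A and C agree; a difference that is both free of x and
    -- divisible by x is zero.
    have h2 : MvPowerSeries.X 0 ∣ A - ((g₀ n : Formal n) * partialD 0 β + MvPowerSeries.X 1 * β + C) := by
      have h3 : (MvPowerSeries.X 0 : Formal n) ∣ A - C :=
        ⟨shift 0 A, by linear_combination -X_mul_shift_add_restrictZero 0 A⟩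
      have h4 : (MvPowerSeries.X 0 : Formal n) ∣ (g₀ n : Formal n) * partialD 0 β + MvPowerSeries.X 1 * β := by
        rw [hβ1]
        exact dvd_add (Dvd.dvd.mul_left (X_dvd_primitive _ _) _)
          (Dvd.dvd.mul_left (X_dvd_primitive _ _) _)
      have := dvd_sub h3 h4
      convert this using 1
      ring
    exact sub_eq_zero.mp (eq_zero_of_partialD_of_X_dvd h1 h2)
  have hC0 : partialD 0 C = 0 := partialD_restrictZero_self 0 A
  -- Decompose C = x₂ c₁ + x₁ c₀ + c. The choice β = x c₁ yields g c₁ + x₁ x c₁ = x₂ c₁, and β = c₀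
  -- yields x₁ c₀, since neither c₁ nor c₀ depends on x.
  set c₁ := shift 2 C with hc₁
  set c₀ := shift 1 (restrictZero 2 C) with hc₀
  have e1 : partialD 0 c₁ = 0 := partialD_shift hC0
  have e0 : partialD 0 c₀ = 0 := partialD_shift (partialD_restrictZero hC0)
  refine ⟨β + c₁ * MvPowerSeries.X 0 + c₀, restrictZero 1 (restrictZero 2 C), ?_, ?_, ?_⟩
  · have h1 : partialD 0 (β + c₁ * MvPowerSeries.X 0 + c₀) = partialD 0 β + c₁ := by
      have h2 := partialD_mul 0 c₁ (MvPowerSeries.X 0)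
      rw [e1] at h2
      simp only [partialD] at *
      rw [map_add, map_add, h2, e0, MvPowerSeries.pderiv_X_self]
      ring
    rw [h1]
    have h3 := X_mul_shift_add_restrictZero 2 C
    have h4 := X_mul_shift_add_restrictZero 1 (restrictZero 2 C)
    rw [coe_g₀] at hA ⊢
    linear_combination hA - h3 - h4
  · rintro i (rfl | rfl | rfl)
    · exact partialD_restrictZero (partialD_restrictZero hC0)
    · exact partialD_restrictZero_self 1 _
    · exact partialD_restrictZero (partialD_restrictZero_self 2 _)
  · intro hA'
    -- The quotient B was only formal; it converges because divisibility by g descends to convergent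
    -- series.
    have hB' : IsConvergent B := by
      obtain ⟨B', hB'⟩ := (g₀_dvd_iff hn (A := ⟨_, hA'.partialD 0⟩)).mpr ⟨B, hB⟩
      have h1 : (g₀ n : Formal n) * B = g₀ n * B' := by
        rw [← hB]
        exact congrArg Subtype.val hB'
      rw [mul_left_cancel₀ (coe_g₀_ne_zero hn) h1]
      exact B'.2
    have hC' : IsConvergent C := hA'.restrictZero 0
    exact ⟨(((hB'.primitive 0).primitive 0).add ((hC'.shift 2).mul (isConvergent_X 0))).add
      ((hC'.restrictZero 2).shift 1), (hC'.restrictZero 2).restrictZero 1⟩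

/-! ### Irreducible decompositions of unit multiples of (x₂ - x x₁)² -/

theorem not_g₀_dvd_X_one (hn : 2 ≤ n) : ¬ (g₀ n : Formal n) ∣ MvPowerSeries.X 1 := by
  rintro ⟨Q, hQ⟩
  have h1 : partialD 2 ((g₀ n : Formal n) * Q) = 0 := by
    rw [← hQ]
    exact partialD_X_ne (fin_one_ne_two hn)
  rw [eq_zero_of_g₀_mul_indep h1, mul_zero] at hQ
  have h2 := congrArg (MvPowerSeries.coeff (Finsupp.single 1 1)) hQ
  rw [MvPowerSeries.coeff_index_single_self_X, map_zero] at h2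
  exact one_ne_zero h2

/-- If g is a unit times some k free of x, then k divides ∂g/∂x = -x₁, and so does g; this is
excluded. -/
theorem g₀_not_isFibered (hn : 2 ≤ n) : ¬ IsFibered (g₀ n) := by
  rintro ⟨k, ⟨u, hu⟩, hk⟩
  have h1 : (g₀ n : Formal n) = k * ((u⁻¹ : (Conv n)ˣ) : Conv n) := by
    rw [← hu, ← Subalgebra.coe_mul, Units.mul_inv_cancel_right]
  have h2 := partialD_mul 0 (k : Formal n) ((u⁻¹ : (Conv n)ˣ) : Conv n)
  rw [← h1, hk, zero_mul, add_zero, partialD_zero_g₀ hn] at h2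
  have h3 : (k : Formal n) ∣ MvPowerSeries.X 1 := dvd_neg.mp ⟨_, h2⟩
  refine not_g₀_dvd_X_one hn (dvd_trans ⟨(u : Conv n), ?_⟩ h3)
  rw [← hu]
  rfl

theorem associated_g₀_of_irreducible_of_dvd (hn : 2 ≤ n) {h : Conv n} (hi : Irreducible h)
    (hd : h ∣ f₀ n) : Associated h (g₀ n) := by
  obtain ⟨i, hi2, ha⟩ := (dvd_prime_pow (prime_g₀ hn) 2).mp hd
  have h1 := ha.irreducible hi
  interval_cases i
  · rw [pow_zero] at h1
    exact absurd isUnit_one h1.not_isUnit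
  · rwa [pow_one] at ha
  · rw [pow_two] at h1
    exact absurd ((h1.isUnit_or_isUnit rfl).elim id id) (prime_g₀ hn).not_isUnit

/-- Every factor is associated to g, distinctness leaves exactly one, and comparison of powers of g
gives it the exponent 2. The raw data replace an `IrredDecomp` so that the number p can be
substituted by 1. -/
theorem prod_pow_pred_eq (hn : 2 ≤ n) {p : ℕ} {u : (Conv n)ˣ} {fac : Fin p → Conv n}
    {l : Fin p → ℕ} (hfac : ∀ j, Irreducible (fac j))
    (hdist : ∀ i j, i ≠ j → ¬ Associated (fac i) (fac j)) (hl : ∀ j, 0 < l j)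
    (h : u * ∏ j, fac j ^ l j = f₀ n) :
    ∃ w : (Conv n)ˣ, ∏ j, fac j ^ (l j - 1) = w * g₀ n := by
  have h3 : ∀ j, Associated (fac j) (g₀ n) := fun j => by
    refine associated_g₀_of_irreducible_of_dvd hn (hfac j) ?_
    rw [← h]
    exact ((dvd_pow_self _ (hl j).ne').trans (Finset.dvd_prod_of_mem
      (fun j => fac j ^ l j) (Finset.mem_univ j))).mul_left _
  have h4 : p = 1 := by
    rcases p with _ | _ | p
    · rw [Finset.univ_eq_empty, Finset.prod_empty, mul_one] at h
      have h5 : IsUnit (g₀ n ^ 2) := by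
        rw [← f₀, ← h]
        exact u.isUnit
      exact absurd ((isUnit_pow_iff two_ne_zero).mp h5) (prime_g₀ hn).not_isUnit
    · rfl
    · exact absurd ((h3 0).trans (h3 1).symm) (hdist 0 1 (by simp))
  subst h4
  simp only [Finset.univ_unique, Fin.default_eq_zero, Finset.prod_singleton] at *
  have h5 : Associated (g₀ n ^ l 0) (g₀ n ^ 2) :=
    (((h3 0).pow_pow (n := l 0)).symm).trans ⟨u, by rw [mul_comm, h, f₀]⟩
  have h6 := (pow_dvd_pow_iff (prime_g₀ hn).ne_zero (prime_g₀ hn).not_isUnit).mp h5.dvd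
  have h7 := (pow_dvd_pow_iff (prime_g₀ hn).ne_zero (prime_g₀ hn).not_isUnit).mp h5.symm.dvd
  have h8 : l 0 - 1 = 1 := by omega
  rw [h8, pow_one]
  obtain ⟨w, hw⟩ := (h3 0).symm
  exact ⟨w, by rw [← hw, mul_comm]⟩

namespace IrredDecomp

variable {f v : Conv n}

/-- A factor free of x would be associated to g, which is not fibered. -/
theorem q_eq_zero (hn : 2 ≤ n) (hv : IsUnit v) (hf : f = v * f₀ n) (d : IrredDecomp f) :
    d.q = 0 := by
  by_contra hq
  have k : Fin d.q := ⟨0, Nat.pos_of_ne_zero hq⟩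
  have h1 : d.Fac k ∣ f₀ n := by
    rw [← hv.dvd_mul_left, ← hf]
    conv_rhs => rw [d.eq]
    exact ((dvd_pow_self _ (d.m_pos k).ne').trans (Finset.dvd_prod_of_mem
      (fun k => d.Fac k ^ d.m k) (Finset.mem_univ k))).mul_left _
  exact g₀_not_isFibered hn ⟨d.Fac k, (associated_g₀_of_irreducible_of_dvd hn
    (d.Fac_irreducible k) h1).symm, d.Fac_indep k⟩

theorem fN_eq (hn : 2 ≤ n) (hv : IsUnit v) (hf : f = v * f₀ n) (d : IrredDecomp f) :
    d.fN = f := by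
  have h1 := d.q_eq_zero hn hv hf
  have : IsEmpty (Fin d.q) := by
    rw [h1]
    infer_instance
  have h2 := d.eq
  rw [Finset.univ_eq_empty (α := Fin d.q), Finset.prod_empty, mul_one] at h2
  exact h2.symm

theorem specialDenom_eq (hn : 2 ≤ n) (d : IrredDecomp (f₀ n)) :
    ∃ w : (Conv n)ˣ, d.specialDenom = w * g₀ n := by
  have h1 := d.q_eq_zero hn isUnit_one (one_mul _).symm
  have h2 := d.fN_eq hn isUnit_one (one_mul _).symm
  have : IsEmpty (Fin d.q) := by
    rw [h1]
    infer_instance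
  rw [specialDenom, Finset.univ_eq_empty (α := Fin d.q), Finset.prod_empty, mul_one]
  exact prod_pow_pred_eq hn d.fac_irreducible d.fac_distinct d.l_pos h2

end IrredDecomp

/-- The decomposition of a unit multiple of `(x₂ - x x₁)²`. -/
def decompUnitMul (hn : 2 ≤ n) (v : (Conv n)ˣ) : IrredDecomp ((v : Conv n) * f₀ n) where
  p := 1
  q := 0
  u := v
  fac := fun _ => g₀ n
  l := fun _ => 2
  Fac := Fin.elim0
  m := Fin.elim0
  fac_irreducible := fun _ => (prime_g₀ hn).irreducible
  fac_not_fibered := fun _ => g₀_not_isFibered hn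
  fac_distinct := fun i j h => absurd (Subsingleton.elim i j) h
  l_pos := fun _ => two_pos
  Fac_irreducible := fun k => k.elim0
  Fac_indep := fun k => k.elim0
  Fac_distinct := fun k => k.elim0
  m_pos := fun k => k.elim0
  eq := by simp [f₀]

/-- This is the quotient rule ∂(β/g)/∂x = (g ∂β/∂x + x₁ β)/g². The special denominator equals g only
up to a unit, which is moved into β. -/
theorem isSpecialEq_f₀_iff (hn : 2 ≤ n) (A : Conv n) : IsSpecialEq (f₀ n) A ↔
    ∃ β : Conv n, (A : Formal n) =
      (g₀ n : Formal n) * partialD 0 (β : Formal n) + MvPowerSeries.X 1 * (β : Formal n) := by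
  have hg := coe_g₀_ne_zero hn
  have hf : (f₀ n : Formal n) = (g₀ n : Formal n) ^ 2 := rfl
  constructor
  · intro h
    -- The hypothesis speaks of all decompositions, so one has to be exhibited before anything can
    -- be extracted from it.
    have d := decompUnitMul hn 1
    rw [Units.val_one, one_mul] at d
    obtain ⟨w, hw⟩ := d.specialDenom_eq hn
    obtain ⟨β, hβ⟩ := h d
    rw [IsSolution, hw] at hβ
    have hw' : (w : Conv n) * ((w⁻¹ : (Conv n)ˣ) : Conv n) = 1 := w.mul_inv
    set D : Conv n := (w : (Conv n)) with hD
    set D' : Conv n := ((w⁻¹ : (Conv n)ˣ) : Conv n) with hD'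
    have h1 : (D : Formal n) * D' = 1 := congrArg Subtype.val hw'
    refine ⟨β * D', ?_⟩
    have h2 := partialD_mul 0 (β : Formal n) (D' : Formal n)
    have h3 := partialD_mul 0 (D : Formal n) (D' : Formal n)
    have h4 := partialD_mul 0 (D : Formal n) (g₀ n : Formal n)
    rw [h1, partialD, MvPowerSeries.pderiv_one] at h3
    rw [partialD_zero_g₀ hn] at h4
    rw [Subalgebra.coe_mul, h4, hf] at hβ
    rw [Subalgebra.coe_mul, h2]
    have hD0 : (D : Formal n) ^ 3 * (g₀ n : Formal n) ^ 2 ≠ 0 := by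
      refine mul_ne_zero (pow_ne_zero _ fun h => ?_) (pow_ne_zero _ hg)
      rw [h, zero_mul] at h1
      exact zero_ne_one h1
    refine mul_left_cancel₀ hD0 ?_
    generalize (D : Formal n) = a at *
    generalize (D' : Formal n) = b at *
    generalize (g₀ n : Formal n) = g at *
    simp only [partialD] at *
    generalize (MvPowerSeries.pderiv ℂ 0) a = a' at *
    generalize (MvPowerSeries.pderiv ℂ 0) b = b' at *
    generalize (MvPowerSeries.pderiv ℂ 0) (β : Formal n) = β' at *
    generalize (β : Formal n) = β at *
    linear_combination (-a) * hβ + (-(g ^ 3 * a ^ 2 * β') - g ^ 2 * a ^ 2 * MvPowerSeries.X 1 * β + g ^ 3 * β * a * a') * h1 + (g ^ 3 * β * a ^ 2) * h3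
  · rintro ⟨β, hβ⟩ d
    obtain ⟨w, hw⟩ := d.specialDenom_eq hn
    refine ⟨β * (w : Conv n), ?_⟩
    have h2 := partialD_mul 0 (β : Formal n) ((w : Conv n) : Formal n)
    have h4 := partialD_mul 0 ((w : Conv n) : Formal n) (g₀ n : Formal n)
    rw [partialD_zero_g₀ hn] at h4
    rw [IsSolution, hw, Subalgebra.coe_mul, Subalgebra.coe_mul, h2, h4, hβ, hf]
    ring

/-! ### Values of convergent power series near the origin -/

theorem norm_coeff_mul_prod_le (A : Formal n) {r : ℝ} {P : Fin (n + 1) → ℂ}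
    (hP : ∀ i, ‖P i‖ ≤ r) (d : Fin (n + 1) →₀ ℕ) :
    ‖MvPowerSeries.coeff d A * ∏ i, P i ^ d i‖ ≤ ‖MvPowerSeries.coeff d A‖ * r ^ d.degree := by
  rw [norm_mul, norm_prod, Finsupp.degree_eq_sum, ← Finset.prod_pow_eq_pow_sum]
  gcongr with i
  rw [norm_pow]
  gcongr
  exact hP i

theorem summable_norm_eval {A : Formal n} {r : ℝ}
    (h : Summable fun d : Fin (n + 1) →₀ ℕ => ‖MvPowerSeries.coeff d A‖ * r ^ d.degree)
    {P : Fin (n + 1) → ℂ} (hP : ∀ i, ‖P i‖ ≤ r) :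
    Summable fun d : Fin (n + 1) →₀ ℕ => ‖MvPowerSeries.coeff d A * ∏ i, P i ^ d i‖ :=
  h.of_nonneg_of_le (fun _ => norm_nonneg _) (norm_coeff_mul_prod_le A hP)

theorem eventually_norm_le {r : ℝ} (hr : 0 < r) :
    ∀ᶠ P in 𝓝 (0 : Fin (n + 1) → ℂ), ∀ i, ‖P i‖ < r := by
  filter_upwards [Metric.ball_mem_nhds (0 : Fin (n + 1) → ℂ) hr] with P hP i
  exact (norm_le_pi_norm P i).trans_lt (by simpa using hP)

theorem IsConvergent.eventually_summable {A : Formal n} (hA : IsConvergent A) :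
    ∀ᶠ P in 𝓝 (0 : Fin (n + 1) → ℂ),
      Summable fun d : Fin (n + 1) →₀ ℕ => ‖MvPowerSeries.coeff d A * ∏ i, P i ^ d i‖ := by
  obtain ⟨r, hr, h⟩ := hA
  filter_upwards [eventually_norm_le hr] with P hP
  exact summable_norm_eval h fun i => (hP i).le

theorem IsConvergent.eventually_evalAt_mul {A B : Formal n} (hA : IsConvergent A)
    (hB : IsConvergent B) :
    ∀ᶠ P in 𝓝 (0 : Fin (n + 1) → ℂ), evalAt (A * B) P = evalAt A P * evalAt B P := by
  classical
  filter_upwards [hA.eventually_summable, hB.eventually_summable] with P h1 h2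
  have h3 := summable_mul_of_summable_norm h1 h2
  rw [evalAt, evalAt, evalAt, h1.of_norm.tsum_mul_tsum_eq_tsum_sum_antidiagonal h2.of_norm h3]
  refine tsum_congr fun d => ?_
  rw [MvPowerSeries.coeff_mul, Finset.sum_mul]
  refine Finset.sum_congr rfl fun p hp => ?_
  rw [← Finset.HasAntidiagonal.mem_antidiagonal.mp hp]
  simp only [Finsupp.add_apply, pow_add, Finset.prod_mul_distrib]
  ring

theorem IsConvergent.eventually_evalAt_add {A B : Formal n} (hA : IsConvergent A)
    (hB : IsConvergent B) :
    ∀ᶠ P in 𝓝 (0 : Fin (n + 1) → ℂ), evalAt (A + B) P = evalAt A P + evalAt B P := by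
  filter_upwards [hA.eventually_summable, hB.eventually_summable] with P h1 h2
  rw [evalAt, evalAt, evalAt, ← h1.of_norm.tsum_add h2.of_norm]
  refine tsum_congr fun d => ?_
  rw [map_add, add_mul]

theorem evalAt_neg (A : Formal n) (P : Fin (n + 1) → ℂ) : evalAt (-A) P = -evalAt A P := by
  simp only [evalAt, map_neg, neg_mul, tsum_neg]

theorem IsConvergent.eventually_evalAt_sub {A B : Formal n} (hA : IsConvergent A)
    (hB : IsConvergent B) :
    ∀ᶠ P in 𝓝 (0 : Fin (n + 1) → ℂ), evalAt (A - B) P = evalAt A P - evalAt B P := by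
  have hB' : IsConvergent (-B) := (Conv n).neg_mem (x := B) hB
  filter_upwards [hA.eventually_evalAt_add hB'] with P h
  rw [sub_eq_add_neg, h, evalAt_neg, sub_eq_add_neg]

theorem evalAt_monomial (e : Fin (n + 1) →₀ ℕ) (c : ℂ) (P : Fin (n + 1) → ℂ) :
    evalAt (MvPowerSeries.monomial e c) P = c * ∏ i, P i ^ e i := by
  rw [evalAt, tsum_eq_single e, MvPowerSeries.coeff_monomial_same]
  intro d hd
  rw [MvPowerSeries.coeff_monomial_ne hd, zero_mul]

theorem evalAt_X (i : Fin (n + 1)) (P : Fin (n + 1) → ℂ) :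
    evalAt (MvPowerSeries.X i : Formal n) P = P i := by
  rw [MvPowerSeries.X, evalAt_monomial, one_mul, Finset.prod_eq_single i]
  · simp
  · intro j _ hj
    simp [hj.symm]
  · simp

theorem evalAt_one (P : Fin (n + 1) → ℂ) : evalAt (1 : Formal n) P = 1 := by
  have := evalAt_monomial (n := n) 0 1 P
  rw [MvPowerSeries.monomial_zero_one] at this
  simpa using this

theorem eventually_evalAt_g₀ :
    ∀ᶠ P in 𝓝 (0 : Fin (n + 1) → ℂ), evalAt (g₀ n : Formal n) P = P 2 - P 0 * P 1 := by
  filter_upwards [(isConvergent_X (n := n) 2).eventually_evalAt_sub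
    ((isConvergent_X 0).mul (isConvergent_X 1)),
    (isConvergent_X (n := n) 0).eventually_evalAt_mul (isConvergent_X 1)] with P h1 h2
  rw [coe_g₀, h1, h2, evalAt_X, evalAt_X, evalAt_X]

/-- The sum of a power series determines its coefficients. -/
theorem IsConvergent.eq_zero_of_eventually {F : Formal n} (hF : IsConvergent F)
    (h : ∀ᶠ P in 𝓝 (0 : Fin (n + 1) → ℂ), evalAt F P = 0) : F = 0 := by
  classical
  -- On the line t ↦ t v the series becomes a power series in t whose k-th coefficient is the value
  -- at v of the homogeneous part of degree k; uniqueness in one variable makes it vanish.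
  have h1 : ∀ (k : ℕ) (v : Fin (n + 1) → ℂ),
      ∑' d : (Finsupp.degree ⁻¹' {k} : Set (Fin (n + 1) →₀ ℕ)), MvPowerSeries.coeff (d : Fin (n + 1) →₀ ℕ) F *
        ∏ i, v i ^ (d : Fin (n + 1) →₀ ℕ) i = 0 := by
    intro k v
    set c : ℕ → ℂ := fun k => ∑' d : (Finsupp.degree ⁻¹' {k} : Set (Fin (n + 1) →₀ ℕ)),
      MvPowerSeries.coeff (d : Fin (n + 1) →₀ ℕ) F * ∏ i, v i ^ (d : Fin (n + 1) →₀ ℕ) i with hc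
    have ht : Tendsto (fun t : ℂ => t • v) (𝓝 0) (𝓝 0) := by
      have : Continuous fun t : ℂ => t • v := by fun_prop
      simpa using this.tendsto 0
    have h2 : HasFPowerSeriesAt (fun _ : ℂ => (0 : ℂ)) (FormalMultilinearSeries.ofScalars ℂ c) 0 := by
      rw [hasFPowerSeriesAt_iff]
      filter_upwards [ht.eventually h, ht.eventually hF.eventually_summable] with t h3 h4
      have h5 := h4.of_norm.hasSum
      rw [← evalAt, h3] at h5
      have h6 := h5.tsum_fiberwise (Finsupp.degree (R := ℕ))
      convert h6 using 2 with m
      rw [FormalMultilinearSeries.coeff_ofScalars, smul_eq_mul, hc, ← tsum_mul_left]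
      refine tsum_congr fun d => ?_
      have h7 : (d : Fin (n + 1) →₀ ℕ).degree = m := d.2
      simp only [Pi.smul_apply, smul_eq_mul, mul_pow, Finset.prod_mul_distrib]
      rw [Finset.prod_pow_eq_pow_sum, ← Finsupp.degree_eq_sum, h7]
      ring
    have h3 := h2.eq_zero
    have h4 : (FormalMultilinearSeries.ofScalars ℂ c : FormalMultilinearSeries ℂ ℂ ℂ).coeff k = 0 := by
      rw [h3]
      rfl
    rwa [FormalMultilinearSeries.coeff_ofScalars] at h4
  ext d
  have hfin : (Finsupp.degree (σ := Fin (n + 1)) (R := ℕ) ⁻¹' {d.degree}).Finite :=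
    (Finsupp.finite_of_degree_le d.degree).subset fun e he => le_of_eq he
  set S := hfin.toFinset with hS
  -- The homogeneous part containing d is a polynomial that vanishes everywhere, hence is zero.
  set p : MvPolynomial (Fin (n + 1)) ℂ :=
    ∑ e ∈ S, MvPolynomial.monomial e (MvPowerSeries.coeff e F) with hp
  have h2 : p = 0 := by
    refine MvPolynomial.funext fun v => ?_
    rw [hp, map_sum, map_zero]
    have h3 := h1 d.degree v
    have h4 := Finset.tsum_subtype' S fun e : Fin (n + 1) →₀ ℕ =>
      MvPowerSeries.coeff e F * ∏ i, v i ^ e i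
    rw [hS, Set.Finite.coe_toFinset, h3] at h4
    rw [h4]
    refine Finset.sum_congr rfl fun e _ => ?_
    rw [MvPolynomial.eval_monomial, Finsupp.prod_fintype _ _ fun _ => pow_zero _]
  have h3 : MvPolynomial.coeff d p = MvPowerSeries.coeff d F := by
    rw [hp, MvPolynomial.coeff_sum, Finset.sum_eq_single d, MvPolynomial.coeff_monomial, if_pos rfl]
    · intro e _ he
      rw [MvPolynomial.coeff_monomial, if_neg he]
    · intro hd
      exact absurd ((Set.Finite.mem_toFinset hfin).mpr rfl) hd
  rw [← h3, h2]
  simp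

theorem evalAt_update_of_partialD {i : Fin (n + 1)} {F : Formal n} (h : partialD i F = 0)
    (P : Fin (n + 1) → ℂ) (z : ℂ) : evalAt F (Function.update P i z) = evalAt F P := by
  refine tsum_congr fun d => ?_
  by_cases hd : d i = 0
  · congr 1
    refine Finset.prod_congr rfl fun j _ => ?_
    by_cases hj : j = i
    · subst hj
      rw [hd, pow_zero, pow_zero]
    · rw [Function.update_of_ne hj]
  · rw [partialD_eq_zero_iff.mp h d hd, zero_mul, zero_mul]

/-- A function which vanishes at the points of `x₂ = x x₁` with `x₁ ≠ 0` is divisible by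
`x₂ - x x₁`. -/
theorem g₀_dvd_of_eventually (hn : 2 ≤ n) {W : Formal n} (hW : IsConvergent W)
    (h : ∀ᶠ P in 𝓝 (0 : Fin (n + 1) → ℂ),
      evalAt (g₀ n : Formal n) P = 0 → P 1 ≠ 0 → evalAt W P = 0) : (g₀ n : Formal n) ∣ W := by
  obtain ⟨Q, ρ, hQ, hρ, hc⟩ := exists_division hn W
  have hQc := hc hW
  have hg : IsConvergent (g₀ n : Formal n) := (g₀ n).2
  have hρc : IsConvergent ρ := by
    have : ρ = W - g₀ n * Q := by linear_combination -hQ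
    rw [this]
    exact hW.sub (hg.mul hQc)
  have ht : Tendsto (fun P : Fin (n + 1) → ℂ => Function.update P 2 (P 0 * P 1)) (𝓝 0) (𝓝 0) := by
    have h1 : Continuous fun P : Fin (n + 1) → ℂ => Function.update P 2 (P 0 * P 1) := by fun_prop
    have h2 := h1.tendsto 0
    simpa using h2
  -- As ρ is free of x₂, its value does not change when the point is moved onto x₂ = x x₁, where W =
  -- ρ. The factor x₁ disposes of the points with x₁ = 0, about which nothing is assumed.
  have h1 : (MvPowerSeries.X 1 : Formal n) * ρ = 0 := by
    refine ((isConvergent_X 1).mul hρc).eq_zero_of_eventually ?_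
    filter_upwards [(isConvergent_X 1).eventually_evalAt_mul hρc, ht.eventually h,
      ht.eventually eventually_evalAt_g₀, ht.eventually (hg.eventually_evalAt_mul hQc),
      ht.eventually ((hg.mul hQc).eventually_evalAt_add hρc)] with P h1 h2 h3 h4 h5
    rw [h1, evalAt_X]
    by_cases hP : P 1 = 0
    · rw [hP, zero_mul]
    · rw [Function.update_self, Function.update_of_ne (fin_zero_ne_two hn),
        Function.update_of_ne (fin_one_ne_two hn), sub_self] at h3
      have h6 := h2 h3 (by rwa [Function.update_of_ne (fin_one_ne_two hn)])
      rw [hQ, h5, h4, h3, zero_mul, zero_add, evalAt_update_of_partialD hρ] at h6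
      rw [h6, mul_zero]
  have h2 : ρ = 0 := by
    rcases mul_eq_zero.mp h1 with h2 | h2
    · exact absurd (h2 ▸ dvd_zero _) (not_g₀_dvd_X_one hn)
    · exact h2
  exact ⟨Q, by rw [hQ, h2, add_zero]⟩

theorem eventually_of_g₀_dvd {W : Conv n} (h : g₀ n ∣ W) :
    ∀ᶠ P in 𝓝 (0 : Fin (n + 1) → ℂ), evalAt (g₀ n : Formal n) P = 0 → evalAt (W : Formal n) P = 0 := by
  obtain ⟨Q, rfl⟩ := h
  have hg : IsConvergent (g₀ n : Formal n) := (g₀ n).2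
  filter_upwards [hg.eventually_evalAt_mul Q.2] with P h1 h2
  rw [Subalgebra.coe_mul, h1, h2, zero_mul]

/-! ### Restriction to the orbits of ∂/∂x and residues -/

theorem tendsto_update_zero (P : Fin (n + 1) → ℂ) :
    Tendsto (fun z => Function.update P 0 z) (𝓝 (P 0)) (𝓝 P) := by
  have h1 : Continuous fun z : ℂ => Function.update P 0 z := by fun_prop
  have h2 := h1.tendsto (P 0)
  rwa [Function.update_eq_self] at h2

theorem coeff_zero_lineTaylor (F : Formal n) (P : Fin (n + 1) → ℂ) :
    PowerSeries.coeff 0 (lineTaylor F P) = evalAt F P := by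
  rw [lineTaylor, PowerSeries.coeff_mk, iteratedDeriv_zero, Function.update_eq_self]
  simp

/-- Termwise differentiation in x; the monomials without x drop out, and the others are reindexed as
the monomials of ∂F/∂x. -/
theorem IsConvergent.eventually_coeff_one_lineTaylor {F : Formal n} (hF : IsConvergent F) :
    ∀ᶠ P in 𝓝 (0 : Fin (n + 1) → ℂ),
      PowerSeries.coeff 1 (lineTaylor F P) = evalAt (_root_.partialD 0 F) P := by
  obtain ⟨r, hr, h⟩ := hF
  filter_upwards [eventually_norm_le hr] with P hP
  rw [lineTaylor, PowerSeries.coeff_mk, iteratedDeriv_one, Nat.factorial_one, Nat.cast_one, div_one]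
  have hu : ∀ (d : Fin (n + 1) →₀ ℕ) (z : ℂ),
      MvPowerSeries.coeff d F * ∏ i, Function.update P 0 z i ^ d i =
        MvPowerSeries.coeff d F * (z ^ d 0 * ∏ i : Fin n, P i.succ ^ d i.succ) := by
    intro d z
    rw [Fin.prod_univ_succ, Function.update_self]
    congr 2
  have h1 := Complex.hasSum_deriv_of_summable_norm (z := P 0)
    (F := fun (d : Fin (n + 1) →₀ ℕ) (z : ℂ) =>
      MvPowerSeries.coeff d F * ∏ i, Function.update P 0 z i ^ d i) h
    (U := Metric.ball (0 : ℂ) r) (fun d => by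
      simp only [hu]
      fun_prop) Metric.isOpen_ball (fun d z hz => norm_coeff_mul_prod_le F (fun i => by
        by_cases hi : i = 0
        · subst hi
          simpa using (mem_ball_zero_iff.mp hz).le
        · simpa [Function.update_of_ne hi] using (hP i).le) d)
    (mem_ball_zero_iff.mpr (hP 0))
  have h2 : ∀ d : Fin (n + 1) →₀ ℕ,
      deriv (fun z : ℂ => MvPowerSeries.coeff d F * ∏ i, Function.update P 0 z i ^ d i) (P 0) =
      MvPowerSeries.coeff d F * ((d 0 : ℂ) * P 0 ^ (d 0 - 1) * ∏ i : Fin n, P i.succ ^ d i.succ) := by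
    intro d
    simp only [hu]
    rw [deriv_const_mul_field, deriv_mul_const_field, deriv_pow_field]
  simp only [h2] at h1
  have h3 : deriv (fun z => evalAt F (Function.update P 0 z)) (P 0) = _ := h1.tsum_eq.symm
  rw [h3, ← Function.Injective.tsum_eq (single_add_injective 0), evalAt]
  · refine tsum_congr fun d => ?_
    rw [MvPowerSeries.coeff_pderiv, Fin.prod_univ_succ]
    simp only [Finsupp.add_apply, Finsupp.single_eq_same, add_tsub_cancel_right, Nat.cast_add,
      Nat.cast_one, Finsupp.single_eq_of_ne (Fin.succ_ne_zero _), add_zero]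
    ring
  · intro d hd
    refine mem_range_add_single fun h' => hd ?_
    simp [h']

theorem lineTaylor_mul (A B : Conv n) : ∀ᶠ P in 𝓝 (0 : Fin (n + 1) → ℂ),
    lineTaylor ((A * B : Conv n) : Formal n) P =
      lineTaylor (A : Formal n) P * lineTaylor (B : Formal n) P := by
  have hA : IsConvergent (A : Formal n) := A.2
  have hB : IsConvergent (B : Formal n) := B.2
  filter_upwards [hA.eventually, hB.eventually, (hA.eventually_evalAt_mul hB).eventually_nhds]
    with P h1 h2 h3
  have he : (fun z => evalAt ((A * B : Conv n) : Formal n) (Function.update P 0 z)) =ᶠ[𝓝 (P 0)]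
      (fun z => evalAt (A : Formal n) (Function.update P 0 z)) *
        fun z => evalAt (B : Formal n) (Function.update P 0 z) :=
    (tendsto_update_zero P).eventually h3
  ext k
  rw [PowerSeries.coeff_mul]
  simp only [lineTaylor, PowerSeries.coeff_mk]
  rw [he.iteratedDeriv_eq, iteratedDeriv_mul h1.self_of_nhds.2.contDiffAt
    h2.self_of_nhds.2.contDiffAt, Finset.sum_div, Finset.Nat.sum_antidiagonal_eq_sum_range_succ_mk]
  refine Finset.sum_congr rfl fun i hi => ?_
  have hi' : i ≤ k := Nat.lt_succ_iff.mp (Finset.mem_range.mp hi)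
  rw [Nat.cast_choose ℂ hi']
  have h4 : (k.factorial : ℂ) ≠ 0 := Nat.cast_ne_zero.mpr k.factorial_ne_zero
  field_simp

theorem lineTaylor_X_zero (P : Fin (n + 1) → ℂ) :
    lineTaylor (MvPowerSeries.X 0 : Formal n) P = PowerSeries.C (P 0) + PowerSeries.X := by
  ext k
  simp only [lineTaylor, PowerSeries.coeff_mk, evalAt_X, Function.update_self]
  rw [iteratedDeriv_fun_id, map_add, PowerSeries.coeff_C, PowerSeries.coeff_X]
  rcases k with _ | _ | k <;> simp

theorem lineTaylor_X_ne {i : Fin (n + 1)} (hi : i ≠ 0) (P : Fin (n + 1) → ℂ) :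
    lineTaylor (MvPowerSeries.X i : Formal n) P = PowerSeries.C (P i) := by
  ext k
  simp only [lineTaylor, PowerSeries.coeff_mk, evalAt_X, Function.update_of_ne hi]
  rw [iteratedDeriv_const, PowerSeries.coeff_C]
  rcases k with _ | k <;> simp

/-- At a point of g = 0 the constant term x₂⁰ - x⁰ x₁⁰ is zero, so only the linear term in t
survives. -/
theorem eventually_lineTaylor_g₀ (hn : 2 ≤ n) : ∀ᶠ P in 𝓝 (0 : Fin (n + 1) → ℂ),
    evalAt (g₀ n : Formal n) P = 0 →
      lineTaylor (g₀ n : Formal n) P = -(PowerSeries.C (P 1) * PowerSeries.X) := by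
  have h0 : g₀ n = coord n 2 + (-1 : ℂ) • (coord n 0 * coord n 1) := by
    rw [neg_one_smul, ← sub_eq_add_neg]
    rfl
  filter_upwards [lineTaylor_add (coord n 2) ((-1 : ℂ) • (coord n 0 * coord n 1)),
    lineTaylor_mul (coord n 0) (coord n 1), eventually_evalAt_g₀] with P h1 h2 h3 h4
  rw [h4] at h3
  have h5 : P 2 = P 0 * P 1 := (sub_eq_zero.mp h3.symm)
  have e0 : lineTaylor (coord n 0 : Formal n) P = _ := lineTaylor_X_zero P
  have e1 : lineTaylor (coord n 1 : Formal n) P = _ := lineTaylor_X_ne (fin_zero_ne_one hn).symm P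
  have e2 : lineTaylor (coord n 2 : Formal n) P = _ := lineTaylor_X_ne (fin_zero_ne_two hn).symm P
  rw [← h0] at h1
  rw [h1, Subalgebra.coe_smul, lineTaylor_smul, h2, e0, e1, e2, h5, map_mul, neg_one_smul]
  ring

theorem eventually_lineTaylor_f₀ (hn : 2 ≤ n) : ∀ᶠ P in 𝓝 (0 : Fin (n + 1) → ℂ),
    evalAt (g₀ n : Formal n) P = 0 →
      lineTaylor (f₀ n : Formal n) P = PowerSeries.C (P 1 ^ 2) * PowerSeries.X ^ 2 := by
  filter_upwards [eventually_lineTaylor_g₀ hn, lineTaylor_mul (g₀ n) (g₀ n)] with P h1 h2 h3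
  rw [f₀, pow_two, h2, h1 h3, map_pow]
  ring

theorem eventually_evalAt_f₀ : ∀ᶠ P in 𝓝 (0 : Fin (n + 1) → ℂ),
    evalAt (f₀ n : Formal n) P = evalAt (g₀ n : Formal n) P ^ 2 := by
  have hg : IsConvergent (g₀ n : Formal n) := (g₀ n).2
  filter_upwards [hg.eventually_evalAt_mul hg] with P h
  rw [f₀, pow_two, pow_two]
  exact h

/-- For c = 0 both sides are zero by the conventions on division, so the points with x₁ = 0 need no
special care when divisibility is shown to imply freeness of residues. -/
theorem residue_C_mul_X_sq (a : PowerSeries ℂ) (c : ℂ) :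
    residue a (PowerSeries.C c * PowerSeries.X ^ 2) = PowerSeries.coeff 1 a * c⁻¹ := by
  have h1 : HahnSeries.ofPowerSeries ℤ ℂ a / HahnSeries.ofPowerSeries ℤ ℂ
      (PowerSeries.C c * PowerSeries.X ^ 2) =
        HahnSeries.ofPowerSeries ℤ ℂ a * HahnSeries.single (-2 : ℤ) c⁻¹ := by
    rw [div_eq_mul_inv, map_mul, HahnSeries.ofPowerSeries_C, HahnSeries.ofPowerSeries_X_pow,
      HahnSeries.C_apply, HahnSeries.single_mul_single, HahnSeries.inv_single]
    simp
  rw [residue, h1]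
  have h2 := HahnSeries.coeff_mul_single_add (r := c⁻¹) (x := HahnSeries.ofPowerSeries ℤ ℂ a)
    (a := (1 : ℤ)) (b := -2)
  rw [show (1 : ℤ) + -2 = -1 by norm_num] at h2
  rw [h2]
  congr 1
  exact HahnSeries.ofPowerSeries_apply_coeff a 1

/-- The residue on g = 0 is (∂A/∂x)/x₁². The points with x₁ = 0 are exempt, because f₀ vanishes
identically on their orbits, but the remaining points already force divisibility by g. -/
theorem mem_Fr_f₀_iff (hn : 2 ≤ n) (A : Conv n) :
    A ∈ Fr (f₀ n) ↔ (g₀ n : Formal n) ∣ partialD 0 (A : Formal n) := by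
  have hA : IsConvergent (A : Formal n) := A.2
  constructor
  · intro h
    have d := decompUnitMul hn 1
    rw [Units.val_one, one_mul] at d
    have h1 := h d
    rw [d.fN_eq hn isUnit_one (one_mul _).symm] at h1
    refine g₀_dvd_of_eventually hn (hA.partialD 0) ?_
    filter_upwards [h1, eventually_evalAt_f₀, eventually_lineTaylor_f₀ hn,
      hA.eventually_coeff_one_lineTaylor] with P h2 h3 h4 h5 h6 h7
    have h8 : (P 1) ^ 2 ≠ 0 := pow_ne_zero 2 h7
    rw [h3, h4 h6, h6, residue_C_mul_X_sq, h5] at h2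
    have h9 := h2 (by simp) (mul_ne_zero (by simpa using h7) (pow_ne_zero 2 PowerSeries.X_ne_zero))
    exact (mul_eq_zero.mp h9).resolve_right (inv_ne_zero h8)
  · intro h d
    rw [d.fN_eq hn isUnit_one (one_mul _).symm]
    have h1 := eventually_of_g₀_dvd ((g₀_dvd_iff hn (A := ⟨_, hA.partialD 0⟩)).mpr h)
    filter_upwards [h1, eventually_evalAt_f₀, eventually_lineTaylor_f₀ hn,
      hA.eventually_coeff_one_lineTaylor] with P h2 h3 h4 h5 h6 h7
    have h8 : evalAt (g₀ n : Formal n) P = 0 := by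
      rw [h3] at h6
      exact pow_eq_zero_iff two_ne_zero |>.mp h6
    rw [h4 h8, residue_C_mul_X_sq, h5, h2 h8, zero_mul]

/-! ### The quotient Fr(f₀)/Sp(f₀) -/

theorem eq_zero_of_indep_of_mem {c a b : Formal n}
    (hc : ∀ i ∈ ({0, 1, 2} : Set (Fin (n + 1))), partialD i c = 0)
    (h : c = MvPowerSeries.X 1 * a + MvPowerSeries.X 2 * b) : c = 0 := by
  ext d
  by_cases h1 : d 1 = 0
  · by_cases h2 : d 2 = 0
    · rw [h, map_add, coeff_X_mul_of_eq_zero 1 _ h1, coeff_X_mul_of_eq_zero 2 _ h2, add_zero,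
        map_zero]
    · exact partialD_eq_zero_iff.mp (hc 2 (by simp)) d h2
  · exact partialD_eq_zero_iff.mp (hc 1 (by simp)) d h1

theorem exists_normal_form_of_mem_Fr (hn : 2 ≤ n) {A : Conv n} (hA : A ∈ Fr (f₀ n)) :
    ∃ (β : Conv n) (c : convIndep n {0, 1, 2}), (A : Formal n) =
      (g₀ n : Formal n) * partialD 0 (β : Formal n) + MvPowerSeries.X 1 * (β : Formal n) +
        ((c : Conv n) : Formal n) := by
  obtain ⟨β, c, h1, h2, h3⟩ := exists_special_normal_form hn ((mem_Fr_f₀_iff hn A).mp hA)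
  exact ⟨⟨β, (h3 A.2).1⟩, ⟨⟨c, (h3 A.2).2⟩, h2⟩, h1⟩

/-- One direction is g ∂β/∂x + x₁ β = x₁ (β - x ∂β/∂x) + x₂ ∂β/∂x. For the other, the term c of the
normal form lies in (x₁, x₂) with A, hence is zero. -/
theorem mem_Sp_f₀_iff (hn : 2 ≤ n) {A : Conv n} (hA : A ∈ Fr (f₀ n)) :
    A ∈ Sp (f₀ n) ↔ A ∈ Ideal.span {coord n 1, coord n 2} := by
  constructor
  · rintro ⟨_, h⟩
    obtain ⟨β, hβ⟩ := (isSpecialEq_f₀_iff hn A).mp h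
    have hβ' : IsConvergent (partialD 0 (β : Formal n)) := IsConvergent.partialD β.2 0
    refine Ideal.mem_span_pair.mpr ⟨β - coord n 0 * ⟨_, hβ'⟩, ⟨_, hβ'⟩, Subtype.ext ?_⟩
    rw [hβ, coe_g₀]
    change ((β : Formal n) - MvPowerSeries.X 0 * partialD 0 (β : Formal n)) * MvPowerSeries.X 1 +
      partialD 0 (β : Formal n) * MvPowerSeries.X 2 = _
    ring
  · intro h
    obtain ⟨a, b, hab⟩ := Ideal.mem_span_pair.mp h
    have hab' : (a : Formal n) * MvPowerSeries.X 1 + (b : Formal n) * MvPowerSeries.X 2 = (A : Formal n) :=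
      congrArg Subtype.val hab
    obtain ⟨β, c, hβ⟩ := exists_normal_form_of_mem_Fr hn hA
    have hc : ((c : Conv n) : Formal n) = 0 := by
      refine eq_zero_of_indep_of_mem (a := (a : Formal n) - (β : Formal n) + MvPowerSeries.X 0 * partialD 0 (β : Formal n))
        (b := (b : Formal n) - partialD 0 (β : Formal n)) c.2 ?_
      rw [coe_g₀] at hβ
      linear_combination -hab' - hβ
    rw [hc, add_zero] at hβ
    exact ⟨hA, (isSpecialEq_f₀_iff hn A).mpr ⟨β, hβ⟩⟩

theorem coe_mem_Fr_f₀ (hn : 2 ≤ n) (c : convIndep n {0, 1, 2}) : (c : Conv n) ∈ Fr (f₀ n) := by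
  rw [mem_Fr_f₀_iff hn, c.2 0 (by simp)]
  exact dvd_zero _

/-- The map `c ↦ c E₀ + Sp(f₀)`. -/
def toFrModSp (hn : 2 ≤ n) : convIndep n {0, 1, 2} →ₗ[ℂ] FrModSp (f₀ n) :=
  LinearMap.codRestrict _ ((Sp (f₀ n)).mkQ.comp (convIndep n {0, 1, 2}).subtype)
    fun c => Submodule.mem_map_of_mem (coe_mem_Fr_f₀ hn c)

/-- Surjectivity is the normal form; injectivity holds because a function of x₃, …, xₙ in the ideal
(x₁, x₂) is zero. -/
theorem toFrModSp_bijective (hn : 2 ≤ n) : Function.Bijective (toFrModSp hn) := by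
  constructor
  · rw [injective_iff_map_eq_zero]
    intro c hc
    have h1 : (Sp (f₀ n)).mkQ (c : Conv n) = 0 := congrArg Subtype.val hc
    rw [Submodule.mkQ_apply, Submodule.Quotient.mk_eq_zero,
      mem_Sp_f₀_iff hn (coe_mem_Fr_f₀ hn c)] at h1
    obtain ⟨a, b, hab⟩ := Ideal.mem_span_pair.mp h1
    have hab' : (a : Formal n) * MvPowerSeries.X 1 + (b : Formal n) * MvPowerSeries.X 2 =
        ((c : Conv n) : Formal n) := congrArg Subtype.val hab
    exact Subtype.ext (Subtype.ext (eq_zero_of_indep_of_mem (a := a) (b := b) c.2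
      (by rw [← hab']; ring)))
  · rintro ⟨_, A, hA, rfl⟩
    obtain ⟨β, c, hβ⟩ := exists_normal_form_of_mem_Fr hn hA
    refine ⟨c, Subtype.ext ?_⟩
    change (Sp (f₀ n)).mkQ (c : Conv n) = (Sp (f₀ n)).mkQ A
    rw [Submodule.mkQ_apply, Submodule.mkQ_apply, eq_comm, Submodule.Quotient.eq]
    refine ⟨Submodule.sub_mem _ hA (coe_mem_Fr_f₀ hn c), (isSpecialEq_f₀_iff hn _).mpr ⟨β, ?_⟩⟩
    rw [Subalgebra.coe_sub, hβ, add_sub_cancel_right]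

theorem rank_convIndep_two : Module.rank ℂ (convIndep 2 {0, 1, 2}) = 1 := by
  have hall : ∀ i : Fin 3, i ∈ ({0, 1, 2} : Set (Fin 3)) := by
    intro i
    fin_cases i <;> simp
  let L : convIndep 2 {0, 1, 2} →ₗ[ℂ] ℂ :=
    (MvPowerSeries.coeff (R := ℂ) (0 : Fin 3 →₀ ℕ)).comp
      ((Conv 2).val.toLinearMap.comp (convIndep 2 {0, 1, 2}).subtype)
  have hL : Function.Bijective L := by
    constructor
    · rw [injective_iff_map_eq_zero]
      intro c hc
      refine Subtype.ext (Subtype.ext (MvPowerSeries.ext fun d => ?_))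
      by_cases hd : d = 0
      · rw [hd]
        exact hc
      · obtain ⟨i, hi⟩ := Finsupp.ne_iff.mp hd
        exact partialD_eq_zero_iff.mp (c.2 i (hall i)) d hi
    · intro a
      refine ⟨⟨a • 1, fun i _ => ?_⟩, ?_⟩
      · rw [Subalgebra.coe_smul, partialD, Derivation.map_smul, Subalgebra.coe_one,
          MvPowerSeries.pderiv_one, smul_zero]
      · change MvPowerSeries.coeff 0 (a • (1 : Formal 2)) = a
        simp
  rw [(LinearEquiv.ofBijective L hL).rank_eq, Module.rank_self]

theorem not_finiteDimensional_convIndep (hn : 3 ≤ n) :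
    ¬ FiniteDimensional ℂ (convIndep n {0, 1, 2}) := by
  classical
  intro hfin
  have h3 : ∀ i ∈ ({0, 1, 2} : Set (Fin (n + 1))), (⟨3, by omega⟩ : Fin (n + 1)) ≠ i := by
    rintro i (rfl | rfl | rfl) h
    · exact absurd (congrArg Fin.val h) (by simp)
    · have : (3 : ℕ) = 1 % (n + 1) := congrArg Fin.val h
      rw [Nat.mod_eq_of_lt (by omega)] at this
      omega
    · have : (3 : ℕ) = 2 % (n + 1) := congrArg Fin.val h
      rw [Nat.mod_eq_of_lt (by omega)] at this
      omega
  generalize (⟨3, by omega⟩ : Fin (n + 1)) = j at h3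
  let v : ℕ → convIndep n {0, 1, 2} := fun k =>
    ⟨coord n j ^ k, fun i hi => partialD_pow_eq_zero (partialD_X_ne (h3 i hi)) k⟩
  let L : convIndep n {0, 1, 2} →ₗ[ℂ] (ℕ → ℂ) :=
    LinearMap.pi fun k => (MvPowerSeries.coeff (R := ℂ) (Finsupp.single j k)).comp
      ((Conv n).val.toLinearMap.comp (convIndep n {0, 1, 2}).subtype)
  have hv : L ∘ v = fun k => Pi.single k 1 := by
    funext k m
    change MvPowerSeries.coeff (Finsupp.single j m) (MvPowerSeries.X j ^ k : Formal n) = _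
    rw [MvPowerSeries.coeff_X_pow, Pi.single_apply]
    exact if_congr (Finsupp.single_injective j).eq_iff rfl rfl
  have h1 : LinearIndependent ℂ v := by
    refine LinearIndependent.of_comp L ?_
    rw [hv]
    exact Pi.linearIndependent_single_one ℕ ℂ
  have : Module.Finite ℂ (convIndep n {0, 1, 2}) := hfin
  exact absurd h1.aleph0_le_rank (not_le.mpr (Module.rank_lt_aleph0 ℂ _))

/-! ### Logarithms and residues of one-variable germs -/

section OneVariable

open PowerSeries

theorem X_pow_dvd_mul_derivative {h a : PowerSeries ℂ} (hh : X ^ 2 ∣ h) {m : ℕ} (ha : X ^ m ∣ a) :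
    X ^ (m + 1) ∣ h * derivative ℂ a := by
  obtain ⟨k, rfl⟩ := hh
  rcases m with _ | m
  · exact ⟨X * k * derivative ℂ a, by ring⟩
  · obtain ⟨b, rfl⟩ := ha
    refine ⟨k * (X * derivative ℂ b + ((m + 1 : ℕ) : PowerSeries ℂ) * b), ?_⟩
    rw [Derivation.leibniz, Derivation.leibniz_pow, PowerSeries.derivative_X]
    simp only [smul_eq_mul, nsmul_eq_mul, Nat.add_sub_cancel]
    push_cast
    ring

theorem X_pow_dvd_iterate {h : PowerSeries ℂ} (hh : X ^ 2 ∣ h) (j : ℕ) :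
    X ^ (j + 1) ∣ (fun a : PowerSeries ℂ => h * derivative ℂ a)^[j] X := by
  induction j with
  | zero => simp
  | succ j ih =>
    rw [Function.iterate_succ_apply']
    exact X_pow_dvd_mul_derivative hh ih

/-- The first iterates are h and h' themselves; afterwards h ∂a - h' ∂b = (h - h') ∂a + h' ∂(a - b)
gains a degree, as t divides ∂a and h' ∈ (t²). So in the exponential a coefficient of h acts
nonlinearly only in higher degrees. -/
theorem X_pow_dvd_iterate_sub {h h' : PowerSeries ℂ} (hh : X ^ 2 ∣ h) (hh' : X ^ 2 ∣ h') {N : ℕ}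
    (hN : X ^ N ∣ h - h') (j : ℕ) :
    X ^ (N + 1) ∣ (fun a : PowerSeries ℂ => h * derivative ℂ a)^[j + 2] X -
      (fun a : PowerSeries ℂ => h' * derivative ℂ a)^[j + 2] X := by
  have key : ∀ i, X ^ N ∣ (fun a : PowerSeries ℂ => h * derivative ℂ a)^[i + 1] X -
      (fun a : PowerSeries ℂ => h' * derivative ℂ a)^[i + 1] X →
      X ^ (N + 1) ∣ (fun a : PowerSeries ℂ => h * derivative ℂ a)^[i + 2] X -
      (fun a : PowerSeries ℂ => h' * derivative ℂ a)^[i + 2] X := by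
    intro i hi
    rw [Function.iterate_succ_apply' _ (i + 1), Function.iterate_succ_apply' _ (i + 1)]
    have h1 := X_pow_dvd_iterate hh (i + 1)
    generalize (fun a : PowerSeries ℂ => h * derivative ℂ a)^[i + 1] X = a at *
    generalize (fun a : PowerSeries ℂ => h' * derivative ℂ a)^[i + 1] X = b at *
    have h2 : h * derivative ℂ a - h' * derivative ℂ b =
        (h - h') * derivative ℂ a + h' * derivative ℂ (a - b) := by
      rw [map_sub]
      ring
    rw [h2]
    refine dvd_add ?_ (X_pow_dvd_mul_derivative hh' hi)
    rw [pow_succ]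
    refine mul_dvd_mul hN ?_
    obtain ⟨c, rfl⟩ := (pow_dvd_pow X (by omega : 2 ≤ i + 1 + 1)).trans h1
    rw [Derivation.leibniz, Derivation.leibniz_pow, PowerSeries.derivative_X]
    refine ⟨X * derivative ℂ c + 2 * c, ?_⟩
    simp only [smul_eq_mul, nsmul_eq_mul]
    push_cast
    ring
  induction j with
  | zero =>
    refine key 0 ?_
    simpa using hN
  | succ j ih => exact key (j + 1) ((pow_dvd_pow X (Nat.le_succ N)).trans ih)

theorem coeff_expField {h : PowerSeries ℂ} (hh : X ^ 2 ∣ h) (k : ℕ) :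
    coeff k (expField h) = coeff k X + coeff k h + ∑ j ∈ Finset.range k,
      coeff k ((fun a : PowerSeries ℂ => h * derivative ℂ a)^[j + 2] X) /
        (Nat.factorial (j + 2) : ℂ) := by
  -- The term j = k + 1 is zero in degree k. Adding it lets j = 0 and j = 1 be split off even when k
  -- = 0.
  have h1 : coeff k ((fun a : PowerSeries ℂ => h * derivative ℂ a)^[k + 1] X) = 0 :=
    PowerSeries.X_pow_dvd_iff.mp (X_pow_dvd_iterate hh (k + 1)) k (by omega)
  have h2 := Finset.sum_range_succ (fun j =>
    coeff k ((fun a : PowerSeries ℂ => h * derivative ℂ a)^[j] X) / (Nat.factorial j : ℂ)) (k + 1)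
  rw [h1, zero_div, add_zero, Finset.sum_range_succ', Finset.sum_range_succ'] at h2
  rw [expField, coeff_mk, ← h2]
  simp
  ring

/-- The equation is triangular: in degree k it expresses the coefficient of h through τ and lower
coefficients of h. In the map iterated here the coefficient of degree k cancels by `coeff_expField`,
so the map contracts. -/
theorem exists_expField_eq {τ : PowerSeries ℂ} (h0 : coeff 0 τ = 0) (h1 : coeff 1 τ = 1) :
    ∃ h : PowerSeries ℂ, X ^ 2 ∣ h ∧ expField h = τ := by
  let p : (ℕ → ℂ) → PowerSeries ℂ := fun f => X ^ 2 * mk fun k => f (k + 2)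
  have hp2 : ∀ f, X ^ 2 ∣ p f := fun f => dvd_mul_right _ _
  have hp : ∀ f k, coeff (k + 2) (p f) = f (k + 2) := fun f k => by
    rw [PowerSeries.coeff_X_pow_mul, coeff_mk]
  have hp' : ∀ f k, k < 2 → coeff k (p f) = 0 := fun f k hk => X_pow_dvd_iff.mp (hp2 f) k hk
  obtain ⟨f, hf⟩ := exists_fixed_point_of_contracting (ι := ℕ) (α := ℂ) id
    (fun f k => coeff k τ - coeff k (X : PowerSeries ℂ) + coeff k (p f) - coeff k (expField (p f)))
    (by
      intro N f f' hff k hk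
      have h2 : X ^ N ∣ p f - p f' := by
        refine X_pow_dvd_iff.mpr fun m hm => ?_
        rw [map_sub, sub_eq_zero]
        rcases lt_or_ge m 2 with h3 | h3
        · rw [hp' f m h3, hp' f' m h3]
        · obtain ⟨m, rfl⟩ := Nat.exists_eq_add_of_le' h3
          rw [hp, hp]
          exact hff _ hm
      simp only [coeff_expField (hp2 _)]
      have h3 : ∀ j, coeff k ((fun a : PowerSeries ℂ => p f * derivative ℂ a)^[j + 2] X) =
          coeff k ((fun a : PowerSeries ℂ => p f' * derivative ℂ a)^[j + 2] X) := by
        intro j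
        have := X_pow_dvd_iff.mp (X_pow_dvd_iterate_sub (hp2 f) (hp2 f') h2 j) k hk
        rwa [map_sub, sub_eq_zero] at this
      simp only [h3]
      ring)
  have hfk : ∀ k, f k = coeff k τ - coeff k (X : PowerSeries ℂ) + coeff k (p f) -
      coeff k (expField (p f)) := fun k => (congrFun hf k).symm
  refine ⟨p f, hp2 f, PowerSeries.ext fun k => ?_⟩
  rcases k with _ | _ | k
  · rw [coeff_expField (hp2 f), h0, hp' f 0 (by omega)]
    simp
  · rw [coeff_expField (hp2 f), h1, hp' f 1 (by omega)]
    have := X_pow_dvd_iff.mp (X_pow_dvd_iterate (hp2 f) 2) 1 (by omega)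
    simp only [zero_add, Finset.sum_range_one]
    rw [this]
    simp
  · have := hfk (k + 2)
    rw [hp, PowerSeries.coeff_X, if_neg (by omega)] at this
    linear_combination this

/-- The residue is the coefficient of t in 1/k, read off from k · (1/k) = 1. -/
theorem residue_one_X_sq_mul {k : PowerSeries ℂ} (hk : coeff 0 k ≠ 0) :
    residue 1 (X ^ 2 * k) = -coeff 1 k / coeff 0 k ^ 2 := by
  have hk' : constantCoeff k ≠ 0 := by
    rwa [← PowerSeries.coeff_zero_eq_constantCoeff_apply]
  have h1 : k * k⁻¹ = 1 := PowerSeries.mul_inv_cancel k hk'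
  have h2 : residue 1 (X ^ 2 * k) = residue k⁻¹ (C 1 * X ^ 2) := by
    have hk0 : HahnSeries.ofPowerSeries ℤ ℂ k ≠ 0 := fun h => by
      have := congrArg (HahnSeries.ofPowerSeries ℤ ℂ) h1
      rw [map_mul, h, zero_mul, map_one] at this
      exact zero_ne_one this
    have h3 : HahnSeries.ofPowerSeries ℤ ℂ k * HahnSeries.ofPowerSeries ℤ ℂ k⁻¹ = 1 := by
      rw [← map_mul, h1, map_one]
    have h4 : HahnSeries.ofPowerSeries ℤ ℂ k⁻¹ = (HahnSeries.ofPowerSeries ℤ ℂ k)⁻¹ :=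
      eq_inv_of_mul_eq_one_right h3
    rw [residue, residue, h4, map_one, map_mul, map_mul, map_one, map_one, one_mul, mul_comm,
      one_div, mul_inv, div_eq_mul_inv]
  have h5 := congrArg (coeff 1) h1
  have h6 := congrArg (coeff 0) h1
  rw [PowerSeries.coeff_mul] at h5 h6
  simp [Finset.Nat.antidiagonal_succ] at h5 h6
  rw [h2, residue_C_mul_X_sq, inv_one, mul_one, eq_div_iff (pow_ne_zero 2 hk)]
  simp only [PowerSeries.coeff_zero_eq_constantCoeff_apply] at *
  rw [← PowerSeries.coeff_zero_eq_constantCoeff_apply] at *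
  field_simp at h5
  linear_combination h5

/-- The residue of a germ tangent to the identity with contact of order two. -/
theorem residueOf_eq {τ : PowerSeries ℂ} (h0 : coeff 0 τ = 0) (h1 : coeff 1 τ = 1)
    (h2 : coeff 2 τ ≠ 0) : residueOf τ = 1 - coeff 3 τ / coeff 2 τ ^ 2 := by
  -- Any h whose exponential is τ has the two coefficients used below, so uniqueness of the
  -- logarithm plays no role.
  have H := exists_expField_eq h0 h1
  have hl : logField τ = H.choose := dif_pos H
  obtain ⟨hX, hexp⟩ := H.choose_spec
  rw [← hl] at hX hexp
  obtain ⟨k, hlog⟩ := hX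
  rw [hlog] at hexp
  have e1 := X_pow_dvd_iterate (h := X ^ 2 * k) (dvd_mul_right _ _)
  have hD2 : (fun a : PowerSeries ℂ => X ^ 2 * k * derivative ℂ a)^[2] X =
      X ^ 3 * (k * (k + k + X * derivative ℂ k)) := by
    rw [Function.iterate_succ_apply', Function.iterate_one, PowerSeries.derivative_X, mul_one,
      Derivation.leibniz, Derivation.leibniz_pow, PowerSeries.derivative_X]
    simp only [smul_eq_mul, nsmul_eq_mul]
    push_cast
    ring
  -- For h = t² (k₀ + k₁ t + …) the exponential is t + k₀ t² + (k₁ + k₀²) t³ + O(t⁴), while the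
  -- residue of dt/h is -k₁/k₀².
  have h3 : coeff 2 τ = coeff 0 k := by
    have e2 := PowerSeries.X_pow_dvd_iff.mp (e1 2) 2 (by omega)
    have e3 := PowerSeries.X_pow_dvd_iff.mp (e1 3) 2 (by omega)
    rw [← hexp, coeff_expField (dvd_mul_right _ _), Finset.sum_range_succ, Finset.sum_range_one,
      e2, e3, PowerSeries.coeff_X, PowerSeries.coeff_X_pow_mul']
    simp
  have h4 : coeff 3 τ = coeff 1 k + coeff 0 k ^ 2 := by
    have e3 := PowerSeries.X_pow_dvd_iff.mp (e1 3) 3 (by omega)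
    have e4 := PowerSeries.X_pow_dvd_iff.mp (e1 4) 3 (by omega)
    rw [← hexp, coeff_expField (dvd_mul_right _ _), Finset.sum_range_succ, Finset.sum_range_succ,
      Finset.sum_range_one, e3, e4, hD2, PowerSeries.coeff_X, PowerSeries.coeff_X_pow_mul',
      PowerSeries.coeff_X_pow_mul']
    simp [PowerSeries.coeff_mul]
    ring
  rw [h3] at h2
  rw [residueOf, hlog, residue_one_X_sq_mul h2, h3, h4]
  field_simp
  ring

end OneVariable

/-! ### The residue functions along x₂ = x x₁ -/

theorem eventually_germAt (hn : 2 ≤ n) {φ : AnalyticDiff n} {v : Conv n}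
    (hφ : φ.comp 0 - coord n 0 = v * f₀ n) : ∀ᶠ P in 𝓝 (0 : Fin (n + 1) → ℂ),
      evalAt (g₀ n : Formal n) P = 0 → germAt φ P = PowerSeries.X +
        lineTaylor (v : Formal n) P * (PowerSeries.C (P 1 ^ 2) * PowerSeries.X ^ 2) := by
  have h0 : φ.comp 0 = coord n 0 + v * f₀ n := by rw [← hφ, add_sub_cancel]
  filter_upwards [lineTaylor_add (coord n 0) (v * f₀ n), lineTaylor_mul v (f₀ n),
    eventually_lineTaylor_f₀ hn] with P h1 h2 h3 h4
  have e0 : lineTaylor (coord n 0 : Formal n) P = _ := lineTaylor_X_zero P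
  rw [germAt, h0, h1, h2, h3 h4, e0]
  ring

theorem eventually_evalAt_ne_zero {v : Conv n} (hv : IsUnit v) :
    ∀ᶠ P in 𝓝 (0 : Fin (n + 1) → ℂ), evalAt (v : Formal n) P ≠ 0 := by
  obtain ⟨w, hw⟩ := hv.exists_right_inv
  have hv' : IsConvergent (v : Formal n) := v.2
  filter_upwards [hv'.eventually_evalAt_mul w.2] with P h1 h2
  have h3 : (v : Formal n) * (w : Formal n) = 1 := congrArg Subtype.val hw
  rw [h3, evalAt_one, h2, zero_mul] at h1
  exact one_ne_zero h1

theorem eventually_contactOrder (hn : 2 ≤ n) {φ : AnalyticDiff n} {v : Conv n} (hv : IsUnit v)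
    (hφ : φ.comp 0 - coord n 0 = v * f₀ n) : ∀ᶠ P in 𝓝 (0 : Fin (n + 1) → ℂ),
      evalAt (g₀ n : Formal n) P = 0 → contactOrder φ P = if P 1 = 0 then ⊤ else 2 := by
  filter_upwards [eventually_germAt hn hφ, eventually_evalAt_ne_zero hv] with P h1 h2 h3
  rw [contactOrder, h1 h3, add_sub_cancel_left]
  split_ifs with h4
  · rw [h4]
    simp
  · have h5 : PowerSeries.coeff 0 (lineTaylor (v : Formal n) P) ≠ 0 := by
      rwa [coeff_zero_lineTaylor]
    have h6 : (PowerSeries.C (P 1 ^ 2)).order = 0 := by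
      rw [PowerSeries.order_zero_of_unit]
      exact (IsUnit.mk0 _ (pow_ne_zero 2 h4)).map PowerSeries.C
    rw [PowerSeries.order_mul, PowerSeries.order_mul, PowerSeries.order_X_pow, h6,
      PowerSeries.order_eq_nat.mpr ⟨h5, fun i hi => absurd hi (by omega)⟩]
    rfl

/-- The points (0, t, 0, …, 0) lie on g = 0. They bound from above the lower limit that defines the
minimal order of contact. -/
theorem frequently_ne_zero (hn : 2 ≤ n) :
    ∃ᶠ P in 𝓝[zeroSet (g₀ n)] (0 : Fin (n + 1) → ℂ), P 1 ≠ 0 := by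
  have h1 : Tendsto (fun t : ℂ => (Pi.single 1 t : Fin (n + 1) → ℂ)) (𝓝[≠] 0)
      (𝓝[zeroSet (g₀ n)] (0 : Fin (n + 1) → ℂ)) := by
    have h2 : Continuous fun t : ℂ => (Pi.single 1 t : Fin (n + 1) → ℂ) :=
      (continuous_const (y := (0 : Fin (n + 1) → ℂ))).update 1 continuous_id
    have h3 : Tendsto (fun t : ℂ => (Pi.single 1 t : Fin (n + 1) → ℂ)) (𝓝[≠] 0) (𝓝 0) := by
      have := h2.tendsto 0
      rw [Pi.single_zero] at this
      exact this.mono_left nhdsWithin_le_nhds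
    refine tendsto_nhdsWithin_iff.mpr ⟨h3, ?_⟩
    filter_upwards [h3.eventually eventually_evalAt_g₀] with t ht
    change evalAt _ _ = 0
    rw [ht]
    simp [Pi.single_eq_of_ne (fin_zero_ne_one hn), Pi.single_eq_of_ne (fin_one_ne_two hn).symm]
  refine h1.frequently (Eventually.frequently ?_)
  filter_upwards [self_mem_nhdsWithin] with t ht
  simpa using ht

theorem minContactOrder_eq_two (hn : 2 ≤ n) {φ : AnalyticDiff n} {v : Conv n} (hv : IsUnit v)
    (hφ : φ.comp 0 - coord n 0 = v * f₀ n) : minContactOrder (g₀ n) φ = 2 := by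
  have h1 : ∀ᶠ P in 𝓝[zeroSet (g₀ n)] (0 : Fin (n + 1) → ℂ),
      contactOrder φ P = if P 1 = 0 then ⊤ else 2 :=
    eventually_nhdsWithin_iff.mpr (eventually_contactOrder hn hv hφ)
  refine le_antisymm (liminf_le_of_frequently_le' ?_) (le_liminf_of_le (by isBoundedDefault) ?_)
  · refine ((frequently_ne_zero hn).and_eventually h1).mono fun P hP => ?_
    rw [hP.2, if_neg hP.1]
  · filter_upwards [h1] with P hP
    rw [hP]
    split_ifs
    · exact le_top
    · exact le_rfl

theorem eventually_residueOf (hn : 2 ≤ n) {φ : AnalyticDiff n} {v : Conv n} (hv : IsUnit v)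
    (hφ : φ.comp 0 - coord n 0 = v * f₀ n) : ∀ᶠ P in 𝓝 (0 : Fin (n + 1) → ℂ),
      evalAt (g₀ n : Formal n) P = 0 → P 1 ≠ 0 → residueOf (germAt φ P) =
        1 - evalAt (partialD 0 (v : Formal n)) P / (evalAt (v : Formal n) P ^ 2 * P 1 ^ 2) := by
  have hv' : IsConvergent (v : Formal n) := v.2
  filter_upwards [eventually_germAt hn hφ, eventually_evalAt_ne_zero hv,
    hv'.eventually_coeff_one_lineTaylor] with P h1 h2 h3 h4 h5
  have e : germAt φ P = PowerSeries.X + PowerSeries.X ^ 2 *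
      (PowerSeries.C (P 1 ^ 2) * lineTaylor (v : Formal n) P) := by
    rw [h1 h4]
    ring
  have hc : ∀ k, PowerSeries.coeff (k + 2) (germAt φ P) = PowerSeries.coeff (k + 2) PowerSeries.X +
      P 1 ^ 2 * PowerSeries.coeff k (lineTaylor (v : Formal n) P) := fun k => by
    rw [e, map_add, PowerSeries.coeff_X_pow_mul, PowerSeries.coeff_C_mul]
  have c2 : PowerSeries.coeff 2 (germAt φ P) = P 1 ^ 2 * evalAt (v : Formal n) P := by
    rw [hc 0, coeff_zero_lineTaylor]
    simp [PowerSeries.coeff_X]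
  have c3 : PowerSeries.coeff 3 (germAt φ P) = P 1 ^ 2 * evalAt (partialD 0 (v : Formal n)) P := by
    rw [hc 1, h3]
    simp [PowerSeries.coeff_X]
  rw [residueOf_eq, c2, c3]
  · field_simp
  · rw [e, map_add, PowerSeries.coeff_X_pow_mul']
    simp
  · rw [e, map_add, PowerSeries.coeff_X_pow_mul']
    simp
  · rw [c2]
    exact mul_ne_zero (pow_ne_zero 2 h5) h2

/-- Cross-multiplication of the two residue formulas. The points with x₁ = 0 have infinite contact,
hence are not of minimal contact and impose no condition. -/
theorem sameResidues_iff (hn : 2 ≤ n) {φ₁ φ₂ : AnalyticDiff n} {v₁ v₂ : Conv n} (hv₁ : IsUnit v₁)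
    (hv₂ : IsUnit v₂) (hφ₁ : φ₁.comp 0 - coord n 0 = v₁ * f₀ n)
    (hφ₂ : φ₂.comp 0 - coord n 0 = v₂ * f₀ n) : SameResidues (g₀ n) φ₁ φ₂ ↔
      (g₀ n : Formal n) ∣ partialD 0 (v₁ : Formal n) * (v₂ : Formal n) ^ 2 -
        partialD 0 (v₂ : Formal n) * (v₁ : Formal n) ^ 2 := by
  have c1 : IsConvergent (v₁ : Formal n) := v₁.2
  have c2 : IsConvergent (v₂ : Formal n) := v₂.2
  have c1' := c1.partialD 0
  have c2' := c2.partialD 0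
  set W : Conv n := ⟨_, c1'⟩ * (v₂ * v₂) - ⟨_, c2'⟩ * (v₁ * v₁) with hW
  have hW' : partialD 0 (v₁ : Formal n) * (v₂ : Formal n) ^ 2 -
        partialD 0 (v₂ : Formal n) * (v₁ : Formal n) ^ 2 = W := by
    rw [pow_two, pow_two]
    rfl
  have hev : ∀ᶠ P in 𝓝 (0 : Fin (n + 1) → ℂ), evalAt (W : Formal n) P =
      evalAt (partialD 0 (v₁ : Formal n)) P * evalAt (v₂ : Formal n) P ^ 2 -
        evalAt (partialD 0 (v₂ : Formal n)) P * evalAt (v₁ : Formal n) P ^ 2 := by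
    filter_upwards [(c1'.mul (c2.mul c2)).eventually_evalAt_sub (c2'.mul (c1.mul c1)),
      c1'.eventually_evalAt_mul (c2.mul c2), c2'.eventually_evalAt_mul (c1.mul c1),
      c1.eventually_evalAt_mul c1, c2.eventually_evalAt_mul c2] with P e1 e2 e3 e4 e5
    rw [e2, e3, e4, e5] at e1
    rw [pow_two, pow_two, ← e1]
    rfl
  have hiff : ∀ᶠ P in 𝓝 (0 : Fin (n + 1) → ℂ), evalAt (g₀ n : Formal n) P = 0 →
      ((contactOrder φ₁ P = minContactOrder (g₀ n) φ₁ →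
        contactOrder φ₂ P = minContactOrder (g₀ n) φ₂ →
          residueOf (germAt φ₁ P) = residueOf (germAt φ₂ P)) ↔
        (P 1 ≠ 0 → evalAt (W : Formal n) P = 0)) := by
    filter_upwards [hev, eventually_residueOf hn hv₁ hφ₁, eventually_residueOf hn hv₂ hφ₂,
      eventually_contactOrder hn hv₁ hφ₁, eventually_contactOrder hn hv₂ hφ₂,
      eventually_evalAt_ne_zero hv₁, eventually_evalAt_ne_zero hv₂] with P e1 e2 e3 e4 e5 e6 e7 e8
    rw [e4 e8, e5 e8, minContactOrder_eq_two hn hv₁ hφ₁, minContactOrder_eq_two hn hv₂ hφ₂]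
    by_cases hP : P 1 = 0
    · simp [hP]
    · simp only [ne_eq, hP, not_false_eq_true, if_false, true_imp_iff]
      rw [e2 e8 hP, e3 e8 hP, e1, sub_right_inj, div_eq_div_iff
        (mul_ne_zero (pow_ne_zero 2 e6) (pow_ne_zero 2 hP))
        (mul_ne_zero (pow_ne_zero 2 e7) (pow_ne_zero 2 hP)), ← mul_assoc, ← mul_assoc,
        mul_left_inj' (pow_ne_zero 2 hP), sub_eq_zero]
  rw [hW', SameResidues, eventually_nhdsWithin_iff]
  constructor
  · intro h
    refine g₀_dvd_of_eventually hn W.2 ?_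
    filter_upwards [h, hiff] with P e1 e2 e3
    exact (e2 e3).mp (e1 e3)
  · intro h
    filter_upwards [eventually_of_g₀_dvd ((g₀_dvd_iff hn).mpr h), hiff] with P e1 e2 e3
    exact (e2 e3).mpr fun _ => e1 e3

/-! ### Taylor expansion of parameterized substitutions -/

theorem fsum_eq_add_of_forall {c : ℕ → Formal n} (hc : ∀ k, c k ∈ ordIdeal n k)
    (h : ∀ k, c (k + 2) = 0) : fsum c = c 0 + c 1 := by
  refine fsum_eq_of_approx hc fun N => ?_
  rcases N with _ | _ | N
  · exact mem_ordIdeal_zero _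
  · simpa using hc 1
  · rw [Finset.sum_range_succ', Finset.sum_range_succ']
    simp [h, add_comm (c 1)]

/-- The components of the map `(x, x₁, …, xₙ) ↦ (F, x₁, …, xₙ)`. -/
def upComp (F : Formal n) : Fin (n + 1) → Formal n :=
  Function.update MvPowerSeries.X 0 F

theorem upComp_zero (F : Formal n) : upComp F 0 = F := Function.update_self ..

theorem upComp_ne (F : Formal n) {i : Fin (n + 1)} (hi : i ≠ 0) :
    upComp F i = MvPowerSeries.X i := Function.update_of_ne hi ..

theorem upComp_mem {F : Formal n} (hF : F ∈ ordIdeal n 1) (i : Fin (n + 1)) :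
    upComp F i ∈ ordIdeal n 1 := by
  by_cases hi : i = 0
  · rw [hi, upComp_zero]
    exact hF
  · rw [upComp_ne F hi]
    exact X_mem_ordIdeal i

theorem hasSubst_upComp {F : Formal n} (hF : F ∈ ordIdeal n 1) :
    MvPowerSeries.HasSubst (upComp F) :=
  MvPowerSeries.hasSubst_of_constantCoeff_zero fun i => mem_ordIdeal_one.mp (upComp_mem hF i)

theorem dividedPow_one (X : Derivation ℂ (Formal n) (Formal n)) (F : Formal n) :
    dividedPow X 1 F = X F := by
  simp [dividedPow]

theorem dividedPow_eq_zero {X : Derivation ℂ (Formal n) (Formal n)} {F : Formal n} {m : ℕ}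
    (h : dividedPow X m F = 0) {k : ℕ} (hk : m ≤ k) : dividedPow X k F = 0 := by
  induction k, hk using Nat.le_induction with
  | base => exact h
  | succ k _ ih =>
    have h1 := dividedPow_succ X k F
    rw [ih, map_zero] at h1
    exact (smul_eq_zero.mp h1.symm).resolve_left (by exact_mod_cast Nat.succ_ne_zero k)

/-- Taylor expansion of `F(x + w, x₁, …, xₙ)`. -/
theorem subst_eq_fsum_taylorTerm {w : Formal n} (hw : w ∈ ordIdeal n 1) (F : Formal n) :
    MvPowerSeries.subst (upComp (MvPowerSeries.X 0 + w)) F = fsum fun k => taylorTerm w k F := by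
  have hD := higherDerivation_taylorTerm hw
  refine (hD.fsum_eq_subst (fun i => ?_) F).symm
  have h1 : ∀ k, taylorTerm w (k + 2) (MvPowerSeries.X i) = 0 := by
    intro k
    have h2 : dividedPow (MvPowerSeries.pderiv ℂ 0) 2 (MvPowerSeries.X i : Formal n) = 0 := by
      have h3 := dividedPow_succ (MvPowerSeries.pderiv ℂ 0) 1 (MvPowerSeries.X i : Formal n)
      rw [dividedPow_one] at h3
      refine (smul_eq_zero.mp (h3.symm.trans ?_)).resolve_left (by norm_num)
      by_cases hi : i = 0
      · rw [hi, MvPowerSeries.pderiv_X_self, MvPowerSeries.pderiv_one]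
      · rw [MvPowerSeries.pderiv_X_of_ne hi, map_zero]
    rw [taylorTerm_apply, dividedPow_eq_zero h2 (by omega), mul_zero]
  rw [fsum_eq_add_of_forall (fun k => hD.mem k _) h1, hD.zero, taylorTerm_apply, dividedPow_one,
    pow_one]
  by_cases hi : i = 0
  · rw [hi, MvPowerSeries.pderiv_X_self, mul_one, upComp_zero]
  · rw [MvPowerSeries.pderiv_X_of_ne hi, mul_zero, add_zero, upComp_ne _ hi]

/-- Second order is enough for `invariants_of_conjugated`: there w is a multiple of g, and after
division by g² the remainders sit in a multiple of g². -/
theorem exists_taylor_two {w : Formal n} (hw : w ∈ ordIdeal n 1) (F : Formal n) :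
    ∃ R, MvPowerSeries.subst (upComp (MvPowerSeries.X 0 + w)) F =
      F + w * partialD 0 F + w ^ 2 * R := by
  have h0 : ∀ k G, w ^ k * G ∈ ordIdeal n k := fun k G => by
    have := pow_mem_ordIdeal hw k
    rw [one_mul] at this
    exact Ideal.mul_mem_right _ _ this
  set D := fun k => dividedPow (MvPowerSeries.pderiv ℂ 0) k F with hD
  have h1 := fsum_succ (c := fun k => w ^ k * D k) (c' := fun k => w ^ k * D (k + 1)) w
    (fun k => h0 k _) (fun k => h0 k _) (fun k => by ring)
  have h2 := fsum_succ (c := fun k => w ^ k * D (k + 1)) (c' := fun k => w ^ k * D (k + 2)) w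
    (fun k => h0 k _) (fun k => h0 k _) (fun k => by ring)
  refine ⟨fsum fun k => w ^ k * D (k + 2), ?_⟩
  rw [subst_eq_fsum_taylorTerm hw]
  have h3 : (fun k => taylorTerm w k F) = fun k => w ^ k * D k := rfl
  have h4 : D 0 = F := dividedPow_zero _ F
  have h5 : D 1 = partialD 0 F := dividedPow_one _ F
  rw [h3, h1, h2, zero_add, h4, h5, pow_zero]
  ring

theorem X_zero_add_mem {w : Formal n} (hw : w ∈ ordIdeal n 1) :
    MvPowerSeries.X 0 + w ∈ ordIdeal n 1 := Ideal.add_mem _ (X_mem_ordIdeal 0) hw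

theorem subst_upComp_g₀ (hn : 2 ≤ n) {w : Formal n} (hw : w ∈ ordIdeal n 1) :
    MvPowerSeries.subst (upComp (MvPowerSeries.X 0 + w)) (g₀ n : Formal n) =
      (g₀ n : Formal n) - MvPowerSeries.X 1 * w := by
  have hs := hasSubst_upComp (X_zero_add_mem hw)
  rw [coe_g₀, MvPowerSeries.subst_sub hs, MvPowerSeries.subst_mul hs, MvPowerSeries.subst_X hs,
    MvPowerSeries.subst_X hs, MvPowerSeries.subst_X hs, upComp_zero,
    upComp_ne _ (fin_zero_ne_one hn).symm, upComp_ne _ (fin_zero_ne_two hn).symm]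
  ring

theorem not_g₀_dvd_of_constantCoeff {m : Formal n} (h : MvPowerSeries.constantCoeff m ≠ 0) :
    ¬ (g₀ n : Formal n) ∣ m := by
  rintro ⟨a, rfl⟩
  rw [map_mul, mem_ordIdeal_one.mp g₀_mem_ordIdeal, zero_mul] at h
  exact h rfl

/-! ### Necessity of the two conditions -/

/-- The invariants of the formal conjugation by special transformations. -/
theorem invariants_of_conjugated (hn : 2 ≤ n) {v₁ v₂ τ : Formal n}
    (h : MvPowerSeries.subst (upComp (MvPowerSeries.X 0 + (g₀ n : Formal n) * τ))
        (MvPowerSeries.X 0 + v₂ * (g₀ n : Formal n) ^ 2) =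
      MvPowerSeries.subst (upComp (MvPowerSeries.X 0 + v₁ * (g₀ n : Formal n) ^ 2))
        (MvPowerSeries.X 0 + (g₀ n : Formal n) * τ)) :
    MvPowerSeries.constantCoeff v₁ = MvPowerSeries.constantCoeff v₂ ∧
      (g₀ n : Formal n) ∣ partialD 0 v₁ * v₂ ^ 2 - partialD 0 v₂ * v₁ ^ 2 := by
  have hw : (g₀ n : Formal n) * τ ∈ ordIdeal n 1 := Ideal.mul_mem_right _ _ g₀_mem_ordIdeal
  have hw' : v₁ * (g₀ n : Formal n) ^ 2 ∈ ordIdeal n 1 := by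
    rw [pow_two]
    exact Ideal.mul_mem_left _ _ (Ideal.mul_mem_right _ _ g₀_mem_ordIdeal)
  have hs := hasSubst_upComp (X_zero_add_mem hw)
  have hs' := hasSubst_upComp (X_zero_add_mem hw')
  obtain ⟨R₁, hR₁⟩ := exists_taylor_two hw v₂
  obtain ⟨R₂, hR₂⟩ := exists_taylor_two hw' τ
  rw [MvPowerSeries.subst_add hs, MvPowerSeries.subst_mul hs, MvPowerSeries.subst_pow hs,
    MvPowerSeries.subst_X hs, upComp_zero, subst_upComp_g₀ hn hw, hR₁,
    MvPowerSeries.subst_add hs', MvPowerSeries.subst_mul hs', MvPowerSeries.subst_X hs',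
    upComp_zero, subst_upComp_g₀ hn hw', hR₂] at h
  have hg := coe_g₀_ne_zero hn
  have hpr := prime_coe_g₀ hn
  have hdg := partialD_zero_g₀ hn
  have hm0 : ¬ (g₀ n : Formal n) ∣ 1 - MvPowerSeries.X 1 * τ := by
    refine not_g₀_dvd_of_constantCoeff ?_
    rw [map_sub, map_mul, map_one, MvPowerSeries.constantCoeff_X, zero_mul, sub_zero]
    exact one_ne_zero
  have hdy : partialD 0 (MvPowerSeries.X 1 : Formal n) = 0 := partialD_X_ne (fin_zero_ne_one hn).symm
  have hg0 := mem_ordIdeal_one.mp (g₀_mem_ordIdeal (n := n))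
  have hy0 := MvPowerSeries.constantCoeff_X (R := ℂ) (1 : Fin (n + 1))
  generalize (g₀ n : Formal n) = g at *
  generalize (MvPowerSeries.X 1 : Formal n) = y at *
  set m := 1 - y * τ with hm
  set τ' := partialD 0 τ with hτ'
  set v₁' := partialD 0 v₁ with hv₁'
  set v₂' := partialD 0 v₂ with hv₂'
  set K := g * v₁ ^ 2 * R₂ - y * v₁ ^ 2 * τ' - y * v₁ ^ 3 * g ^ 2 * R₂ - m ^ 2 * τ ^ 2 * R₁ with hK
  set T := v₁ * τ' - τ * m ^ 2 * v₂' with hT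
  -- The conjugacy equation divided by g², where g ∘ σ = g m; `T` gathers the terms of first order
  -- in g and `K` the rest.
  have hE : m ^ 2 * v₂ - v₁ * m = g * T + g ^ 2 * K := by
    refine mul_left_cancel₀ (pow_ne_zero 2 hg) ?_
    rw [hK, hT, hm]
    linear_combination h
  -- Modulo g this is m v₂ = v₁ after cancelling m, which g does not divide since m(0) = 1.
  -- Evaluation at 0 gives v₁(0) = v₂(0).
  obtain ⟨J, hJ⟩ : g ∣ m * v₂ - v₁ := by
    have h1 : g ∣ m * (m * v₂ - v₁) := ⟨T + g * K, by linear_combination hE⟩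
    exact (hpr.dvd_or_dvd h1).resolve_left hm0
  constructor
  · have h1 := congrArg (MvPowerSeries.constantCoeff (σ := Fin (n + 1)) (R := ℂ)) hJ
    rw [hm] at h1
    simp only [map_sub, map_mul, map_one, hg0, hy0, zero_mul, sub_zero, one_mul] at h1
    exact (sub_eq_zero.mp h1).symm
  · have hdm : partialD 0 m = -(y * τ') := by
      have h1 := partialD_mul 0 y τ
      rw [hdy, zero_mul, add_zero] at h1
      rw [hm, partialD, map_sub, MvPowerSeries.pderiv_one, zero_sub]
      exact congrArg Neg.neg h1
    -- Since ∂g/∂x = -x₁, the derivative of g T still sees T modulo g. With m v₂ ≡ v₁ the terms in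
    -- ∂τ/∂x cancel and m (v₁' - m² v₂') ≡ 0 remains; eliminating m between the two congruences
    -- gives the divisibility.
    have hdE := congrArg (partialD 0) hE
    have e1 : partialD 0 (m ^ 2 * v₂ - v₁ * m) =
        2 * m * partialD 0 m * v₂ + m ^ 2 * v₂' - v₁' * m - v₁ * partialD 0 m := by
      have a1 := partialD_mul 0 (m ^ 2) v₂
      have a2 := partialD_mul 0 m m
      have a3 := partialD_mul 0 v₁ m
      rw [← pow_two] at a2
      rw [a2] at a1
      simp only [partialD] at *
      rw [map_sub, a1, a3]
      ring
    have e2 : partialD 0 (g * T + g ^ 2 * K) =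
        -(y * T) + g * partialD 0 T - 2 * y * g * K + g ^ 2 * partialD 0 K := by
      have a1 := partialD_mul 0 g T
      have a2 := partialD_mul 0 g g
      have a3 := partialD_mul 0 (g ^ 2) K
      rw [← pow_two] at a2
      rw [a2, hdg] at a3
      rw [hdg] at a1
      simp only [partialD] at *
      rw [map_add, a1, a3]
      ring
    rw [e1, e2, hdm] at hdE
    have h1 : g ∣ m * (v₁' * v₂ ^ 2 - v₂' * v₁ ^ 2) := by
      refine ⟨v₂ ^ 2 * (-2 * y * τ' * J - partialD 0 T + 2 * y * K - g * partialD 0 K) +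
        m * v₂' * J * (m * v₂ + v₁), ?_⟩
      have hy : y * τ = 1 - m := by rw [hm]; ring
      have hdE' : m * (v₁' - m ^ 2 * v₂') = -2 * y * τ' * (m * v₂ - v₁) - g * partialD 0 T +
          2 * y * g * K - g ^ 2 * partialD 0 K := by
        rw [hT] at hdE
        linear_combination -hdE - m ^ 2 * v₂' * hy
      linear_combination v₂ ^ 2 * hdE' +
        (m * v₂' * (m * v₂ + v₁) - 2 * y * τ' * v₂ ^ 2) * hJ
    exact (hpr.dvd_or_dvd h1).resolve_left hm0

/-! ### Formal logarithms of x + (x₂ - x x₁)² v -/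

theorem exists_fixed_point_formal (T : Formal n → Formal n)
    (hT : ∀ N F G, F - G ∈ ordIdeal n N → T F - T G ∈ ordIdeal n (N + 1)) : ∃ F, T F = F := by
  refine exists_fixed_point_of_contracting (fun d : Fin (n + 1) →₀ ℕ => d.degree) T ?_
  intro N F G h d hd
  exact sub_eq_zero.mp (hT N F G (fun e he => sub_eq_zero.mpr (h e he)) d hd)

/-- The iterates of the vector field `(x₂ - x x₁)² u ∂/∂x` at `x` are
`(x₂ - x x₁)^(k + 2) · fieldIterate u k`. -/
def fieldIterate (u : Formal n) : ℕ → Formal n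
  | 0 => u
  | k + 1 => u * ((g₀ n : Formal n) * partialD 0 (fieldIterate u k) -
      ((k + 2 : ℕ) : ℂ) • (MvPowerSeries.X 1 * fieldIterate u k))

theorem fieldIterate_succ (u : Formal n) (k : ℕ) :
    fieldIterate u (k + 1) = u * ((g₀ n : Formal n) * partialD 0 (fieldIterate u k) -
      ((k + 2 : ℕ) : ℂ) • (MvPowerSeries.X 1 * fieldIterate u k)) := rfl

theorem fieldIterate_sub_mem {u u' : Formal n} {N : ℕ} (h : u - u' ∈ ordIdeal n N) (k : ℕ) :
    fieldIterate u k - fieldIterate u' k ∈ ordIdeal n N := by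
  induction k with
  | zero => exact h
  | succ k ih =>
    have h0 : (g₀ n : Formal n) * partialD 0 (fieldIterate u k - fieldIterate u' k) ∈
        ordIdeal n N := mul_partialD_mem_ordIdeal (M := 0) 0 (g₀_mem_ordIdeal (n := n)) ih
    have h1 := Ideal.mul_mem_left _ u (Ideal.sub_mem _ h0
      (smul_mem_ordIdeal ((k + 2 : ℕ) : ℂ) (Ideal.mul_mem_left _ (MvPowerSeries.X 1) ih)))
    have h2 := Ideal.mul_mem_right ((g₀ n : Formal n) * partialD 0 (fieldIterate u' k) -
      ((k + 2 : ℕ) : ℂ) • (MvPowerSeries.X 1 * fieldIterate u' k)) _ h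
    convert Ideal.add_mem _ h1 h2 using 1
    simp only [fieldIterate_succ, partialD, map_sub, MvPowerSeries.smul_eq_C_mul]
    ring

theorem g₀_pow_mul_mem (k : ℕ) (F : Formal n) : (g₀ n : Formal n) ^ k * F ∈ ordIdeal n k := by
  have := pow_mem_ordIdeal (g₀_mem_ordIdeal (n := n)) k
  rw [one_mul] at this
  exact Ideal.mul_mem_right _ _ this

/-- The vector field `(x₂ - x x₁)² u ∂/∂x`. -/
def fieldOf (u : Formal n) : Derivation ℂ (Formal n) (Formal n) :=
  ((g₀ n : Formal n) ^ 2 * u) • MvPowerSeries.pderiv ℂ 0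

theorem fieldOf_apply (u F : Formal n) :
    fieldOf u F = (g₀ n : Formal n) ^ 2 * u * partialD 0 F := rfl

theorem higherDerivation_fieldOf (u : Formal n) : HigherDerivation (dividedPow (fieldOf u)) :=
  higherDerivation_dividedPow fun _ _ hF => mul_partialD_mem_ordIdeal 0 (g₀_pow_mul_mem 2 u) hF

/-- Applying g² u ∂/∂x to gᵏ⁺² M gives gᵏ⁺³ u (g ∂M/∂x - (k + 2) x₁ M), which is the recursion of
`fieldIterate`. -/
theorem dividedPow_fieldOf_X_zero (hn : 2 ≤ n) (u : Formal n) (k : ℕ) :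
    dividedPow (fieldOf u) (k + 1) (MvPowerSeries.X 0) = (g₀ n : Formal n) ^ 2 *
      (((k + 1).factorial : ℂ)⁻¹ • ((g₀ n : Formal n) ^ k * fieldIterate u k)) := by
  rw [dividedPow, LinearMap.smul_apply, mul_smul_comm]
  congr 1
  induction k with
  | zero =>
    rw [zero_add, pow_one, pow_zero, one_mul]
    change (g₀ n : Formal n) ^ 2 * u * partialD 0 (MvPowerSeries.X 0) = _
    rw [partialD, MvPowerSeries.pderiv_X_self, mul_one]
    rfl
  | succ k ih =>
    rw [pow_succ', Module.End.mul_apply, ih]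
    change (g₀ n : Formal n) ^ 2 * u * partialD 0 _ = _
    have h1 : partialD 0 ((g₀ n : Formal n) ^ (k + 2)) =
        -(((k + 2 : ℕ) : ℂ) • ((g₀ n : Formal n) ^ (k + 1) * MvPowerSeries.X 1)) := by
      have h2 := partialD_zero_g₀ hn
      simp only [partialD] at h2 ⊢
      rw [Derivation.leibniz_pow, h2, Nat.add_succ_sub_one, smul_neg, smul_neg, smul_eq_mul,
        ← Nat.cast_smul_eq_nsmul ℂ]
    rw [← mul_assoc, ← pow_add, add_comm 2 k, partialD_mul, h1, fieldIterate]
    simp only [MvPowerSeries.smul_eq_C_mul]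
    ring

/-- Every up-diffeomorphism `x + (x₂ - x x₁)² v` is the exponential of a formal vector field. -/
theorem exists_log (hn : 2 ≤ n) (v : Formal n) : ∃ u K : Formal n,
    v = u - MvPowerSeries.X 1 * (g₀ n : Formal n) * u ^ 2 + (g₀ n : Formal n) ^ 2 * K ∧
    ∀ F, MvPowerSeries.subst (upComp (MvPowerSeries.X 0 + v * (g₀ n : Formal n) ^ 2)) F =
      fsum fun k => dividedPow (fieldOf u) k F := by
  have hmem : ∀ (c : ℕ → ℂ) (M : ℕ → Formal n) (k : ℕ),
      c k • ((g₀ n : Formal n) ^ k * M k) ∈ ordIdeal n k :=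
    fun c M k => smul_mem_ordIdeal _ (g₀_pow_mul_mem k _)
  -- The exponential sends x to x + g² ∑ gʲ `fieldIterate u j`/(j + 1)!. The family `c i u` lists
  -- the terms j ≥ i of that sum with gⁱ removed, so the sums are linked by one factor g.
  set c : ℕ → Formal n → ℕ → Formal n := fun i u k =>
    (((k + i + 1).factorial : ℂ)⁻¹) • ((g₀ n : Formal n) ^ k * fieldIterate u (k + i)) with hc
  have hcm : ∀ i u k, c i u k ∈ ordIdeal n k := fun i u k =>
    hmem (fun k => (((k + i + 1).factorial : ℂ)⁻¹)) (fun k => fieldIterate u (k + i)) k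
  have hcs : ∀ i u k, c i u (k + 1) = (g₀ n : Formal n) * c (i + 1) u k := by
    intro i u k
    simp only [hc, add_right_comm k 1 i, ← add_assoc k i 1]
    rw [pow_succ', mul_assoc, mul_smul_comm]
  have hsucc : ∀ i u, fsum (c i u) = c i u 0 + (g₀ n : Formal n) * fsum (c (i + 1) u) :=
    fun i u => fsum_succ _ (hcm i u) (hcm (i + 1) u) (hcs i u)
  -- The equation v = u + g · (tail depending on u) is solved for u; the factor g gains the degree
  -- needed for contraction.
  obtain ⟨u, hu⟩ := exists_fixed_point_formal
    (fun u => v - (g₀ n : Formal n) * fsum (c 1 u)) (by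
      intro N u u' h
      have h1 : fsum (c 1 u) - fsum (c 1 u') ∈ ordIdeal n N := by
        refine fsum_sub_fsum_mem (hcm 1 u) (hcm 1 u') fun k => ?_
        simp only [hc]
        rw [← smul_sub, ← mul_sub]
        exact smul_mem_ordIdeal _ (Ideal.mul_mem_left _ _ (fieldIterate_sub_mem h _))
      have h2 := Ideal.neg_mem_iff _ |>.mpr (mul_mem_ordIdeal (g₀_mem_ordIdeal (n := n)) h1)
      rw [add_comm 1 N] at h2
      convert h2 using 1
      ring)
  have hc0 : c 0 u 0 = u := by simp [hc, fieldIterate]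
  have hv : v = fsum (c 0 u) := by
    rw [hsucc 0 u, hc0, zero_add]
    linear_combination hu
  -- The term j = 1 is g u (g ∂u/∂x - 2 x₁ u)/2; its second half is -x₁ g u², and its first half
  -- joins the tail j ≥ 2 in K.
  refine ⟨u, (1 / 2 : ℂ) • (u * partialD 0 u) + fsum (c 2 u), ?_, fun F => ?_⟩
  · have h1 : c 1 u 0 = (1 / 2 : ℂ) • (u * ((g₀ n : Formal n) * partialD 0 u -
        (2 : ℂ) • (MvPowerSeries.X 1 * u))) := by
      simp [hc, fieldIterate]
    have h2 : (MvPowerSeries.C (1 / 2 : ℂ) : Formal n) * MvPowerSeries.C (2 : ℂ) = 1 := by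
      rw [← map_mul]
      norm_num
    have h3 := hsucc 0 u
    rw [hsucc (0 + 1) u, hc0, ← hv, zero_add, h1] at h3
    conv_lhs => rw [h3]
    simp only [MvPowerSeries.smul_eq_C_mul]
    linear_combination (-(g₀ n : Formal n) * MvPowerSeries.X 1 * u ^ 2) * h2
  · refine ((higherDerivation_fieldOf u).fsum_eq_subst (fun i => ?_) F).symm
    by_cases hi : i = 0
    · rw [hi, upComp_zero, fsum_succ ((g₀ n : Formal n) ^ 2)
        (fun k => (higherDerivation_fieldOf u).mem k _) (hcm 0 u)
        (fun k => dividedPow_fieldOf_X_zero hn u k), dividedPow_zero, ← hv, mul_comm]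
    · rw [upComp_ne _ hi, fsum_succ 0 (fun k => (higherDerivation_fieldOf u).mem k _)
        (fun k => zero_mem (ordIdeal n k)), dividedPow_zero, zero_mul, add_zero]
      intro k
      rw [zero_mul]
      refine dividedPow_eq_zero (m := 1) ?_ (by omega)
      rw [dividedPow_one, fieldOf_apply, partialD_X_ne hi, mul_zero]

/-! ### Conjugation of vector fields and of their exponentials -/

/-- The chain rule, checked on polynomials and extended by continuity; the approximation is taken to
order N + 1 because differentiation loses one. -/
theorem partialD_subst_upComp {σ : Formal n} (hσ : σ ∈ ordIdeal n 1) (F : Formal n) :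
    partialD 0 (MvPowerSeries.subst (upComp σ) F) =
      partialD 0 σ * MvPowerSeries.subst (upComp σ) (partialD 0 F) := by
  have hs := hasSubst_upComp hσ
  have hpoly : ∀ p : MvPolynomial (Fin (n + 1)) ℂ,
      partialD 0 (MvPowerSeries.subst (upComp σ) (p : Formal n)) =
        partialD 0 σ * MvPowerSeries.subst (upComp σ) (partialD 0 (p : Formal n)) := by
    intro p
    induction p using MvPolynomial.induction_on with
    | C a =>
      have h1 : MvPowerSeries.subst (upComp σ) (MvPowerSeries.C a : Formal n) =
          MvPowerSeries.C a := by
        rw [← MvPowerSeries.coe_substAlgHom hs]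
        exact (MvPowerSeries.substAlgHom hs).commutes a
      rw [MvPolynomial.coe_C, h1, partialD, MvPowerSeries.pderiv_C,
        ← MvPowerSeries.coe_substAlgHom hs, map_zero, mul_zero]
    | add p q hp hq =>
      simp only [partialD] at *
      rw [MvPolynomial.coe_add, MvPowerSeries.subst_add hs, map_add, map_add,
        MvPowerSeries.subst_add hs, hp, hq, mul_add]
    | mul_X p i hp =>
      rw [MvPolynomial.coe_mul, MvPolynomial.coe_X, MvPowerSeries.subst_mul hs, partialD_mul,
        partialD_mul, hp, MvPowerSeries.subst_add hs, MvPowerSeries.subst_mul hs,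
        MvPowerSeries.subst_mul hs, MvPowerSeries.subst_X hs]
      by_cases hi : i = 0
      · subst hi
        have h1 : MvPowerSeries.subst (upComp σ) (1 : Formal n) = 1 := by
          rw [← MvPowerSeries.coe_substAlgHom hs, map_one]
        rw [upComp_zero, partialD, partialD, partialD, MvPowerSeries.pderiv_X_self, h1]
        ring
      · have h1 : MvPowerSeries.subst (upComp σ) (0 : Formal n) = 0 := by
          rw [← MvPowerSeries.coe_substAlgHom hs, map_zero]
        rw [upComp_ne _ hi, partialD_X_ne hi, h1]
        ring
  refine eq_of_sub_mem_ordIdeal fun N => ?_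
  obtain ⟨p, hp⟩ := exists_polynomial_sub_mem F (N + 1)
  have h1 := partialD_mem_ordIdeal 0 (subst_mem_ordIdeal (upComp_mem hσ) hp)
  have h2 := Ideal.mul_mem_left _ (partialD 0 σ)
    (subst_mem_ordIdeal (upComp_mem hσ) (partialD_mem_ordIdeal 0 hp))
  have h3 := hpoly p
  simp only [partialD] at *
  rw [MvPowerSeries.subst_sub hs, map_sub, h3] at h1
  rw [map_sub, MvPowerSeries.subst_sub hs, mul_sub] at h2
  have := Ideal.sub_mem _ h1 h2
  rwa [sub_sub_sub_cancel_right] at this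

/-- A transformation which conjugates two vector fields conjugates their exponentials. -/
theorem subst_fsum_dividedPow {σ u₁ u₂ : Formal n} (hσ : σ ∈ ordIdeal n 1)
    (h : (g₀ n : Formal n) ^ 2 * u₁ * partialD 0 σ =
      MvPowerSeries.subst (upComp σ) ((g₀ n : Formal n) ^ 2 * u₂)) (F : Formal n) :
    MvPowerSeries.subst (upComp σ) (fsum fun k => dividedPow (fieldOf u₂) k F) =
      fsum fun k => dividedPow (fieldOf u₁) k (MvPowerSeries.subst (upComp σ) F) := by
  have hs := hasSubst_upComp hσ
  -- By the chain rule the hypothesis says that composition with σ intertwines the two derivations,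
  -- hence also their divided powers.
  have h1 : ∀ k, MvPowerSeries.subst (upComp σ) (dividedPow (fieldOf u₂) k F) =
      dividedPow (fieldOf u₁) k (MvPowerSeries.subst (upComp σ) F) := by
    intro k
    induction k with
    | zero => rw [dividedPow_zero, dividedPow_zero]
    | succ k ih =>
      have hk : ((k + 1 : ℕ) : ℂ) ≠ 0 := by exact_mod_cast Nat.succ_ne_zero k
      refine smul_right_injective _ hk ?_
      simp only
      rw [← dividedPow_succ, ← ih, fieldOf_apply, partialD_subst_upComp hσ,
        ← MvPowerSeries.subst_smul hs, ← dividedPow_succ, fieldOf_apply, MvPowerSeries.subst_mul hs,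
        ← h]
      ring
  symm
  refine fsum_eq_of_approx (fun k => (higherDerivation_fieldOf u₁).mem k _) fun N => ?_
  have h2 := subst_mem_ordIdeal (upComp_mem hσ)
    (fsum_sub_sum_mem (fun k => (higherDerivation_fieldOf u₂).mem k F) N)
  rw [← MvPowerSeries.coe_substAlgHom hs, map_sub, map_sum, MvPowerSeries.coe_substAlgHom hs] at h2
  simpa only [h1] using h2

/-! ### The transport equation along the orbits -/

/-- The coefficient of `s^k` in `u(x + (x₂ - x x₁) s, x₁, …, xₙ)`. -/
def pathCoeff (u : Formal n) (k : ℕ) : Formal n :=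
  (g₀ n : Formal n) ^ k * dividedPow (MvPowerSeries.pderiv ℂ 0) k u

/-- The coefficient of `s^k` in `F(s) / (1 - x₁ s)` with `F(s) = ∑ a_k s^k`. -/
def geomCoeff (a : ℕ → Formal n) : ℕ → Formal n
  | 0 => a 0
  | k + 1 => a (k + 1) + MvPowerSeries.X 1 * geomCoeff a k

theorem pathCoeff_mem (u : Formal n) (k : ℕ) : pathCoeff u k ∈ ordIdeal n k := g₀_pow_mul_mem k _

theorem geomCoeff_mem {a : ℕ → Formal n} (ha : ∀ k, a k ∈ ordIdeal n k) (k : ℕ) :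
    geomCoeff a k ∈ ordIdeal n k := by
  induction k with
  | zero => exact ha 0
  | succ k ih =>
    have := mul_mem_ordIdeal (X_mem_ordIdeal 1) ih
    rw [add_comm 1 k] at this
    exact Ideal.add_mem _ (ha _) this

/-- The recursion of `geomCoeff` is multiplication by the geometric series of x₁ s; here s is set
equal to τ. -/
theorem fsum_geomCoeff {a : ℕ → Formal n} (ha : ∀ k, a k ∈ ordIdeal n k) (τ : Formal n) :
    (1 - MvPowerSeries.X 1 * τ) * fsum (fun k => geomCoeff a k * τ ^ k) =
      fsum fun k => a k * τ ^ k := by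
  have h1 : ∀ k, a k * τ ^ k ∈ ordIdeal n k := fun k => Ideal.mul_mem_right _ _ (ha k)
  have h2 : ∀ k, geomCoeff a k * τ ^ k ∈ ordIdeal n k :=
    fun k => Ideal.mul_mem_right _ _ (geomCoeff_mem ha k)
  have h4 : ∀ k, geomCoeff a k * τ ^ k - a k * τ ^ k ∈ ordIdeal n k :=
    fun k => Ideal.sub_mem _ (h2 k) (h1 k)
  have h5 := fsum_succ (MvPowerSeries.X 1 * τ) h4 h2 (fun k => by
    rw [geomCoeff]
    ring)
  have h6 := fsum_add h1 h4
  simp only [add_sub_cancel] at h6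
  have h7 : geomCoeff a 0 = a 0 := rfl
  rw [h7, sub_self, zero_add] at h5
  rw [h5] at h6
  linear_combination h6

/-- Coefficient form of g ∂U/∂x = (1 - x₁ s) ∂U/∂s for U(s) = u(x + g s), which holds because ∂(x +
g s)/∂x = 1 - x₁ s. -/
theorem g₀_mul_partialD_pathCoeff (hn : 2 ≤ n) (u : Formal n) (k : ℕ) :
    (g₀ n : Formal n) * partialD 0 (pathCoeff u k) =
      ((k + 1 : ℕ) : Formal n) * pathCoeff u (k + 1) -
        (k : Formal n) * (MvPowerSeries.X 1 * pathCoeff u k) := by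
  have h1 : partialD 0 (dividedPow (MvPowerSeries.pderiv ℂ 0) k u) =
      ((k + 1 : ℕ) : Formal n) * dividedPow (MvPowerSeries.pderiv ℂ 0) (k + 1) u := by
    rw [partialD, dividedPow_succ, Nat.cast_smul_eq_nsmul, nsmul_eq_mul]
  have h2 : (g₀ n : Formal n) * partialD 0 ((g₀ n : Formal n) ^ k) =
      -((k : Formal n) * (MvPowerSeries.X 1 * (g₀ n : Formal n) ^ k)) := by
    have h3 := partialD_zero_g₀ hn
    simp only [partialD] at h3 ⊢
    rcases k with _ | k
    · simp
    · rw [Derivation.leibniz_pow, h3, Nat.add_sub_cancel, smul_eq_mul, nsmul_eq_mul]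
      ring
  rw [pathCoeff, pathCoeff, partialD_mul, h1, mul_add, ← mul_assoc, ← mul_assoc, ← mul_assoc, h2]
  ring

/-- Coefficient form of g ∂E/∂x = ∂U/∂s for E = U/(1 - x₁ s): the preceding relation divided by 1 -
x₁ s, which does not depend on x. -/
theorem g₀_mul_partialD_geomCoeff (hn : 2 ≤ n) (u : Formal n) (k : ℕ) :
    (g₀ n : Formal n) * partialD 0 (geomCoeff (pathCoeff u) k) =
      ((k + 1 : ℕ) : Formal n) * pathCoeff u (k + 1) := by
  induction k with
  | zero =>
    rw [geomCoeff, g₀_mul_partialD_pathCoeff hn]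
    simp
  | succ k ih =>
    have h1 := g₀_mul_partialD_pathCoeff hn u (k + 1)
    have h2 := partialD_mul 0 (MvPowerSeries.X 1 : Formal n) (geomCoeff (pathCoeff u) k)
    rw [partialD_X_ne (fin_zero_ne_one hn).symm, zero_mul, add_zero] at h2
    rw [geomCoeff]
    simp only [partialD] at *
    rw [map_add, h2, mul_add, h1]
    linear_combination MvPowerSeries.X 1 * ih

/-- Coefficient form of g ∂C/∂x + x₁ C = ∂E/∂s for C = U/(1 - x₁ s)². Thus g ∂/∂x + x₁ turns the
integrand into an exact derivative in s. -/
theorem g₀_mul_partialD_geomCoeff_geomCoeff (hn : 2 ≤ n) (u : Formal n) (k : ℕ) :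
    (g₀ n : Formal n) * partialD 0 (geomCoeff (geomCoeff (pathCoeff u)) k) +
      MvPowerSeries.X 1 * geomCoeff (geomCoeff (pathCoeff u)) k =
      ((k + 1 : ℕ) : Formal n) * geomCoeff (pathCoeff u) (k + 1) := by
  induction k with
  | zero =>
    rw [geomCoeff, g₀_mul_partialD_geomCoeff hn, geomCoeff]
    simp
    rfl
  | succ k ih =>
    have h1 := g₀_mul_partialD_geomCoeff hn u (k + 1)
    have h2 := partialD_mul 0 (MvPowerSeries.X 1 : Formal n)
      (geomCoeff (geomCoeff (pathCoeff u)) k)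
    rw [partialD_X_ne (fin_zero_ne_one hn).symm, zero_mul, add_zero] at h2
    have h3 : geomCoeff (pathCoeff u) (k + 1 + 1) =
      pathCoeff u (k + 1 + 1) + MvPowerSeries.X 1 * geomCoeff (pathCoeff u) (k + 1) := rfl
    rw [geomCoeff, h3]
    simp only [partialD] at *
    rw [map_add, h2, mul_add, h1]
    push_cast at *
    linear_combination MvPowerSeries.X 1 * ih

/-- Solution of `∫₀^τ u(x + (x₂ - x x₁) s, x₁, …, xₙ) / (1 - x₁ s)² ds = β`. -/
theorem exists_transport (hn : 2 ≤ n) {u u' : Formal n} (hu : u' * u = 1) (β : Formal n) :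
    ∃ τ : Formal n, (1 - MvPowerSeries.X 1 * τ) ^ 2 *
        ((g₀ n : Formal n) * partialD 0 β + MvPowerSeries.X 1 * β + u) =
      (1 - MvPowerSeries.X 1 * τ + (g₀ n : Formal n) * partialD 0 τ) *
        MvPowerSeries.subst (upComp (MvPowerSeries.X 0 + (g₀ n : Formal n) * τ)) u := by
  set e := geomCoeff (pathCoeff u) with he
  set c := geomCoeff e with hc
  have hem : ∀ k, e k ∈ ordIdeal n k := geomCoeff_mem (pathCoeff_mem u)
  have hcm : ∀ k, c k ∈ ordIdeal n k := geomCoeff_mem hem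
  -- `G τ k` is the integral of c k sᵏ from 0 to τ, so the sum of the family is the integral to be
  -- equated with β.
  set G : Formal n → ℕ → Formal n :=
    fun τ k => MvPowerSeries.C ((k + 1 : ℂ)⁻¹) * (c k * τ ^ (k + 1)) with hG
  have hGm : ∀ τ k, G τ k ∈ ordIdeal n k := fun τ k =>
    Ideal.mul_mem_left _ _ (Ideal.mul_mem_right _ _ (hcm k))
  have hGm' : ∀ τ k, G τ (k + 1) ∈ ordIdeal n k := fun τ k => ordIdeal_anti (Nat.le_succ k) (hGm τ _)
  -- The linear coefficient of the equation is c 0 = u, which is invertible; the other coefficients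
  -- have positive order, so solving for the linear term gives a contraction.
  obtain ⟨τ, hτ⟩ := exists_fixed_point_formal
    (fun τ => u' * (β - fsum fun k => G τ (k + 1))) (by
      intro N τ τ' h
      have h1 : (fsum fun k => G τ (k + 1)) - (fsum fun k => G τ' (k + 1)) ∈ ordIdeal n (N + 1) := by
        refine fsum_sub_fsum_mem (hGm' τ) (hGm' τ') fun k => ?_
        obtain ⟨q, hq⟩ := sub_dvd_pow_sub_pow τ τ' (k + 1 + 1)
        have h2 := mul_mem_ordIdeal h (ordIdeal_anti (by omega : 1 ≤ k + 1) (hcm (k + 1)))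
        convert Ideal.mul_mem_left _
          (MvPowerSeries.C ((((k + 1 : ℕ) : ℂ) + 1)⁻¹) * q) h2 using 1
        simp only [hG]
        linear_combination (MvPowerSeries.C ((((k + 1 : ℕ) : ℂ) + 1)⁻¹) * c (k + 1)) * hq
      convert Ideal.mul_mem_left _ (-u') h1 using 1
      ring)
  have hβ : fsum (G τ) = β := by
    have h1 := fsum_succ 1 (hGm τ) (hGm' τ) (fun k => (one_mul _).symm)
    have h2 : G τ 0 = u * τ := by
      have h3 : c 0 = u := by
        change (g₀ n : Formal n) ^ 0 * dividedPow _ 0 u = u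
        rw [pow_zero, one_mul, dividedPow_zero]
      simp [hG, h3]
    rw [h1, h2]
    linear_combination (-u) * hτ + (β - fsum fun k => G τ (k + 1)) * hu
  have hA : MvPowerSeries.subst (upComp (MvPowerSeries.X 0 + (g₀ n : Formal n) * τ)) u =
      fsum fun k => pathCoeff u k * τ ^ k := by
    rw [subst_eq_fsum_taylorTerm (Ideal.mul_mem_right _ _ g₀_mem_ordIdeal)]
    congr 1
    funext k
    rw [taylorTerm_apply, pathCoeff, mul_pow]
    ring
  have hE := fsum_geomCoeff (pathCoeff_mem u) τ
  have hC := fsum_geomCoeff hem τ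
  rw [← he] at hE
  rw [← hc] at hC
  -- Apply g ∂/∂x + x₁ to the integral of C: the integrand becomes ∂E/∂s, which integrates to E(τ) -
  -- u, and the moving endpoint adds g (∂τ/∂x) C(τ). The identity is verified on partial sums.
  have hmain : (g₀ n : Formal n) * partialD 0 β + MvPowerSeries.X 1 * β + u =
      fsum (fun k => e k * τ ^ k) + (g₀ n : Formal n) * partialD 0 τ *
        fsum fun k => c k * τ ^ k := by
    refine eq_of_sub_mem_ordIdeal fun N => ?_
    have k1 := Ideal.mul_mem_left _ (g₀ n : Formal n) (partialD_fsum_sub_mem 0 (hGm τ) N)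
    have k2 := Ideal.mul_mem_left _ (MvPowerSeries.X 1)
      (ordIdeal_anti (Nat.le_succ N) (fsum_sub_sum_mem (hGm τ) (N + 1)))
    have k3 := ordIdeal_anti (by omega : N ≤ N + 1 + 1)
      (fsum_sub_sum_mem (fun k => Ideal.mul_mem_right (τ ^ k) _ (hem k)) (N + 1 + 1))
    have k4 := Ideal.mul_mem_left _ ((g₀ n : Formal n) * partialD 0 τ) (ordIdeal_anti (Nat.le_succ N)
      (fsum_sub_sum_mem (fun k => Ideal.mul_mem_right (τ ^ k) _ (hcm k)) (N + 1)))
    rw [hβ] at k1 k2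
    have k5 : (g₀ n : Formal n) * ∑ k ∈ Finset.range (N + 1), partialD 0 (G τ k) +
        MvPowerSeries.X 1 * ∑ k ∈ Finset.range (N + 1), G τ k + u =
        ∑ k ∈ Finset.range (N + 1 + 1), e k * τ ^ k +
          (g₀ n : Formal n) * partialD 0 τ * ∑ k ∈ Finset.range (N + 1), c k * τ ^ k := by
      have h0 : e 0 * τ ^ 0 = u := by
        change (g₀ n : Formal n) ^ 0 * dividedPow _ 0 u * τ ^ 0 = u
        rw [pow_zero, pow_zero, one_mul, mul_one, dividedPow_zero]
      rw [Finset.sum_range_succ' (fun k => e k * τ ^ k), h0, Finset.mul_sum, Finset.mul_sum,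
        Finset.mul_sum, ← Finset.sum_add_distrib, add_right_comm, ← Finset.sum_add_distrib]
      congr 1
      refine Finset.sum_congr rfl fun k _ => ?_
      have h1 := g₀_mul_partialD_geomCoeff_geomCoeff hn u k
      rw [← he, ← hc] at h1
      have h2 := partialD_mul 0 (MvPowerSeries.C ((k + 1 : ℂ)⁻¹)) (c k * τ ^ (k + 1))
      have h3 := partialD_mul 0 (c k) (τ ^ (k + 1))
      have h4 : partialD 0 (τ ^ (k + 1)) = ((k + 1 : ℕ) : Formal n) * (τ ^ k * partialD 0 τ) := by
        rw [partialD, Derivation.leibniz_pow, Nat.add_sub_cancel, smul_eq_mul, nsmul_eq_mul]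
      have h5 : (MvPowerSeries.C ((k + 1 : ℂ)⁻¹) : Formal n) * ((k + 1 : ℕ) : Formal n) = 1 := by
        have h6 : ((k + 1 : ℕ) : Formal n) = MvPowerSeries.C ((k : ℂ) + 1) := by
          rw [map_add, map_natCast, map_one, Nat.cast_succ]
        rw [h6, ← map_mul, inv_mul_cancel₀ (Nat.cast_add_one_ne_zero k), map_one]
      have h7 : partialD 0 (MvPowerSeries.C ((k + 1 : ℂ)⁻¹) : Formal n) = 0 :=
        MvPowerSeries.pderiv_C
      rw [h7, zero_mul, add_zero, h3, h4] at h2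
      simp only [hG]
      rw [h2]
      linear_combination (MvPowerSeries.C ((k + 1 : ℂ)⁻¹) * τ ^ (k + 1)) * h1 +
        (e (k + 1) * τ ^ (k + 1) + (g₀ n : Formal n) * c k * τ ^ k * partialD 0 τ) * h5
    convert Ideal.sub_mem _ (Ideal.add_mem _ k1 k2) (Ideal.add_mem _ k3 k4) using 1
    linear_combination k5
  refine ⟨τ, ?_⟩
  rw [hmain, hA]
  linear_combination (1 - MvPowerSeries.X 1 * τ + (g₀ n : Formal n) * partialD 0 τ) * hE +
    ((g₀ n : Formal n) * partialD 0 τ * (1 - MvPowerSeries.X 1 * τ)) * hC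

/-! ### Sufficiency of the two conditions -/

/-- Modulo g one has v ≡ u and ∂v/∂x ≡ ∂u/∂x + x₁² u², the last term coming from ∂g/∂x = -x₁. It
contributes x₁² u₁² u₂² to both products and cancels in the difference. -/
theorem g₀_dvd_wronskian_log_iff (hn : 2 ≤ n) {v₁ v₂ u₁ u₂ K₁ K₂ : Formal n}
    (h₁ : v₁ = u₁ - MvPowerSeries.X 1 * (g₀ n : Formal n) * u₁ ^ 2 + (g₀ n : Formal n) ^ 2 * K₁)
    (h₂ : v₂ = u₂ - MvPowerSeries.X 1 * (g₀ n : Formal n) * u₂ ^ 2 + (g₀ n : Formal n) ^ 2 * K₂)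
    (h : (g₀ n : Formal n) ∣ partialD 0 v₁ * v₂ ^ 2 - partialD 0 v₂ * v₁ ^ 2) :
    (g₀ n : Formal n) ∣ partialD 0 u₁ * u₂ ^ 2 - partialD 0 u₂ * u₁ ^ 2 := by
  have key : ∀ {v u K : Formal n},
      v = u - MvPowerSeries.X 1 * (g₀ n : Formal n) * u ^ 2 + (g₀ n : Formal n) ^ 2 * K →
      ∃ a b, v = u + (g₀ n : Formal n) * a ∧
        partialD 0 v = partialD 0 u + MvPowerSeries.X 1 ^ 2 * u ^ 2 + (g₀ n : Formal n) * b := by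
    intro v u K h
    refine ⟨-MvPowerSeries.X 1 * u ^ 2 + (g₀ n : Formal n) * K,
      -MvPowerSeries.X 1 * (2 * u * partialD 0 u) - 2 * MvPowerSeries.X 1 * K +
        (g₀ n : Formal n) * partialD 0 K, by rw [h]; ring, ?_⟩
    have h1 : v = u - MvPowerSeries.X 1 * ((g₀ n : Formal n) * (u * u)) +
        (g₀ n : Formal n) * ((g₀ n : Formal n) * K) := by
      rw [h]
      ring
    have h2 := partialD_mul 0 (MvPowerSeries.X 1) ((g₀ n : Formal n) * (u * u))
    have h3 := partialD_mul 0 (g₀ n : Formal n) (u * u)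
    have h4 := partialD_mul 0 u u
    have h5 := partialD_mul 0 (g₀ n : Formal n) ((g₀ n : Formal n) * K)
    have h6 := partialD_mul 0 (g₀ n : Formal n) K
    rw [partialD_X_ne (fin_zero_ne_one hn).symm, h3, h4, partialD_zero_g₀ hn] at h2
    rw [h6, partialD_zero_g₀ hn] at h5
    rw [h1]
    simp only [partialD] at *
    rw [map_add, map_sub, h2, h5]
    ring
  obtain ⟨a₁, b₁, e₁, d₁⟩ := key h₁
  obtain ⟨a₂, b₂, e₂, d₂⟩ := key h₂
  rw [d₁, d₂, e₁, e₂] at h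
  generalize partialD 0 u₁ = p₁ at *
  generalize partialD 0 u₂ = p₂ at *
  generalize (g₀ n : Formal n) = g at *
  generalize (MvPowerSeries.X 1 : Formal n) = y at *
  obtain ⟨Q, hQ⟩ := h
  refine ⟨Q - ((p₁ + y ^ 2 * u₁ ^ 2) * (2 * u₂ * a₂ + g * a₂ ^ 2) + b₁ * (u₂ + g * a₂) ^ 2 -
    ((p₂ + y ^ 2 * u₂ ^ 2) * (2 * u₁ * a₁ + g * a₁ ^ 2) + b₂ * (u₁ + g * a₁) ^ 2)), ?_⟩
  linear_combination hQ

/-- Since ∂(1/a)/∂x = -(∂a/∂x)/a², the hypothesis is, up to a unit, the condition that the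
difference of the dual coefficients 1/aᵢ is free of residues. -/
theorem g₀_dvd_partialD_inv_sub_inv {a₁ a₂ u₁ u₂ : Formal n} (h₁ : a₁ * u₁ = 1) (h₂ : a₂ * u₂ = 1)
    (h : (g₀ n : Formal n) ∣ partialD 0 a₁ * a₂ ^ 2 - partialD 0 a₂ * a₁ ^ 2) :
    (g₀ n : Formal n) ∣ partialD 0 (u₁ - u₂) := by
  have key : ∀ {a u : Formal n}, a * u = 1 → partialD 0 u = -(partialD 0 a * u ^ 2) := by
    intro a u h
    have h1 := partialD_mul 0 a u
    have h2 : partialD 0 (a * u) = 0 := by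
      rw [h]
      exact Derivation.map_one_eq_zero _
    rw [h2] at h1
    linear_combination (-u) * h1 + (-partialD 0 u) * h
  have h3 : partialD 0 (u₁ - u₂) = partialD 0 u₁ - partialD 0 u₂ := map_sub _ _ _
  have h4 : partialD 0 (u₁ - u₂) =
      (partialD 0 a₁ * a₂ ^ 2 - partialD 0 a₂ * a₁ ^ 2) * -(u₁ ^ 2 * u₂ ^ 2) := by
    rw [h3, key h₁, key h₂]
    linear_combination (partialD 0 a₁ * u₁ ^ 2) * (a₂ * u₂ + 1) * h₂ -
      (partialD 0 a₂ * u₂ ^ 2) * (a₁ * u₁ + 1) * h₁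
  rw [h4]
  exact Dvd.dvd.mul_right h _

theorem eq_zero_of_partialD_two {c : Formal 2} (h : ∀ i ∈ ({0, 1, 2} : Set (Fin 3)), partialD i c = 0)
    (h0 : MvPowerSeries.constantCoeff c = 0) : c = 0 := by
  ext d
  by_cases hd : d = 0
  · rw [hd]
    exact h0
  · obtain ⟨i, hi⟩ := Finsupp.ne_iff.mp hd
    have hs : i ∈ ({0, 1, 2} : Set (Fin 3)) := by fin_cases i <;> simp
    exact (partialD_eq_zero_iff.mp (h i hs)) d (by simpa using hi)

/-- Existence of a formal conjugation by a special transformation. -/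
theorem exists_conjugation {v₁ v₂ : Formal 2} (h0 : MvPowerSeries.constantCoeff v₁ ≠ 0)
    (h : MvPowerSeries.constantCoeff v₁ = MvPowerSeries.constantCoeff v₂)
    (hW : (g₀ 2 : Formal 2) ∣ partialD 0 v₁ * v₂ ^ 2 - partialD 0 v₂ * v₁ ^ 2) :
    ∃ τ : Formal 2, MvPowerSeries.subst (upComp (MvPowerSeries.X 0 + (g₀ 2 : Formal 2) * τ))
        (MvPowerSeries.X 0 + v₂ * (g₀ 2 : Formal 2) ^ 2) =
      MvPowerSeries.subst (upComp (MvPowerSeries.X 0 + v₁ * (g₀ 2 : Formal 2) ^ 2))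
        (MvPowerSeries.X 0 + (g₀ 2 : Formal 2) * τ) := by
  have hn : 2 ≤ 2 := le_rfl
  obtain ⟨a₁, K₁, e₁, f₁⟩ := exists_log hn v₁
  obtain ⟨a₂, K₂, e₂, f₂⟩ := exists_log hn v₂
  have hg0 : MvPowerSeries.constantCoeff (g₀ 2 : Formal 2) = 0 := mem_ordIdeal_one.mp g₀_mem_ordIdeal
  have k₁ : MvPowerSeries.constantCoeff a₁ = MvPowerSeries.constantCoeff v₁ := by
    rw [e₁]
    simp [hg0]
  have k₂ : MvPowerSeries.constantCoeff a₂ = MvPowerSeries.constantCoeff v₁ := by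
    rw [h, e₂]
    simp [hg0]
  set u₁ := a₁⁻¹
  set u₂ := a₂⁻¹
  have i₁ : a₁ * u₁ = 1 := MvPowerSeries.mul_inv_cancel _ (by rwa [k₁])
  have i₂ : a₂ * u₂ = 1 := MvPowerSeries.mul_inv_cancel _ (by rwa [k₂])
  obtain ⟨β, c, hβ, hc, -⟩ := exists_special_normal_form hn
    (g₀_dvd_partialD_inv_sub_inv i₁ i₂ (g₀_dvd_wronskian_log_iff hn e₁ e₂ hW))
  -- For n = 2 the obstruction is a constant, with value 1/a₁(0) - 1/a₂(0). This is where equality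
  -- of the second derivatives at the origin is used.
  have hc0 : c = 0 := by
    refine eq_zero_of_partialD_two hc ?_
    have h1 := congrArg MvPowerSeries.constantCoeff hβ
    simpa [hg0, u₁, u₂, k₁, k₂] using h1.symm
  rw [hc0, add_zero] at hβ
  obtain ⟨τ, hτ⟩ := exists_transport hn i₂ β
  refine ⟨τ, ?_⟩
  have hw : (g₀ 2 : Formal 2) * τ ∈ ordIdeal 2 1 := Ideal.mul_mem_right _ _ g₀_mem_ordIdeal
  have hσ := X_zero_add_mem hw
  set σ : Formal 2 := MvPowerSeries.X 0 + (g₀ 2 : Formal 2) * τ with hσ'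
  have hs := hasSubst_upComp hσ
  have hD : partialD 0 σ = 1 - MvPowerSeries.X 1 * τ + (g₀ 2 : Formal 2) * partialD 0 τ := by
    have h1 := partialD_mul 0 (g₀ 2 : Formal 2) τ
    have h2 : partialD 0 σ = partialD 0 (MvPowerSeries.X 0) + partialD 0 ((g₀ 2 : Formal 2) * τ) :=
      map_add _ _ _
    have h3 : partialD 0 (MvPowerSeries.X 0 : Formal 2) = 1 := MvPowerSeries.pderiv_X_self
    rw [h2, h1, partialD_zero_g₀ hn, h3]
    ring
  have hS : MvPowerSeries.subst (upComp σ) a₂ * MvPowerSeries.subst (upComp σ) u₂ = 1 := by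
    rw [← MvPowerSeries.subst_mul hs, i₂, ← MvPowerSeries.coe_substAlgHom hs, map_one]
  -- With g ∘ σ = g (1 - x₁ τ), the transport equation for u₂ = 1/a₂ becomes the conjugacy of the
  -- two vector fields after multiplication by g² a₁ (a₂ ∘ σ).
  have hconj : (g₀ 2 : Formal 2) ^ 2 * a₁ * partialD 0 σ =
      MvPowerSeries.subst (upComp σ) ((g₀ 2 : Formal 2) ^ 2 * a₂) := by
    rw [MvPowerSeries.subst_mul hs, MvPowerSeries.subst_pow hs, subst_upComp_g₀ hn hw, hD]
    rw [← hβ, sub_add_cancel] at hτ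
    generalize MvPowerSeries.subst (upComp σ) a₂ = A at *
    generalize MvPowerSeries.subst (upComp σ) u₂ = U at *
    linear_combination (-(g₀ 2 : Formal 2) ^ 2 * a₁ * A) * hτ -
      ((g₀ 2 : Formal 2) ^ 2 * a₁ *
        (1 - MvPowerSeries.X 1 * τ + (g₀ 2 : Formal 2) * partialD 0 τ)) * hS +
      ((g₀ 2 : Formal 2) ^ 2 * (1 - MvPowerSeries.X 1 * τ) ^ 2 * A) * i₁
  have h1 := subst_fsum_dividedPow hσ hconj (MvPowerSeries.X 0)
  have hv₂ : MvPowerSeries.X 0 + v₂ * (g₀ 2 : Formal 2) ^ 2 ∈ ordIdeal 2 1 :=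
    X_zero_add_mem (Ideal.mul_mem_left _ _ (Ideal.pow_mem_of_mem _ g₀_mem_ordIdeal 2 two_pos))
  rwa [← f₂, ← f₁, MvPowerSeries.subst_X (hasSubst_upComp hv₂), MvPowerSeries.subst_X hs,
    upComp_zero, upComp_zero] at h1

/-! ### The criterion for special formal conjugation -/

theorem constantCoeff_partialD_two_two (hn : 2 ≤ n) (v : Formal n) :
    MvPowerSeries.constantCoeff (partialD 2 (partialD 2
      (MvPowerSeries.X 0 + v * (g₀ n : Formal n) ^ 2))) = 2 * MvPowerSeries.constantCoeff v := by
  have hg0 : MvPowerSeries.constantCoeff (g₀ n : Formal n) = 0 := mem_ordIdeal_one.mp g₀_mem_ordIdeal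
  have h1 : partialD 2 (MvPowerSeries.X 0 + v * (g₀ n : Formal n) ^ 2) =
      (g₀ n : Formal n) * ((g₀ n : Formal n) * partialD 2 v + 2 * v) := by
    have h2 := partialD_mul 2 v ((g₀ n : Formal n) * (g₀ n : Formal n))
    have h3 := partialD_mul 2 (g₀ n : Formal n) (g₀ n : Formal n)
    have h4 : partialD 2 (MvPowerSeries.X 0 : Formal n) = 0 := partialD_X_ne (fin_zero_ne_two hn)
    rw [h3, partialD_two_g₀ hn] at h2
    simp only [partialD] at *
    rw [map_add, sq, h2, h4]
    ring
  rw [h1, partialD_mul, partialD_two_g₀ hn]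
  simp only [map_add, map_mul, hg0, zero_mul, map_ofNat, zero_add, one_mul]

/-- The formal diffeomorphism `(x + (x₂ - x x₁) τ, x₁, x₂)`. -/
def upDiff (τ : Formal 2) : FormalDiff 2 where
  comp := upComp (MvPowerSeries.X 0 + (g₀ 2 : Formal 2) * τ)
  map_zero := fun i => mem_ordIdeal_one.mp
    (upComp_mem (X_zero_add_mem (Ideal.mul_mem_right _ _ g₀_mem_ordIdeal)) i)
  jacobian := by
    have hn : 2 ≤ 2 := le_rfl
    have hg0 : MvPowerSeries.constantCoeff (g₀ 2 : Formal 2) = 0 := mem_ordIdeal_one.mp g₀_mem_ordIdeal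
    have h1 := partialD_mul 0 (g₀ 2 : Formal 2) τ
    have h2 : partialD 0 (MvPowerSeries.X 0 + (g₀ 2 : Formal 2) * τ) =
        partialD 0 (MvPowerSeries.X 0) + partialD 0 ((g₀ 2 : Formal 2) * τ) := map_add _ _ _
    have h3 : ∀ i : Fin 3, partialD i (MvPowerSeries.X i : Formal 2) = 1 :=
      fun i => MvPowerSeries.pderiv_X_self
    have h4 : MvPowerSeries.constantCoeff
        (partialD 0 (MvPowerSeries.X 0 + (g₀ 2 : Formal 2) * τ)) = 1 := by
      rw [h2, h1, h3, partialD_zero_g₀ hn]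
      simp [hg0]
    have e1 : upComp (MvPowerSeries.X 0 + (g₀ 2 : Formal 2) * τ) 1 = MvPowerSeries.X 1 :=
      upComp_ne _ (by decide)
    have e2 : upComp (MvPowerSeries.X 0 + (g₀ 2 : Formal 2) * τ) 2 = MvPowerSeries.X 2 :=
      upComp_ne _ (by decide)
    rw [Matrix.det_fin_three]
    simp only [Matrix.of_apply, e1, e2, upComp_zero, h4, h3,
      partialD_X_ne (show (1 : Fin 3) ≠ 0 by decide), partialD_X_ne (show (1 : Fin 3) ≠ 2 by decide),
      partialD_X_ne (show (2 : Fin 3) ≠ 0 by decide), partialD_X_ne (show (2 : Fin 3) ≠ 1 by decide)]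
    simp

theorem comp_eq_upComp {φ : AnalyticDiff n} {v : Conv n} (h : IsUp φ)
    (hv : φ.comp 0 - coord n 0 = v * f₀ n) : (fun j => (φ.comp j : Formal n)) =
      upComp (MvPowerSeries.X 0 + (v : Formal n) * (g₀ n : Formal n) ^ 2) := by
  funext j
  by_cases hj : j = 0
  · rw [hj, upComp_zero, eq_add_of_sub_eq' hv]
    rfl
  · rw [upComp_ne _ hj, h.1 j hj]
    rfl

theorem formallySpeciallyConjugated_iff {φ₁ φ₂ : AnalyticDiff 2} (h₁ : φ₁ ∈ DSet (f₀ 2))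
    (h₂ : φ₂ ∈ DSet (f₀ 2)) : FormallySpeciallyConjugated φ₁ φ₂ ↔ SameResidues (g₀ 2) φ₁ φ₂ ∧
      MvPowerSeries.constantCoeff (partialD 2 (partialD 2 (φ₁.comp 0 : Formal 2))) =
        MvPowerSeries.constantCoeff (partialD 2 (partialD 2 (φ₂.comp 0 : Formal 2))) := by
  have hn : 2 ≤ 2 := le_rfl
  obtain ⟨p₁, v₁, hv₁, e₁⟩ := h₁
  obtain ⟨p₂, v₂, hv₂, e₂⟩ := h₂
  have c₁ := comp_eq_upComp p₁ e₁
  have c₂ := comp_eq_upComp p₂ e₂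
  have d₁ : (φ₁.comp 0 : Formal 2) = MvPowerSeries.X 0 + (v₁ : Formal 2) * (g₀ 2 : Formal 2) ^ 2 :=
    congrFun c₁ 0
  have d₂ : (φ₂.comp 0 : Formal 2) = MvPowerSeries.X 0 + (v₂ : Formal 2) * (g₀ 2 : Formal 2) ^ 2 :=
    congrFun c₂ 0
  rw [sameResidues_iff hn hv₁ hv₂ e₁ e₂, d₁, d₂, constantCoeff_partialD_two_two hn,
    constantCoeff_partialD_two_two hn, mul_right_inj' two_ne_zero]
  constructor
  · rintro ⟨σ, ⟨s1, s2⟩, hc⟩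
    -- The non-fibered part is a unit times g², and g is prime in the formal ring, so membership in
    -- the radical forces x ∘ σ - x to be a multiple of g.
    have s3 : (g₀ 2 : Formal 2) ∣ σ.comp 0 - MvPowerSeries.X 0 := by
      rw [e₁] at s2
      let d : IrredDecomp (v₁ * f₀ 2) := decompUnitMul hn hv₁.unit
      obtain ⟨k, hk⟩ := s2 d
      rw [IrredDecomp.fN_eq hn hv₁ rfl, Ideal.mem_span_singleton] at hk
      refine (prime_coe_g₀ hn).dvd_of_dvd_pow (dvd_trans ⟨(v₁ : Formal 2) * (g₀ 2 : Formal 2), ?_⟩ hk)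
      change (v₁ : Formal 2) * (g₀ 2 : Formal 2) ^ 2 = _
      ring
    obtain ⟨τ, hτ⟩ := s3
    have s4 : σ.comp = upComp (MvPowerSeries.X 0 + (g₀ 2 : Formal 2) * τ) := by
      funext j
      by_cases hj : j = 0
      · rw [hj, upComp_zero, ← hτ, add_sub_cancel]
      · rw [upComp_ne _ hj, s1 j hj]
    have h := hc 0
    rw [c₁, s4, d₂, upComp_zero] at h
    exact (invariants_of_conjugated hn h).symm
  · rintro ⟨hW, h0⟩
    have hv0 : MvPowerSeries.constantCoeff (v₁ : Formal 2) ≠ 0 :=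
      (hv₁.map (MvPowerSeries.constantCoeff.comp (Conv 2).val.toRingHom)).ne_zero
    obtain ⟨τ, hτ⟩ := exists_conjugation hv0 h0 hW
    -- The exponent 2 suffices for the radical: (g τ)² is a multiple of g², which is f_N up to a
    -- unit.
    refine ⟨upDiff τ, ⟨fun j hj => upComp_ne _ hj, fun d => ⟨2, ?_⟩⟩, fun i => ?_⟩
    · rw [d.fN_eq hn hv₁ e₁, e₁, Ideal.mem_span_singleton]
      obtain ⟨w, rfl⟩ := hv₁
      have h1 : ((w : Conv 2) : Formal 2) * (((w⁻¹ : (Conv 2)ˣ) : Conv 2) : Formal 2) = 1 :=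
        congrArg Subtype.val w.mul_inv
      refine ⟨(((w⁻¹ : (Conv 2)ˣ) : Conv 2) : Formal 2) * τ ^ 2, ?_⟩
      have h2 : (upDiff τ).comp 0 - MvPowerSeries.X 0 = (g₀ 2 : Formal 2) * τ := by
        change upComp (MvPowerSeries.X 0 + (g₀ 2 : Formal 2) * τ) 0 - _ = _
        rw [upComp_zero, add_sub_cancel_left]
      have h3 : ((w * f₀ 2 : Conv 2) : Formal 2) =
        ((w : Conv 2) : Formal 2) * (g₀ 2 : Formal 2) ^ 2 := rfl
      rw [h2, h3]
      linear_combination (-(g₀ 2 : Formal 2) ^ 2 * τ ^ 2) * h1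
    · have hs : MvPowerSeries.HasSubst (upComp (MvPowerSeries.X 0 + (g₀ 2 : Formal 2) * τ)) :=
        hasSubst_upComp (X_zero_add_mem (Ideal.mul_mem_right _ _ g₀_mem_ordIdeal))
      have hs₁ : MvPowerSeries.HasSubst
          (upComp (MvPowerSeries.X 0 + (v₁ : Formal 2) * (g₀ 2 : Formal 2) ^ 2)) :=
        hasSubst_upComp (X_zero_add_mem
          (Ideal.mul_mem_left _ _ (Ideal.pow_mem_of_mem _ g₀_mem_ordIdeal 2 two_pos)))
      rw [c₁]
      change MvPowerSeries.subst (upComp (MvPowerSeries.X 0 + (g₀ 2 : Formal 2) * τ)) _ =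
        MvPowerSeries.subst _ (upComp (MvPowerSeries.X 0 + (g₀ 2 : Formal 2) * τ) i)
      rw [show (φ₂.comp i : Formal 2) = _ from congrFun c₂ i]
      by_cases hi : i = 0
      · rw [hi, upComp_zero, upComp_zero]
        exact hτ
      · rw [upComp_ne _ hi, upComp_ne _ hi, MvPowerSeries.subst_X hs, MvPowerSeries.subst_X hs₁,
          upComp_ne _ hi, upComp_ne _ hi]

end

theorem mainTheorem11 :
    (∀ n : ℕ, 2 ≤ n →
      (∀ A ∈ Fr (f₀ n), A ∈ Sp (f₀ n) ↔ A ∈ Ideal.span {coord n 1, coord n 2}) ∧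
      (∃ e : convIndep n {0, 1, 2} ≃ₗ[ℂ] FrModSp (f₀ n),
        ∀ c : convIndep n {0, 1, 2}, (c : Conv n) * E₀ n ∈ Fr (f₀ n) ∧
          (e c : Conv n ⧸ Sp (f₀ n)) = Submodule.Quotient.mk ((c : Conv n) * E₀ n)) ∧
      (n = 2 → Module.rank ℂ (FrModSp (f₀ n)) = 1) ∧
      (3 ≤ n → ¬ FiniteDimensional ℂ (FrModSp (f₀ n)))) ∧
    (∀ φ₁ ∈ DSet (f₀ 2), ∀ φ₂ ∈ DSet (f₀ 2),
      FormallySpeciallyConjugated φ₁ φ₂ ↔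
        SameResidues (g₀ 2) φ₁ φ₂ ∧
          MvPowerSeries.constantCoeff (partialD 2 (partialD 2 (φ₁.comp 0 : Formal 2))) =
            MvPowerSeries.constantCoeff (partialD 2 (partialD 2 (φ₂.comp 0 : Formal 2)))) := by
  refine ⟨fun n hn => ⟨fun A hA => mem_Sp_f₀_iff hn hA, ?_, ?_, ?_⟩,
    fun φ₁ h₁ φ₂ h₂ => formallySpeciallyConjugated_iff h₁ h₂⟩
  · refine ⟨LinearEquiv.ofBijective (toFrModSp hn) (toFrModSp_bijective hn), fun c => ?_⟩
    rw [E₀, mul_one]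
    exact ⟨coe_mem_Fr_f₀ hn c, rfl⟩
  · rintro rfl
    rw [← (LinearEquiv.ofBijective (toFrModSp hn) (toFrModSp_bijective hn)).rank_eq]
    exact rank_convIndep_two
  · intro h3 h
    exact not_finiteDimensional_convIndep h3
      (Module.Finite.equiv (LinearEquiv.ofBijective (toFrModSp hn) (toFrModSp_bijective hn)).symm)
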